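/- **Setting.** Let $X_0\in\mathbb R^{d_1\times d_2}$ be nonzero. For a real matrix $X$, $\|X\|_1$ is the sum of the absolute values of the entries, $\|X\|_{1,2}$ the sum of the Euclidean norms of the columns, $\|X\|_\star$ the nuclear norm, $\|X\|_F$ the Frobenius norm, $\|X\|_0$ the number of nonzero entries and $\|X\|_{0,2}$ the number of nonzero columns; $\bar X=X/\|X\|_F$. $\mathbb S^d$ and $\mathbb S^d_+$ are the symmetric and the positive semidefinite $d\times d$ matrices. $X_0$ is *S&L with $(k_1,k_2,r)$* if the smallest submatrix containing all nonzero entries of $X_0$ has size $k_1\times k_2$ and $\operatorname{rank}X_0=r$. Measurements are $\mathcal A(X)=\mathbf A\operatorname{vec}(X)\in\mathbb R^m$, where $\mathbf A\in\mathbb R^{m\times d_1d_2}$ has independent $\mathcal N(0,1)$ entries. For a function $f$ and a set $\mathcal C$ of matrices consider the program $$\min_{X\in\mathcal C} f(X)\quad\text{subject to}\quad \mathcal A(X)=\mathcal A(X_0).\tag{P}$$ (P) *fails to recover* $X_0$ if $X_0$ is not a minimizer of (P); it *uniquely recovers* $X_0$ if $X_0$ is the unique minimizer. "With probability $p$" means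 with probability at least $p$. **Theorem.** In each item below there are constants $c_1,c_2>0$, absolute except that in the last sentence of (c2) they may depend on $\theta$ (and possibly different in different items), such that the following holds for all $m,d_1,d_2$ (resp. $m,d$) and every nonzero $X_0$ as described. (a) *General model*: $X_0\in\mathbb R^{d_1\times d_2}$ is S&L with $(k_1,k_2,r)$, and $\mathcal C=\mathbb R^{d_1\times d_2}$. * (a1) Let $m_0=\min\{d_1k_2,\;d_2k_1,\;(d_1+d_2)r\}$. If $m\le c_2m_0$, then with probability $1-\exp(-c_1m_0)$, for all $\lambda_1,\lambda_2\ge0$ simultaneously, (P) with $f(X)=\|X\|_{1,2}+\lambda_1\|X^T\|_{1,2}+\lambda_2\|X\|_\star$ fails to recover $X_0$. * (a2) Let $f(X)=\frac1{k_2}\|X\|_{0,2}+\frac1{k_1}\|X^T\|_{0,2}+\frac1r\operatorname{rank}(X)$. If $m\ge c_2\max\{(k_1+k_2)r,\;k_1\log\frac{d_1}{k_1},\;k_2\log\frac{d_2}{k_2}\}$, then (P) uniquely recovers $X_0$ with probability $1-\exp(-c_1m)$. (b) *PSD with $\ell_{1,2}$*: $X_0\in\mathbb S^d_+$ is S&L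 with $(k,k,r)$. * (b1) Let $\mathcal C=\mathbb S^d_+$. If $m\le c_2rd$, then with probability $1-\exp(-c_1rd)$, for all $\lambda\ge0$ simultaneously, (P) with $f(X)=\|X\|_{1,2}+\lambda\|X\|_\star$ fails to recover $X_0$. * (b2) Let $f(X)=\frac2k\|X\|_{0,2}+\frac1r\operatorname{rank}(X)$ and $\mathcal C=\mathbb S^d$. If $m\ge c_2\max\{rk,\;k\log\frac dk\}$, then (P) uniquely recovers $X_0$ with probability $1-\exp(-c_1m)$. (c) *PSD with $\ell_1$*: $X_0\in\mathbb S^d_+$ is S&L with $(k,k,r)$. * (c1) Let $\mathcal C=\mathbb S^d_+$ and $m_0=\min\{\|\bar X_0\|_1^2,\;\|\bar X_0\|_\star^2\,d\}$. If $m\le c_2m_0$, then with probability $1-\exp(-c_1m_0)$, for all $\lambda\ge0$ simultaneously, (P) with $f(X)=\|X\|_1+\lambda\|X\|_\star$ fails to recover $X_0$. * (c2) Suppose $r=1$, and let $f(X)=\frac1{k^2}\|X\|_0+\operatorname{rank}(X)$ and $\mathcal C=\mathbb S^d$. If $m\ge c_2\max\{k,\;k\log\frac dk\}$, then (P) uniquely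 recovers $X_0$ with probability $1-\exp(-c_1m)$. In particular, for every $\theta\in(0,1)$ there are $c_1,c_2>0$ depending only on $\theta$ such that, whenever $k\le\theta d$ and $m\ge c_2\,k\log\frac dk$, (P) uniquely recovers $X_0$ with probability $1-\exp(-c_1m)$. -/

import Mathlib

noncomputable section

namespace SparseLowRank

open MeasureTheory ProbabilityTheory

/-! ### Norms and structure counts of a real matrix -/

/-- The entrywise norm `‖X‖₁`. -/
def l1Norm {d₁ d₂ : ℕ} (X : Matrix (Fin d₁) (Fin d₂) ℝ) : ℝ := ∑ i, ∑ j, |X i j|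

/-- The Frobenius norm `‖X‖_F`. -/
def frobNorm {d₁ d₂ : ℕ} (X : Matrix (Fin d₁) (Fin d₂) ℝ) : ℝ :=
  Real.sqrt (∑ i, ∑ j, X i j ^ 2)

/-- The norm `‖X‖_{1,2}`: the sum of the Euclidean norms of the columns. -/
def l12Norm {d₁ d₂ : ℕ} (X : Matrix (Fin d₁) (Fin d₂) ℝ) : ℝ :=
  ∑ j, Real.sqrt (∑ i, X i j ^ 2)

/-- The nuclear norm: the sum of the singular values. `LinearMap.singularValues` lists the
singular values in decreasing order, indexed by `ℕ`, and it vanishes from the index `d₂` on. -/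
def nuclearNorm {d₁ d₂ : ℕ} (X : Matrix (Fin d₁) (Fin d₂) ℝ) : ℝ :=
  ∑ i ∈ Finset.range d₂, (Matrix.toEuclideanLin X).singularValues i

/-- `‖X‖₀`: the number of nonzero entries. -/
def l0Count {d₁ d₂ : ℕ} (X : Matrix (Fin d₁) (Fin d₂) ℝ) : ℕ :=
  {p : Fin d₁ × Fin d₂ | X p.1 p.2 ≠ 0}.ncard

/-- `‖X‖_{0,2}`: the number of nonzero columns. -/
def l02Count {d₁ d₂ : ℕ} (X : Matrix (Fin d₁) (Fin d₂) ℝ) : ℕ :=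
  {j : Fin d₂ | ∃ i, X i j ≠ 0}.ncard

/-- The normalization of `X` to unit Frobenius norm. -/
def normalized {d₁ d₂ : ℕ} (X : Matrix (Fin d₁) (Fin d₂) ℝ) : Matrix (Fin d₁) (Fin d₂) ℝ :=
  (frobNorm X)⁻¹ • X

/-- The submatrix with row set `I` and column set `J` contains all nonzero entries of `X`. -/
def SupportedOn {d₁ d₂ : ℕ} (X : Matrix (Fin d₁) (Fin d₂) ℝ)
    (I : Finset (Fin d₁)) (J : Finset (Fin d₂)) : Prop :=
  ∀ i j, X i j ≠ 0 → i ∈ I ∧ j ∈ J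

/-- `X` is a simultaneously sparse and low-rank matrix with parameters `(k₁, k₂, r)`: the
smallest submatrix that contains all nonzero entries of `X` has size `k₁ × k₂`, and `X` has
rank `r`. -/
def IsSL {d₁ d₂ : ℕ} (X : Matrix (Fin d₁) (Fin d₂) ℝ) (k₁ k₂ r : ℕ) : Prop :=
  (∃ (I : Finset (Fin d₁)) (J : Finset (Fin d₂)),
    SupportedOn X I J ∧ (∀ I' J', SupportedOn X I' J' → I ⊆ I' ∧ J ⊆ J') ∧
      I.card = k₁ ∧ J.card = k₂) ∧
  X.rank = r

/-! ### Gaussian measurements and recovery programs -/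

/-- The law of an `m × (d₁ d₂)` matrix with independent standard normal entries. The columns
are indexed by the coordinates of the vectorization `Matrix.vec` of a `d₁ × d₂` matrix. -/
def gaussianEnsemble (m d₁ d₂ : ℕ) : Measure (Fin m → Fin d₂ × Fin d₁ → ℝ) :=
  Measure.pi fun _ => Measure.pi fun _ => gaussianReal 0 1

/-- The measurement operator `X ↦ A vec(X)`. -/
def measurements {m d₁ d₂ : ℕ} (A : Fin m → Fin d₂ × Fin d₁ → ℝ) (X : Matrix (Fin d₁) (Fin d₂) ℝ) :
    Fin m → ℝ :=
  (Matrix.of A).mulVec X.vec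

/-- The feasible set of the recovery program. -/
def feasible {m d₁ d₂ : ℕ} (C : Set (Matrix (Fin d₁) (Fin d₂) ℝ))
    (A : Fin m → Fin d₂ × Fin d₁ → ℝ) (X₀ : Matrix (Fin d₁) (Fin d₂) ℝ) :
    Set (Matrix (Fin d₁) (Fin d₂) ℝ) :=
  {X | X ∈ C ∧ measurements A X = measurements A X₀}

/-- `X₀` is not a minimizer of `f` over all `X ∈ C` with the same measurements as `X₀`. -/
def FailsToRecover {m d₁ d₂ : ℕ} (f : Matrix (Fin d₁) (Fin d₂) ℝ → ℝ)
    (C : Set (Matrix (Fin d₁) (Fin d₂) ℝ)) (A : Fin m → Fin d₂ × Fin d₁ → ℝ)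
    (X₀ : Matrix (Fin d₁) (Fin d₂) ℝ) : Prop :=
  ¬ (X₀ ∈ feasible C A X₀ ∧ IsMinOn f (feasible C A X₀) X₀)

/-- `X₀` is the unique minimizer of `f` over all `X ∈ C` with the same measurements as `X₀`. -/
def UniquelyRecovers {m d₁ d₂ : ℕ} (f : Matrix (Fin d₁) (Fin d₂) ℝ → ℝ)
    (C : Set (Matrix (Fin d₁) (Fin d₂) ℝ)) (A : Fin m → Fin d₂ × Fin d₁ → ℝ)
    (X₀ : Matrix (Fin d₁) (Fin d₂) ℝ) : Prop :=
  X₀ ∈ feasible C A X₀ ∧ ∀ X ∈ feasible C A X₀, X ≠ X₀ → f X₀ < f X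

/-- `E` holds with probability at least `1 - δ` under the probability measure `μ`: its complement has (outer) measure
at most `δ`, that is, it lies in a measurable set of measure at most `δ`. -/
def HoldsExceptWithProb {Ω : Type*} [MeasurableSpace Ω] (μ : Measure Ω) (δ : ℝ) (E : Ω → Prop) : Prop :=
  μ {ω | ¬ E ω} ≤ ENNReal.ofReal δ

/-- The positive semidefinite cone (symmetric matrices with nonnegative quadratic form). -/
def psdCone (d : ℕ) : Set (Matrix (Fin d) (Fin d) ℝ) := {X | X.PosSemidef}

/-- The space of symmetric matrices. -/
def symMatrices (d : ℕ) : Set (Matrix (Fin d) (Fin d) ℝ) := {X | X.IsSymm}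

end SparseLowRank

end

namespace SparseLowRank

open MeasureTheory ProbabilityTheory
open scoped ENNReal

/-! Failure of the convex programs, (a1), (b1), (c1). Let `A` be the measurement map. `X₀` is not a
minimizer once it can be moved along a path `X₀ - tE + t²E'` on which the objective drops at a rate
`δ`, and the measurement error, of size about `t‖A(E)‖`, can be cancelled by a further admissible
summand costing less than `tδ`. Cancelling is cheap: when `m` is a small multiple of `m₀`, the image
under `A` of the Frobenius unit ball contains a ball of radius `s` of order `√(d₁d₂)`, while
`‖A(E)‖²` is at most a small multiple of `m₀‖E‖_F²` or of a bound for it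
(`exists_const_solvable_and_small`). If the objective is `L`-Lipschitz in the Frobenius norm,
failure follows from `L‖A(E)‖ < δs` (`failsToRecover_of_path`).

For `‖·‖_{1,2}`, `E` is `X₀` with normalized columns: `δ` and `‖E‖_F²` both equal `k₂`, `L = √d₂`,
and the inequality becomes `m₀ ≲ d₁k₂`. For the nuclear norm, `E = UVᵀ` and both numbers equal `r`.
With several penalties, the path is the one adapted to a dominating penalty, and it does not
increase the others; for (c1) plain scaling towards `0` serves both penalties. The good event never
mentions the weights, so failure holds for all weights at once.

With the positive semidefinite constraint the correction must itself be positive semidefinite. The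
intersection of the cone with the unit ball still has support function of order `d` at a Gaussian
matrix, with failure probability `exp(-c d²)` (`stdGauss_not_exists_mem_psdBall`). The witnesses are
block matrices with identity diagonal blocks and an orthonormal off-diagonal block, found by running
Gram–Schmidt greedily along Gaussian vectors (`pi_stdGauss_pairingLE`).

Recovery, (a2), (b2), (c2), is a dimension count. A competitor `X` with `f X ≤ f X₀` has rank and
support comparable to those of `X₀`, so `X - X₀` lies in a family with fewer than `m` parameters.
The measurement matrices whose kernel meets such a family away from `0` form a Lebesgue null set
(`gaussianEnsemble_exists_kernel_eq_zero`), so recovery is almost sure. -/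

/-- The standard Gaussian measure on `ι → ℝ`. -/
noncomputable def stdGauss (ι : Type*) [Fintype ι] : Measure (ι → ℝ) :=
  Measure.pi fun _ => gaussianReal 0 1

instance stdGauss.instIsProbabilityMeasure (ι : Type*) [Fintype ι] :
    IsProbabilityMeasure (stdGauss ι) := by
  unfold stdGauss; infer_instance

/-! ### Gaussian vectors: rotation invariance and tails of the squared norm -/

section

variable {ι κ : Type*} [Fintype ι] [Fintype κ]

theorem charFun_stdGauss (t : EuclideanSpace ℝ ι) :
    charFun ((stdGauss ι).map (WithLp.toLp 2)) t = Complex.exp (-((∑ i, t i ^ 2 : ℝ) : ℂ) / 2) := by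
  rw [stdGauss, map_pi_eq_stdGaussian, charFun_stdGaussian, ← Complex.ofReal_pow,
    EuclideanSpace.real_norm_sq_eq]

/-- The image of a standard Gaussian vector under a matrix with orthonormal rows is standard
Gaussian. -/
theorem stdGauss_map_of_orthonormal_rows [DecidableEq κ] (B : κ → ι → ℝ)
    (hB : ∀ i j, ∑ p, B i p * B j p = if i = j then 1 else 0) :
    (stdGauss ι).map (fun x i => ∑ p, B i p * x p) = stdGauss κ := by
  have hmeas : Measurable (fun (x : ι → ℝ) i => ∑ p, B i p * x p) := by fun_prop
  have : IsProbabilityMeasure ((stdGauss ι).map (fun x i => ∑ p, B i p * x p)) :=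
    Measure.isProbabilityMeasure_map hmeas.aemeasurable
  have e : (MeasurableEquiv.toLp 2 (κ → ℝ) : (κ → ℝ) → EuclideanSpace ℝ κ) = WithLp.toLp 2 :=
    MeasurableEquiv.coe_toLp ..
  apply (MeasurableEquiv.toLp 2 (κ → ℝ)).map_measurableEquiv_injective
  refine Measure.ext_of_charFun (E := EuclideanSpace ℝ κ) <| funext fun t ↦ ?_
  rw [e, charFun_stdGauss]
  -- Pairing with `t` moves `B` to `Bᵀt`, and orthonormality of the rows gives `‖Bᵀt‖ = ‖t‖`.
  have key : charFun (((stdGauss ι).map (fun x i => ∑ p, B i p * x p)).map (WithLp.toLp 2)) t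
      = charFun ((stdGauss ι).map (WithLp.toLp 2))
        (WithLp.toLp 2 (fun p => ∑ i, B i p * t i) : EuclideanSpace ℝ ι) := by
    have h1 : Measurable (WithLp.toLp 2 : (κ → ℝ) → EuclideanSpace ℝ κ) := WithLp.measurable_toLp 2 _
    have h2 : Measurable (WithLp.toLp 2 : (ι → ℝ) → EuclideanSpace ℝ ι) := WithLp.measurable_toLp 2 _
    rw [charFun_apply, charFun_apply, Measure.map_map h1 hmeas,
      integral_map (h1.comp hmeas).aemeasurable (by fun_prop),
      integral_map h2.aemeasurable (by fun_prop)]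
    congr 1
    ext x
    congr 3
    simp only [PiLp.inner_apply, RCLike.inner_apply, conj_trivial, Function.comp,
      Finset.mul_sum, Finset.sum_mul]
    rw [Finset.sum_comm]
    refine Finset.sum_congr rfl fun p _ => Finset.sum_congr rfl fun i _ => by ring
  rw [key, charFun_stdGauss]
  congr 4
  calc ∑ p, (∑ i, B i p * t i) ^ 2
      = ∑ p, ∑ i, ∑ j, t i * t j * (B i p * B j p) := by
        refine Finset.sum_congr rfl fun p _ => ?_
        rw [sq, Finset.sum_mul_sum]
        exact Finset.sum_congr rfl fun i _ => Finset.sum_congr rfl fun j _ => by ring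
    _ = ∑ i, ∑ j, t i * t j * ∑ p, B i p * B j p := by
        rw [Finset.sum_comm]
        refine Finset.sum_congr rfl fun i _ => ?_
        rw [Finset.sum_comm]
        exact Finset.sum_congr rfl fun j _ => by rw [Finset.mul_sum]
    _ = ∑ i, t i ^ 2 := by
        simp [hB, sq]

theorem stdGauss_map_curry :
    (stdGauss (κ × ι)).map (fun x (i : κ) (p : ι) => x (i, p))
      = Measure.pi fun _ : κ => stdGauss ι := by
  symm
  unfold stdGauss
  have hc : Measurable (fun (x : κ × ι → ℝ) (i : κ) (p : ι) => x (i, p)) := by fun_prop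
  have hu : Measurable (fun (y : κ → ι → ℝ) (q : κ × ι) => y q.1 q.2) := by fun_prop
  have h : Measure.pi (fun _ : κ × ι => gaussianReal 0 1)
      = (Measure.pi fun _ : κ => Measure.pi fun _ : ι => gaussianReal 0 1).map
        (fun y q => y q.1 q.2) := by
    refine Measure.pi_eq fun s hs => ?_
    rw [Measure.map_apply hu (MeasurableSet.univ_pi hs)]
    have : (fun (y : κ → ι → ℝ) (q : κ × ι) => y q.1 q.2) ⁻¹' Set.univ.pi s
        = Set.univ.pi fun i => Set.univ.pi fun p => s (i, p) := by
      ext y; simp [Set.mem_pi]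
    rw [this, Measure.pi_pi]
    simp_rw [Measure.pi_pi]
    rw [Fintype.prod_prod_type]
  rw [h, Measure.map_map hc hu]
  exact Measure.map_id.symm

/-- Both signs of `b` matter: `b = -1/4` serves the upper tail of a squared norm, `b = 1` the lower
tail. -/
theorem lintegral_exp_neg_mul_sq (b : ℝ) (hb : 0 < 1 / 2 + b) :
    ∫⁻ x, ENNReal.ofReal (Real.exp (-b * x ^ 2)) ∂(gaussianReal 0 1)
      = ENNReal.ofReal (Real.sqrt (1 / (1 + 2 * b))) := by
  have hc : (1 : NNReal) ≠ 0 := one_ne_zero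
  rw [gaussianReal_of_var_ne_zero 0 hc, lintegral_withDensity_eq_lintegral_mul _
    (measurable_gaussianPDF 0 1) (by fun_prop)]
  have : ∀ x : ℝ, (gaussianPDF 0 1 * fun x => ENNReal.ofReal (Real.exp (-b * x ^ 2))) x
      = ENNReal.ofReal ((Real.sqrt (2 * Real.pi))⁻¹ * Real.exp (-(1 / 2 + b) * x ^ 2)) := by
    intro x
    rw [Pi.mul_apply, gaussianPDF, ← ENNReal.ofReal_mul (gaussianPDFReal_nonneg _ _ _),
      gaussianPDFReal]
    congr 1
    simp only [NNReal.coe_one, mul_one, sub_zero]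
    rw [mul_assoc, ← Real.exp_add]
    congr 2; ring
  simp_rw [this]
  rw [← ofReal_integral_eq_lintegral_ofReal
    ((integrable_exp_neg_mul_sq hb).const_mul _)
    (Filter.Eventually.of_forall fun x => by positivity)]
  congr 1
  rw [integral_const_mul, integral_gaussian, ← Real.sqrt_inv, ← Real.sqrt_mul (by positivity)]
  congr 1
  have := Real.pi_pos.ne'
  have h2 : (1 + 2 * b) ≠ 0 := by linarith
  have h3 : (1/2 + b) ≠ 0 := hb.ne'
  field_simp
  try ring

theorem lintegral_exp_neg_mul_sum_sq (b : ℝ) (hb : 0 < 1 / 2 + b) :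
    ∫⁻ x, ENNReal.ofReal (Real.exp (-b * ∑ i, x i ^ 2)) ∂(stdGauss ι)
      = ENNReal.ofReal (Real.sqrt (1 / (1 + 2 * b))) ^ Fintype.card ι := by
  have : ∀ x : ι → ℝ, ENNReal.ofReal (Real.exp (-b * ∑ i, x i ^ 2))
      = ∏ i, ENNReal.ofReal (Real.exp (-b * x i ^ 2)) := by
    intro x
    rw [Finset.mul_sum, Real.exp_sum, ENNReal.ofReal_prod_of_nonneg fun _ _ => by positivity]
  have hf : Measurable fun x : ℝ => ENNReal.ofReal (Real.exp (-b * x ^ 2)) := by fun_prop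
  simp_rw [this, stdGauss]
  rw [lintegral_prod_eq_prod_lintegral_of_indepFun Finset.univ
    (fun i (x : ι → ℝ) => ENNReal.ofReal (Real.exp (-b * x i ^ 2)))
    (iIndepFun_pi (fun _ => hf.aemeasurable)) (fun i => by fun_prop)]
  rw [← Finset.card_univ, ← Finset.prod_const]
  refine Finset.prod_congr rfl fun i _ => ?_
  rw [← lintegral_exp_neg_mul_sq b hb,
    ← (measurePreserving_eval (fun _ : ι => gaussianReal 0 1) i).lintegral_comp hf]

theorem stdGauss_le_sum_sq (t : ℝ) :
    stdGauss ι {x | t ≤ ∑ i, x i ^ 2}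
      ≤ ENNReal.ofReal (Real.exp (Fintype.card ι / 2 - t / 4)) := by
  have h := lintegral_exp_neg_mul_sum_sq (ι := ι) (-(1 / 4)) (by norm_num)
  -- The mean of `exp (x²/4)` is `√2`, and `√2 ≤ e^{1/2}` because `2 ≤ e`.
  have h2 : ENNReal.ofReal (Real.sqrt (1 / (1 + 2 * (-(1 / 4)))))
      ≤ ENNReal.ofReal (Real.exp (1 / 2)) := by
    apply ENNReal.ofReal_le_ofReal
    rw [Real.sqrt_le_left (by positivity), ← Real.exp_nat_mul]
    have := Real.exp_one_gt_d9
    norm_num at *; linarith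
  calc stdGauss ι {x | t ≤ ∑ i, x i ^ 2}
      ≤ stdGauss ι {x | ENNReal.ofReal (Real.exp (t / 4))
          ≤ ENNReal.ofReal (Real.exp (-(-(1 / 4)) * ∑ i, x i ^ 2))} := by
        refine measure_mono fun x hx => ENNReal.ofReal_le_ofReal (Real.exp_le_exp.2 ?_)
        simp only [Set.mem_ofPred_eq] at hx
        linarith
    _ ≤ (∫⁻ x, ENNReal.ofReal (Real.exp (-(-(1 / 4)) * ∑ i, x i ^ 2)) ∂(stdGauss ι))
          / ENNReal.ofReal (Real.exp (t / 4)) :=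
        meas_ge_le_lintegral_div (Measurable.aemeasurable (by fun_prop)) (by positivity) ENNReal.ofReal_ne_top
    _ ≤ ENNReal.ofReal (Real.exp (1 / 2)) ^ Fintype.card ι
          / ENNReal.ofReal (Real.exp (t / 4)) := by
        rw [h]; gcongr
    _ = _ := by
        rw [← ENNReal.ofReal_pow (by positivity), ← ENNReal.ofReal_div_of_pos (by positivity),
          ← Real.exp_nat_mul, ← Real.exp_sub]
        congr 3; ring

theorem lintegral_exp_neg_sum_sq_le :
    ∫⁻ x, ENNReal.ofReal (Real.exp (-∑ i, x i ^ 2)) ∂(stdGauss ι)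
      ≤ ENNReal.ofReal (Real.exp (-(Fintype.card ι / 2))) := by
  have h := lintegral_exp_neg_mul_sum_sq (ι := ι) 1 (by norm_num)
  -- The mean of `exp (-x²)` is `1/√3`, and `1/√3 ≤ e^{-1/2}` because `e ≤ 3`.
  have h2 : ENNReal.ofReal (Real.sqrt (1 / (1 + 2 * 1)))
      ≤ ENNReal.ofReal (Real.exp (-(1 / 2))) := by
    apply ENNReal.ofReal_le_ofReal
    rw [Real.sqrt_le_left (by positivity), ← Real.exp_nat_mul]
    have := Real.exp_one_lt_d9
    rw [show ((2 : ℕ) : ℝ) * -(1 / 2) = -1 by norm_num, Real.exp_neg, one_div]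
    gcongr; norm_num; linarith
  simp only [neg_mul, one_mul] at h
  rw [h]
  refine (pow_le_pow_left₀ zero_le h2 _).trans_eq ?_
  rw [← ENNReal.ofReal_pow (by positivity), ← Real.exp_nat_mul]
  congr 2; ring

theorem stdGauss_sum_sq_le (t : ℝ) :
    stdGauss ι {x | ∑ i, x i ^ 2 ≤ t}
      ≤ ENNReal.ofReal (Real.exp (t - Fintype.card ι / 2)) := by
  calc stdGauss ι {x | ∑ i, x i ^ 2 ≤ t}
      ≤ stdGauss ι {x | ENNReal.ofReal (Real.exp (-t))
          ≤ ENNReal.ofReal (Real.exp (-∑ i, x i ^ 2))} := by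
        refine measure_mono fun x hx => ENNReal.ofReal_le_ofReal (Real.exp_le_exp.2 ?_)
        simp only [Set.mem_ofPred_eq] at hx
        linarith
    _ ≤ (∫⁻ x, ENNReal.ofReal (Real.exp (-∑ i, x i ^ 2)) ∂(stdGauss ι))
          / ENNReal.ofReal (Real.exp (-t)) :=
        meas_ge_le_lintegral_div (Measurable.aemeasurable (by fun_prop)) (by positivity) ENNReal.ofReal_ne_top
    _ ≤ ENNReal.ofReal (Real.exp (-(Fintype.card ι / 2))) / ENNReal.ofReal (Real.exp (-t)) := by
        gcongr; exact lintegral_exp_neg_sum_sq_le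
    _ = _ := by
        rw [← ENNReal.ofReal_div_of_pos (by positivity), ← Real.exp_sub]
        congr 2; ring

end

section

variable {ι κ : Type*} [Fintype ι] [Fintype κ]

/-- As a linear map of all entries of `A`, `A ↦ Aᵀy` has the rows `y ⊗ e_p`, which are orthonormal
because `y` is a unit vector. -/
theorem pi_stdGauss_map_vecMul (y : κ → ℝ) (hy : ∑ i, y i ^ 2 = 1) :
    (Measure.pi fun _ : κ => stdGauss ι).map (fun A p => ∑ i, y i * A i p) = stdGauss ι := by
  classical
  rw [← stdGauss_map_curry, Measure.map_map (by fun_prop) (by fun_prop),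
    ← stdGauss_map_of_orthonormal_rows (ι := κ × ι) (κ := ι)
      (fun p q => if q.2 = p then y q.1 else 0)]
  · congr 1
    ext x p
    simp [Fintype.sum_prod_type]
  · intro p q
    by_cases h : p = q
    · subst h
      simp [Fintype.sum_prod_type, ← sq, hy]
    · simp [Fintype.sum_prod_type, h, Ne.symm h]

theorem pi_stdGauss_map_mulVec (e : ι → ℝ) (he : ∑ p, e p ^ 2 = 1) :
    (Measure.pi fun _ : κ => stdGauss ι).map (fun A i => ∑ p, A i p * e p) = stdGauss κ := by
  classical
  rw [← stdGauss_map_curry, Measure.map_map (by fun_prop) (by fun_prop),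
    ← stdGauss_map_of_orthonormal_rows (ι := κ × ι) (κ := κ)
      (fun i q => if q.1 = i then e q.2 else 0)]
  · congr 1
    ext x p
    simp [Fintype.sum_prod_type, mul_comm]
  · intro p q
    by_cases h : p = q
    · subst h
      simp [Fintype.sum_prod_type, ← sq, he]
    · simp [Fintype.sum_prod_type, h, Ne.symm h]

end

/-! ### Nets on the unit sphere -/

section Net

variable {E : Type*} [NormedAddCommGroup E] [NormedSpace ℝ E]

open Metric Module Function in
-- Volume comparison: the balls of radius `ε/2` around the points are disjoint and lie in the ball
-- of radius `1 + ε/2`.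
theorem card_le_of_separated_of_norm_eq_one [FiniteDimensional ℝ E] {ε : ℝ} (hε : 0 < ε) (s : Finset E)
    (hs : ∀ c ∈ s, ‖c‖ = 1) (h : ∀ c ∈ s, ∀ d ∈ s, c ≠ d → ε < ‖c - d‖) :
    (s.card : ℝ) ≤ (1 + 2 / ε) ^ finrank ℝ E := by
  borelize E
  let μ : Measure E := Measure.addHaar
  have hδ : 0 < ε / 2 := by positivity
  have hρ : 0 < 1 + ε / 2 := by positivity
  have D : Set.Pairwise (s : Set E) (Disjoint on fun c => ball (c : E) (ε / 2)) := by
    rintro c hc d hd hcd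
    apply ball_disjoint_ball
    rw [dist_eq_norm]
    linarith [h c hc d hd hcd]
  have A_subset : (⋃ c ∈ s, ball (c : E) (ε / 2)) ⊆ ball (0 : E) (1 + ε / 2) := by
    refine Set.iUnion₂_subset fun x hx => ball_subset_ball' ?_
    rw [dist_zero_right, hs x hx, add_comm]
  have I : (s.card : ℝ≥0∞) * ENNReal.ofReal ((ε / 2) ^ finrank ℝ E) * μ (ball 0 1) ≤
      ENNReal.ofReal ((1 + ε / 2) ^ finrank ℝ E) * μ (ball 0 1) :=
    calc
      (s.card : ℝ≥0∞) * ENNReal.ofReal ((ε / 2) ^ finrank ℝ E) * μ (ball 0 1)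
          = μ (⋃ c ∈ s, ball (c : E) (ε / 2)) := by
        rw [measure_biUnion_finset D fun c _ => measurableSet_ball]
        simp only [μ.addHaar_ball_of_pos _ hδ, Finset.sum_const, nsmul_eq_mul, mul_assoc]
      _ ≤ μ (ball (0 : E) (1 + ε / 2)) := measure_mono A_subset
      _ = _ := by simp only [μ.addHaar_ball_of_pos _ hρ]
  have J : (s.card : ℝ≥0∞) * ENNReal.ofReal ((ε / 2) ^ finrank ℝ E)
      ≤ ENNReal.ofReal ((1 + ε / 2) ^ finrank ℝ E) :=
    (ENNReal.mul_le_mul_iff_left (measure_ball_pos _ _ zero_lt_one).ne' measure_ball_lt_top.ne).1 I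
  have K := ENNReal.toReal_le_of_le_ofReal (by positivity) J
  rw [ENNReal.toReal_mul, ENNReal.toReal_natCast, ENNReal.toReal_ofReal (by positivity),
    ← le_div_iff₀ (by positivity), ← div_pow] at K
  have e : (1 + ε / 2) / (ε / 2) = 1 + 2 / ε := by field_simp; ring
  rwa [e] at K

/-- The unit sphere has an `ε`-net with at most `exp (2 dim / ε)` points. -/
theorem exists_net_sphere [FiniteDimensional ℝ E] {ε : ℝ} (hε : 0 < ε) :
    ∃ T : Finset E, (∀ t ∈ T, ‖t‖ = 1) ∧
      (T.card : ℝ) ≤ (1 + 2 / ε) ^ Module.finrank ℝ E ∧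
      ∀ y : E, ‖y‖ = 1 → ∃ t ∈ T, ‖y - t‖ ≤ ε := by
  classical
  let P : Finset E → Prop := fun s =>
    (∀ c ∈ s, ‖c‖ = 1) ∧ ∀ c ∈ s, ∀ d ∈ s, c ≠ d → ε < ‖c - d‖
  let N : Set ℕ := {n | ∃ s, P s ∧ s.card = n}
  have hbdd : BddAbove N := by
    refine ⟨⌊(1 + 2 / ε) ^ Module.finrank ℝ E⌋₊, ?_⟩
    rintro _ ⟨s, hs, rfl⟩
    exact Nat.le_floor (card_le_of_separated_of_norm_eq_one hε s hs.1 hs.2)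
  have hne : N.Nonempty := ⟨0, ∅, ⟨by simp, by simp⟩, rfl⟩
  -- A separated set of maximal size is a net: a unit vector at distance more than `ε` from all its
  -- points could be added to it.
  obtain ⟨T, hT, hcard⟩ := Nat.sSup_mem hne hbdd
  refine ⟨T, hT.1, card_le_of_separated_of_norm_eq_one hε T hT.1 hT.2, fun y hy => ?_⟩
  by_contra! hfar
  have hyT : y ∉ T := fun hyT => by
    have := hfar y hyT
    simp at this
    linarith
  have hP : P (insert y T) := by
    refine ⟨by simpa [hy] using hT.1, ?_⟩
    intro c hc d hd hcd
    rcases Finset.mem_insert.1 hc with rfl | hc' <;> rcases Finset.mem_insert.1 hd with rfl | hd'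
    · exact absurd rfl hcd
    · exact hfar d hd'
    · rw [norm_sub_rev]; exact hfar c hc'
    · exact hT.2 c hc' d hd' hcd
  have := le_csSup hbdd ⟨_, hP, rfl⟩
  rw [Finset.card_insert_of_notMem hyT, hcard] at this
  omega

/-- Writing `y = t + (y - t)` gives `‖L‖ ≤ M + ‖L‖/2`, and the last term is absorbed. -/
theorem opNorm_le_of_half_net {F : Type*} [NormedAddCommGroup F] [NormedSpace ℝ F]
    (L : E →L[ℝ] F) (T : Finset E)
    (hT : ∀ y : E, ‖y‖ = 1 → ∃ t ∈ T, ‖y - t‖ ≤ 1 / 2) {M : ℝ} (hM : 0 ≤ M)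
    (h : ∀ t ∈ T, ‖L t‖ ≤ M) : ‖L‖ ≤ 2 * M := by
  have : ‖L‖ ≤ M + ‖L‖ / 2 := by
    refine L.opNorm_le_of_unit_norm (by positivity) fun y hy => ?_
    obtain ⟨t, ht, hyt⟩ := hT y hy
    calc ‖L y‖ = ‖L t + L (y - t)‖ := by rw [← map_add]; congr 2; abel
      _ ≤ ‖L t‖ + ‖L (y - t)‖ := norm_add_le _ _
      _ ≤ M + ‖L‖ * (1 / 2) := by
        gcongr
        · exact h t ht
        · exact (L.le_opNorm _).trans (by gcongr)
      _ = _ := by ring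
  linarith

end Net

/-! ### Gaussian measurement maps: solvability by small matrices -/

section

variable {ι κ : Type*} [Fintype ι] [Fintype κ]

/-- The linear map `y ↦ Aᵀ y` between Euclidean spaces. -/
noncomputable def adjointMap (A : κ → ι → ℝ) : EuclideanSpace ℝ κ →L[ℝ] EuclideanSpace ℝ ι :=
  LinearMap.toContinuousLinearMap
    { toFun := fun y => WithLp.toLp 2 fun p => ∑ i, y i * A i p
      map_add' := fun x y => by ext p; simp [add_mul, Finset.sum_add_distrib]
      map_smul' := fun c y => by ext p; simp [mul_assoc, Finset.mul_sum] }

theorem adjointMap_apply (A : κ → ι → ℝ) (y : EuclideanSpace ℝ κ) :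
    adjointMap A y = WithLp.toLp 2 fun p => ∑ i, y i * A i p := rfl

theorem norm_sq_adjointMap (A : κ → ι → ℝ) (y : EuclideanSpace ℝ κ) :
    ‖adjointMap A y‖ ^ 2 = ∑ p, (∑ i, y i * A i p) ^ 2 := by
  rw [EuclideanSpace.real_norm_sq_eq, adjointMap_apply]

/-- Union bound over a `1/2`-net with at most `5^|κ| ≤ e^{2N}` points, where `N = |ι|`. At each net
point `|Aᵀt|² ≥ 16N` has probability at most `e^{N/2 - 4N}`; passing from the net to the sphere
doubles `4√N` to `8√N`. -/
theorem pi_stdGauss_norm_adjointMap_gt (hκ : Fintype.card κ ≤ Fintype.card ι) :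
    (Measure.pi fun _ : κ => stdGauss ι)
      {A | ¬ ‖adjointMap A‖ ≤ 8 * Real.sqrt (Fintype.card ι)}
      ≤ ENNReal.ofReal (Real.exp (-Fintype.card ι)) := by
  set N : ℝ := ((Fintype.card ι : ℕ) : ℝ) with hN
  obtain ⟨T, hT1, hTc, hT⟩ := exists_net_sphere (E := EuclideanSpace ℝ κ) (ε := 1 / 2) (by norm_num)
  rw [finrank_euclideanSpace] at hTc
  have hsub : {A : κ → ι → ℝ | ¬ ‖adjointMap A‖ ≤ 8 * Real.sqrt N}
      ⊆ ⋃ t ∈ T, (fun A p => ∑ i, t i * A i p) ⁻¹' {x : ι → ℝ | 16 * N ≤ ∑ p, x p ^ 2} := by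
    intro A hA
    by_contra hcon
    simp only [Set.mem_iUnion, not_exists, Set.mem_preimage, Set.mem_ofPred_eq, not_le] at hcon
    apply hA
    have := opNorm_le_of_half_net (adjointMap A) T hT (M := 4 * Real.sqrt N) (by positivity) ?_
    · linarith
    · intro t ht
      refine abs_le_of_sq_le_sq' ?_ (by positivity) |>.2
      rw [norm_sq_adjointMap, mul_pow, Real.sq_sqrt (by positivity)]
      linarith [hcon t ht]
  refine (measure_mono hsub).trans ((measure_biUnion_finset_le _ _).trans ?_)
  have hb : ∀ t ∈ T, (Measure.pi fun _ : κ => stdGauss ι)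
      ((fun A p => ∑ i, t i * A i p) ⁻¹' {x : ι → ℝ | 16 * N ≤ ∑ p, x p ^ 2})
      ≤ ENNReal.ofReal (Real.exp (N / 2 - 16 * N / 4)) := by
    intro t ht
    refine (Measure.le_map_apply (Measurable.aemeasurable (by fun_prop)) _).trans ?_
    rw [pi_stdGauss_map_vecMul]
    · exact stdGauss_le_sum_sq _
    · rw [← EuclideanSpace.real_norm_sq_eq, hT1 t ht, one_pow]
  refine (Finset.sum_le_sum hb).trans ?_
  rw [Finset.sum_const, nsmul_eq_mul, ← ENNReal.ofReal_natCast, ← ENNReal.ofReal_mul (by positivity)]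
  apply ENNReal.ofReal_le_ofReal
  have h5 : (1 + 2 / (1 / 2) : ℝ) ^ Fintype.card κ ≤ Real.exp (2 * N) := by
    have h1 : (1 + 2 / (1 / 2) : ℝ) ≤ Real.exp 2 := by
      have := Real.exp_one_gt_d9
      have h2 : Real.exp 2 = Real.exp 1 * Real.exp 1 := by rw [← Real.exp_add]; norm_num
      rw [h2]; nlinarith
    calc (1 + 2 / (1 / 2) : ℝ) ^ Fintype.card κ ≤ Real.exp 2 ^ Fintype.card κ := by gcongr
      _ = Real.exp (Fintype.card κ * 2) := (Real.exp_nat_mul _ _).symm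
      _ ≤ _ := by
        apply Real.exp_le_exp.2
        have : (Fintype.card κ : ℝ) ≤ N := Nat.cast_le.2 hκ
        linarith
  calc (T.card : ℝ) * Real.exp (N / 2 - 16 * N / 4)
      ≤ Real.exp (2 * N) * Real.exp (N / 2 - 16 * N / 4) := by gcongr; exact hTc.trans h5
    _ = Real.exp (2 * N + (N / 2 - 16 * N / 4)) := (Real.exp_add _ _).symm
    _ ≤ _ := by
      apply Real.exp_le_exp.2
      have : 0 ≤ N := by positivity
      linarith

/-- If a set `S` of unit-ball vectors has large support function at a typical Gaussian vector, then
it has large support function at `Aᵀ y`, uniformly over the unit vectors `y`. -/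
theorem pi_stdGauss_support_lt {a b : ℝ} (ha : 0 < a)
    (S : Set (EuclideanSpace ℝ ι)) (hS1 : ∀ P ∈ S, ‖P‖ ≤ 1)
    (hS : stdGauss ι {g | ¬ ∃ P ∈ S, a * Real.sqrt (Fintype.card ι) ≤ ∑ p, P p * g p}
      ≤ ENNReal.ofReal (Real.exp (-b * Fintype.card ι)))
    (hκ : Fintype.card κ ≤ Fintype.card ι)
    (hκ2 : 32 / a * Fintype.card κ ≤ b / 2 * Fintype.card ι) :
    (Measure.pi fun _ : κ => stdGauss ι)
      {A | ¬ ∀ y : EuclideanSpace ℝ κ, ‖y‖ = 1 →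
        ∃ P ∈ S, a / 2 * Real.sqrt (Fintype.card ι) ≤ inner ℝ P (adjointMap A y)}
      ≤ ENNReal.ofReal (Real.exp (-Fintype.card ι))
        + ENNReal.ofReal (Real.exp (-(b / 2) * Fintype.card ι)) := by
  set N : ℝ := ((Fintype.card ι : ℕ) : ℝ) with hN
  -- With operator norm at most `8√N`, moving by `a/16` changes the pairing with a vector of the
  -- unit ball by at most `(a/2)√N`, half of the available margin.
  have hε : 0 < a / 16 := by positivity
  obtain ⟨T, hT1, hTc, hT⟩ := exists_net_sphere (E := EuclideanSpace ℝ κ) hε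
  rw [finrank_euclideanSpace] at hTc
  have hsub : {A : κ → ι → ℝ | ¬ ∀ y : EuclideanSpace ℝ κ, ‖y‖ = 1 →
        ∃ P ∈ S, a / 2 * Real.sqrt N ≤ inner ℝ P (adjointMap A y)}
      ⊆ {A | ¬ ‖adjointMap A‖ ≤ 8 * Real.sqrt N} ∪
        ⋃ t ∈ T, (fun A p => ∑ i, t i * A i p) ⁻¹'
          {g : ι → ℝ | ¬ ∃ P ∈ S, a * Real.sqrt N ≤ ∑ p, P p * g p} := by
    intro A hA
    by_contra hcon
    simp only [Set.mem_union, Set.mem_iUnion, Set.mem_preimage, Set.mem_ofPred_eq, not_or,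
      not_not, not_exists] at hcon
    obtain ⟨hop, hnet⟩ := hcon
    apply hA
    intro y hy
    obtain ⟨t, ht, hyt⟩ := hT y hy
    have h1 := hnet t ht
    push Not at h1
    obtain ⟨P, hP, hPt⟩ := h1
    refine ⟨P, hP, ?_⟩
    have h2 : inner ℝ P (adjointMap A t) = ∑ p, P p * ∑ i, t i * A i p := by
      rw [adjointMap_apply, PiLp.inner_apply]
      exact Finset.sum_congr rfl fun p _ => by simp [mul_comm]
    rw [← h2] at hPt
    have h3 : inner ℝ P (adjointMap A t) - inner ℝ P (adjointMap A y)
        ≤ a / 2 * Real.sqrt N := by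
      rw [← inner_sub_right, ← map_sub]
      calc inner ℝ P (adjointMap A (t - y)) ≤ ‖P‖ * ‖adjointMap A (t - y)‖ :=
            real_inner_le_norm _ _
        _ ≤ 1 * ((8 * Real.sqrt N) * (a / 16)) := by
            gcongr
            · exact hS1 P hP
            · refine ((adjointMap A).le_opNorm _).trans ?_
              gcongr
              rwa [norm_sub_rev]
        _ = _ := by ring
    linarith
  refine (measure_mono hsub).trans ((measure_union_le _ _).trans ?_)
  refine add_le_add (pi_stdGauss_norm_adjointMap_gt hκ) ?_
  refine (measure_biUnion_finset_le _ _).trans ?_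
  have hb' : ∀ t ∈ T, (Measure.pi fun _ : κ => stdGauss ι)
      ((fun A p => ∑ i, t i * A i p) ⁻¹'
          {g : ι → ℝ | ¬ ∃ P ∈ S, a * Real.sqrt N ≤ ∑ p, P p * g p})
      ≤ ENNReal.ofReal (Real.exp (-b * N)) := by
    intro t ht
    refine (Measure.le_map_apply (Measurable.aemeasurable (by fun_prop)) _).trans ?_
    rw [pi_stdGauss_map_vecMul]
    · exact hS
    · rw [← EuclideanSpace.real_norm_sq_eq, hT1 t ht, one_pow]
  refine (Finset.sum_le_sum hb').trans ?_
  rw [Finset.sum_const, nsmul_eq_mul, ← ENNReal.ofReal_natCast, ← ENNReal.ofReal_mul (by positivity)]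
  apply ENNReal.ofReal_le_ofReal
  -- The net has at most `exp (32|κ|/a)` points, so the union bound spends half of the exponent
  -- `bN`.
  have h5 : (1 + 2 / (a / 16) : ℝ) ^ Fintype.card κ ≤ Real.exp (b / 2 * N) := by
    calc (1 + 2 / (a / 16) : ℝ) ^ Fintype.card κ
        ≤ Real.exp (2 / (a / 16)) ^ Fintype.card κ := by
          gcongr; rw [add_comm]; exact Real.add_one_le_exp _
      _ = Real.exp (Fintype.card κ * (2 / (a / 16))) := (Real.exp_nat_mul _ _).symm
      _ ≤ _ := by
        apply Real.exp_le_exp.2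
        refine le_trans (le_of_eq ?_) hκ2
        field_simp; ring
  calc (T.card : ℝ) * Real.exp (-b * N)
      ≤ Real.exp (b / 2 * N) * Real.exp (-b * N) := by gcongr; exact hTc.trans h5
    _ = Real.exp (b / 2 * N + -b * N) := (Real.exp_add _ _).symm
    _ = _ := by congr 1; ring

/-- A compact convex set whose support function is at least `s` on all `Aᵀ y` with `y` a unit
vector has an image under `A` that contains the ball of radius `s`. -/
theorem exists_mem_of_support_le (A : κ → ι → ℝ) (S : Set (EuclideanSpace ℝ ι))
    (hconv : Convex ℝ S) (hcomp : IsCompact S) (h0 : (0 : EuclideanSpace ℝ ι) ∈ S) {s : ℝ}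
    (h : ∀ y : EuclideanSpace ℝ κ, ‖y‖ = 1 → ∃ P ∈ S, s ≤ inner ℝ P (adjointMap A y))
    (z : EuclideanSpace ℝ κ) (hz : ‖z‖ ≤ s) :
    ∃ P ∈ S, ∀ i, ∑ p, A i p * P p = z i := by
  -- The adjoint of `y ↦ Aᵀy` is the measurement map. If `z` were outside the compact convex set `L
  -- '' S`, a separating functional `w` would satisfy `⟨w, L P⟩ < u < ⟨w, z⟩ ≤ ‖w‖s` for all `P ∈
  -- S`, against the lower bound on the support function in the direction `w`.
  let L : EuclideanSpace ℝ ι →L[ℝ] EuclideanSpace ℝ κ := (adjointMap A).adjoint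
  have hL : ∀ P i, L P i = ∑ p, A i p * P p := by
    classical
    intro P i
    have h1 : L P i = inner ℝ (EuclideanSpace.single i (1 : ℝ)) (L P) := by
      simp [EuclideanSpace.inner_single_left]
    rw [h1, ContinuousLinearMap.adjoint_inner_right, adjointMap_apply, PiLp.inner_apply]
    refine Finset.sum_congr rfl fun p _ => ?_
    simp [PiLp.single_apply, mul_comm]
  suffices hmem : z ∈ L '' S by
    obtain ⟨P, hP, rfl⟩ := hmem
    exact ⟨P, hP, fun i => (hL P i).symm⟩
  by_contra hnot
  obtain ⟨f, u, hf1, hf2⟩ := geometric_hahn_banach_closed_point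
    (hconv.linear_image L.toLinearMap) (hcomp.image L.continuous).isClosed hnot
  set w := (InnerProductSpace.toDual ℝ _).symm f with hw
  have hfw : ∀ v, f v = inner ℝ w v := fun v => by
    rw [hw, InnerProductSpace.toDual_symm_apply]
  have hu : 0 < u := by simpa using hf1 (L 0) ⟨0, h0, rfl⟩
  have hw0 : w ≠ 0 := fun h0' => by
    rw [hfw, h0', inner_zero_left] at hf2; linarith
  have hwn : 0 < ‖w‖ := norm_pos_iff.2 hw0
  obtain ⟨P, hP, hsP⟩ := h (‖w‖⁻¹ • w) (by rw [norm_smul, norm_inv, norm_norm, inv_mul_cancel₀ hwn.ne'])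
  have h1 : f (L P) < u := hf1 _ ⟨P, hP, rfl⟩
  have h2 : f z ≤ ‖w‖ * s := by
    rw [hfw]; exact (real_inner_le_norm _ _).trans (by gcongr)
  have h3 : f (L P) = ‖w‖ * inner ℝ P (adjointMap A (‖w‖⁻¹ • w)) := by
    rw [hfw, ContinuousLinearMap.adjoint_inner_right, map_smul, inner_smul_right,
      real_inner_comm, mul_inv_cancel_left₀ hwn.ne']
  nlinarith

/-- For a fixed nonzero `e`, `Ae` is `‖e‖` times a standard Gaussian vector. The vector `e = 0`
cannot be normalized and is treated separately. -/
theorem pi_stdGauss_mulVec_sq_gt (e : ι → ℝ) {k t : ℝ} (he : ∑ p, e p ^ 2 ≤ k) (ht : 0 ≤ t) :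
    (Measure.pi fun _ : κ => stdGauss ι) {A | ¬ ∑ i, (∑ p, A i p * e p) ^ 2 ≤ k * t}
      ≤ ENNReal.ofReal (Real.exp (Fintype.card κ / 2 - t / 4)) := by
  have hs0 : 0 ≤ ∑ p, e p ^ 2 := Finset.sum_nonneg fun _ _ => sq_nonneg _
  rcases hs0.eq_or_lt with h0 | hpos
  · have he0 : ∀ p, e p = 0 := fun p => by
      have := (Finset.sum_eq_zero_iff_of_nonneg fun _ _ => sq_nonneg _).1 h0.symm p (Finset.mem_univ p)
      exact pow_eq_zero_iff (two_ne_zero) |>.1 this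
    have : {A : κ → ι → ℝ | ¬ ∑ i, (∑ p, A i p * e p) ^ 2 ≤ k * t} = ∅ := by
      ext A
      simp only [he0, mul_zero, Finset.sum_const_zero, Set.mem_ofPred_eq, Set.mem_empty_iff_false,
        iff_false, not_not]
      have : 0 ≤ k * t := mul_nonneg (hs0.trans he) ht
      simpa using this
    rw [this]; simp
  · set r := Real.sqrt (∑ p, e p ^ 2) with hr
    have hrpos : 0 < r := Real.sqrt_pos.2 hpos
    have hr2 : r ^ 2 = ∑ p, e p ^ 2 := Real.sq_sqrt hs0
    have hunit : ∑ p, (e p / r) ^ 2 = 1 := by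
      simp_rw [div_pow]
      rw [← Finset.sum_div, hr2, div_self hpos.ne']
    have hsub : {A : κ → ι → ℝ | ¬ ∑ i, (∑ p, A i p * e p) ^ 2 ≤ k * t}
        ⊆ (fun A i => ∑ p, A i p * (e p / r)) ⁻¹' {x : κ → ℝ | t ≤ ∑ i, x i ^ 2} := by
      intro A hA
      simp only [Set.mem_ofPred_eq, not_le] at hA
      simp only [Set.mem_preimage, Set.mem_ofPred_eq]
      have h1 : ∑ i, (∑ p, A i p * (e p / r)) ^ 2 = (∑ i, (∑ p, A i p * e p) ^ 2) / r ^ 2 := by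
        rw [Finset.sum_div]
        refine Finset.sum_congr rfl fun i _ => ?_
        rw [← div_pow, Finset.sum_div]
        congr 1
        exact Finset.sum_congr rfl fun p _ => by ring
      rw [h1, le_div_iff₀ (by positivity), hr2]
      nlinarith
    refine (measure_mono hsub).trans ((Measure.le_map_apply (Measurable.aemeasurable (by fun_prop)) _).trans ?_)
    rw [pi_stdGauss_map_mulVec _ hunit]
    exact stdGauss_le_sum_sq t

end

/-- The main probabilistic input to the converse bounds: with overwhelming probability, every
measurement vector is attained on a small multiple of the set `S`, and three prescribed matrices
have small measurements. -/
theorem exists_const_solvable_and_small {a b η N₀ : ℝ} (ha : 0 < a) (hb : 0 < b) (hη : 0 < η)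
    (hN₀ : 0 < N₀) :
    ∃ c₁ > (0 : ℝ), ∃ c₂ > (0 : ℝ), ∀ (ι : Type) [Fintype ι] (m : ℕ)
      (S : Set (EuclideanSpace ℝ ι)) (m₀ : ℝ) (e : Fin 3 → ι → ℝ) (k : Fin 3 → ℝ),
      Convex ℝ S → IsCompact S → (0 : EuclideanSpace ℝ ι) ∈ S → (∀ P ∈ S, ‖P‖ ≤ 1) →
      (N₀ ≤ Fintype.card ι →
        stdGauss ι {g | ¬ ∃ P ∈ S, a * Real.sqrt (Fintype.card ι) ≤ ∑ p, P p * g p}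
          ≤ ENNReal.ofReal (Real.exp (-b * Fintype.card ι))) →
      (∀ j, ∑ p, e j p ^ 2 ≤ k j) → m₀ ≤ Fintype.card ι → 1 ≤ m → (m : ℝ) ≤ c₂ * m₀ →
      (Measure.pi fun _ : Fin m => stdGauss ι)
        {A | ¬ ((∀ z : EuclideanSpace ℝ (Fin m), ‖z‖ ≤ a / 2 * Real.sqrt (Fintype.card ι) →
            ∃ P ∈ S, ∀ i, ∑ p, A i p * P p = z i) ∧
          ∀ j, ∑ i, (∑ p, A i p * e j p) ^ 2 ≤ k j * (η * m₀))}
        ≤ ENNReal.ofReal (Real.exp (-c₁ * m₀)) := by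
  -- A common rate: `b/2` for the support function, `1` for the operator norm, `η/8` for the three
  -- prescribed measurements.
  set β : ℝ := min (b / 2) (min 1 (η / 8)) with hβ
  have hβpos : 0 < β := by positivity
  have hβ1 : β ≤ b / 2 := min_le_left _ _
  have hβ2 : β ≤ 1 := (min_le_right _ _).trans (min_le_left _ _)
  have hβ3 : β ≤ η / 8 := (min_le_right _ _).trans (min_le_right _ _)
  -- As `1 ≤ m ≤ c₂m₀`, the bound `β/4` yields `βm₀ ≥ 4` and `1/N₀` yields `m₀ ≥ N₀`. The bound
  -- `η/4` makes the tail exponent `m/2 - ηm₀/4` at most `-ηm₀/8`, and `ab/64` pays for the net.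
  set c₂ : ℝ := min (min (β / 4) (1 / N₀)) (min (η / 4) (a * b / 64)) with hc₂
  have hc₂pos : 0 < c₂ := by positivity
  have hc1 : c₂ ≤ β / 4 := (min_le_left _ _).trans (min_le_left _ _)
  have hc0 : c₂ ≤ 1 / N₀ := (min_le_left _ _).trans (min_le_right _ _)
  have hc2 : c₂ ≤ η / 4 := (min_le_right _ _).trans (min_le_left _ _)
  have hc3 : c₂ ≤ a * b / 64 := (min_le_right _ _).trans (min_le_right _ _)
  refine ⟨β / 2, by positivity, c₂, hc₂pos, ?_⟩
  intro ι _ m S m₀ e k hconv hcomp h0 hS1 hS he hm₀ hm1 hm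
  set N : ℝ := ((Fintype.card ι : ℕ) : ℝ) with hN
  have hm1' : (1 : ℝ) ≤ m := by exact_mod_cast hm1
  have hm₀pos : 0 < m₀ := by
    by_contra! hneg
    nlinarith
  have hN₀m : N₀ ≤ m₀ := by
    have h1 : c₂ * m₀ ≤ 1 / N₀ * m₀ := by gcongr
    have h2 : 1 ≤ m₀ / N₀ := by
      rw [div_eq_mul_one_div, mul_comm]; linarith
    rwa [le_div_iff₀ hN₀, one_mul] at h2
  have hm₀β : 4 ≤ β * m₀ := by
    have h1 : c₂ * m₀ ≤ β / 4 * m₀ := by gcongr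
    linarith
  have hmN : (m : ℝ) ≤ N := by
    have h1 : c₂ * m₀ ≤ 1 * m₀ := by gcongr; linarith
    linarith
  have hcard : Fintype.card (Fin m) ≤ Fintype.card ι := by
    rw [Fintype.card_fin]; exact Nat.cast_le.1 hmN
  have hcard2 : 32 / a * Fintype.card (Fin m) ≤ b / 2 * Fintype.card ι := by
    rw [Fintype.card_fin, ← hN]
    have h1 : (m : ℝ) ≤ a * b / 64 * N := hm.trans (by gcongr)
    calc 32 / a * m ≤ 32 / a * (a * b / 64 * N) := by gcongr
      _ = _ := by field_simp; ring
  have hbad := pi_stdGauss_support_lt (κ := Fin m) ha S hS1 (hS (hN₀m.trans hm₀)) hcard hcard2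
  have hsub : {A : Fin m → ι → ℝ |
        ¬ ((∀ z : EuclideanSpace ℝ (Fin m), ‖z‖ ≤ a / 2 * Real.sqrt N →
            ∃ P ∈ S, ∀ i, ∑ p, A i p * P p = z i) ∧
          ∀ j, ∑ i, (∑ p, A i p * e j p) ^ 2 ≤ k j * (η * m₀))}
      ⊆ {A | ¬ ∀ y : EuclideanSpace ℝ (Fin m), ‖y‖ = 1 →
          ∃ P ∈ S, a / 2 * Real.sqrt N ≤ inner ℝ P (adjointMap A y)} ∪
        ⋃ j ∈ (Finset.univ : Finset (Fin 3)),
          {A | ¬ ∑ i, (∑ p, A i p * e j p) ^ 2 ≤ k j * (η * m₀)} := by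
    intro A hA
    by_contra hcon
    simp only [Set.mem_union, Set.mem_iUnion, Set.mem_ofPred_eq, not_or,
      not_not, not_exists, Finset.mem_univ] at hcon
    refine hA ⟨fun z hz => exists_mem_of_support_le A S hconv hcomp h0 hcon.1 z hz,
      fun j => hcon.2 j trivial⟩
  refine (measure_mono hsub).trans ((measure_union_le _ _).trans ?_)
  have hthree : (Measure.pi fun _ : Fin m => stdGauss ι)
      (⋃ j ∈ (Finset.univ : Finset (Fin 3)),
          {A | ¬ ∑ i, (∑ p, A i p * e j p) ^ 2 ≤ k j * (η * m₀)})
      ≤ ENNReal.ofReal (3 * Real.exp (-β * m₀)) := by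
    refine (measure_biUnion_finset_le _ _).trans ?_
    refine (Finset.sum_le_sum fun j _ =>
      pi_stdGauss_mulVec_sq_gt (κ := Fin m) (e j) (he j) (t := η * m₀) (by positivity)).trans ?_
    rw [Finset.sum_const, nsmul_eq_mul, ← ENNReal.ofReal_natCast,
      ← ENNReal.ofReal_mul (by positivity)]
    apply ENNReal.ofReal_le_ofReal
    simp only [Finset.card_univ, Fintype.card_fin]
    push_cast
    gcongr
    have h1 : (m : ℝ) ≤ η / 4 * m₀ := hm.trans (by gcongr)
    have h2 : β * m₀ ≤ η / 8 * m₀ := by gcongr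
    linarith
  refine (add_le_add hbad hthree).trans ?_
  rw [← ENNReal.ofReal_add (by positivity) (by positivity),
    ← ENNReal.ofReal_add (by positivity) (by positivity)]
  apply ENNReal.ofReal_le_ofReal
  have e1 : Real.exp (-N) ≤ Real.exp (-β * m₀) := by
    apply Real.exp_le_exp.2
    have : β * m₀ ≤ 1 * m₀ := by gcongr
    linarith
  have e2 : Real.exp (-(b / 2) * N) ≤ Real.exp (-β * m₀) := by
    apply Real.exp_le_exp.2
    have h1 : β * m₀ ≤ b / 2 * m₀ := by gcongr
    have h2 : b / 2 * m₀ ≤ b / 2 * N := by gcongr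
    linarith
  -- Five terms are collected, one each for operator norm and support function and three for the
  -- measurements. Since `βm₀/2 ≥ 2` and `e² ≥ 5`, half of the rate absorbs the factor.
  have e3 : 5 * Real.exp (-β * m₀) ≤ Real.exp (-(β / 2) * m₀) := by
    have h1 : (5 : ℝ) ≤ Real.exp (β * m₀ / 2) := by
      have h2 : Real.exp 2 ≤ Real.exp (β * m₀ / 2) := Real.exp_le_exp.2 (by linarith)
      have h3 : Real.exp 2 = Real.exp 1 * Real.exp 1 := by rw [← Real.exp_add]; norm_num
      have := Real.exp_one_gt_d9
      nlinarith
    calc 5 * Real.exp (-β * m₀) ≤ Real.exp (β * m₀ / 2) * Real.exp (-β * m₀) := by gcongr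
      _ = _ := by rw [← Real.exp_add]; congr 1; ring
  linarith

/-! ### Greedy Gram–Schmidt against Gaussian vectors -/

section GramSchmidt

variable {ι : Type*} [Fintype ι]

/-- The families of `k` vectors whose pairing with every orthonormal family orthogonal to `V` is at
most `s`. -/
def pairingLE (V : Submodule ℝ (EuclideanSpace ℝ ι)) (k : ℕ) (s : ℝ) : Set (Fin k → ι → ℝ) :=
  {h | ∀ w : Fin k → EuclideanSpace ℝ ι, Orthonormal ℝ w → (∀ j, w j ∈ Vᗮ) →
    ∑ j, ∑ p, w j p * h j p ≤ s}

theorem isClosed_pairingLE (V : Submodule ℝ (EuclideanSpace ℝ ι)) (k : ℕ) (s : ℝ) :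
    IsClosed (pairingLE V k s) := by
  simp only [pairingLE, Set.ofPred_forall]
  refine isClosed_iInter fun w => isClosed_iInter fun _ => isClosed_iInter fun _ => ?_
  exact isClosed_le (by fun_prop) continuous_const

/-- The greedy choice is the normalized projection of `x` to `Vᗮ`. If the projection vanishes, any
unit vector of `Vᗮ` works; one exists by the dimension bound. -/
theorem exists_unit_mem_orthogonal (V : Submodule ℝ (EuclideanSpace ℝ ι))
    (hV : Module.finrank ℝ V < Fintype.card ι) (x : EuclideanSpace ℝ ι) :
    ∃ w ∈ Vᗮ, ‖w‖ = 1 ∧ inner ℝ w x = ‖Vᗮ.starProjection x‖ := by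
  set u := Vᗮ.starProjection x with hu
  have hmem : u ∈ Vᗮ := Submodule.starProjection_apply_mem _ _
  by_cases h0 : u = 0
  · have hne : Vᗮ ≠ ⊥ := by
      intro h
      have := V.finrank_add_finrank_orthogonal
      rw [h, finrank_bot, finrank_euclideanSpace] at this
      omega
    obtain ⟨v, hv, hv0⟩ := Submodule.exists_mem_ne_zero_of_ne_bot hne
    refine ⟨‖v‖⁻¹ • v, Submodule.smul_mem _ _ hv, ?_, ?_⟩
    · rw [norm_smul, norm_inv, norm_norm, inv_mul_cancel₀ (norm_ne_zero_iff.2 hv0)]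
    · have : inner ℝ v u = inner ℝ v x := by
        rw [hu, Submodule.inner_starProjection_left_eq_right .. |>.symm,
          Submodule.starProjection_eq_self_iff.2 hv]
      rw [inner_smul_left, ← this, h0]; simp
  · refine ⟨‖u‖⁻¹ • u, Submodule.smul_mem _ _ hmem, ?_, ?_⟩
    · rw [norm_smul, norm_inv, norm_norm, inv_mul_cancel₀ (norm_ne_zero_iff.2 h0)]
    · have h1 : inner ℝ u x = ‖u‖ ^ 2 := by
        rw [← real_inner_self_eq_norm_sq]
        nth_rewrite 3 [hu]
        rw [Submodule.inner_starProjection_left_eq_right .. |>.symm,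
          Submodule.starProjection_eq_self_iff.2 hmem]
      rw [inner_smul_left, h1]
      have := norm_ne_zero_iff.2 h0
      simp
      field_simp

/-- Orthonormal families orthogonal to both `V` and `w` extend by `w`, so the choice of `w` for the
first vector uses up `⟨w, x⟩` of the budget `s`. -/
theorem mem_pairingLE_of_cons (V : Submodule ℝ (EuclideanSpace ℝ ι)) {k : ℕ} {s : ℝ}
    {w : EuclideanSpace ℝ ι} (hw : w ∈ Vᗮ) (hw1 : ‖w‖ = 1) (x : ι → ℝ) (h : Fin k → ι → ℝ)
    (hx : Fin.cons x h ∈ pairingLE V (k + 1) s) :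
    h ∈ pairingLE (V ⊔ Submodule.span ℝ {w}) k (s - inner ℝ w (WithLp.toLp 2 x)) := by
  intro v hv hvV
  have hvV' : ∀ j, v j ∈ Vᗮ := fun j => Submodule.orthogonal_le le_sup_left (hvV j)
  have hwv : ∀ j, inner ℝ w (v j) = 0 := fun j =>
    (Submodule.mem_orthogonal _ _).1 (hvV j) w
      (Submodule.mem_sup_right (Submodule.mem_span_singleton_self w))
  have hcons : Orthonormal ℝ (Fin.cons w v : Fin (k + 1) → EuclideanSpace ℝ ι) := by
    constructor
    · intro j
      refine Fin.cases ?_ (fun j => ?_) j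
      · simpa using hw1
      · simpa using hv.1 j
    · intro i j hij
      revert hij
      refine Fin.cases ?_ (fun i => ?_) i <;> refine Fin.cases ?_ (fun j => ?_) j
      · intro h; exact absurd rfl h
      · intro _; simpa using hwv j
      · intro _; rw [real_inner_comm]; simpa using hwv i
      · intro hij
        simpa using hv.2 (fun h => hij (by rw [h]))
  have := hx (Fin.cons w v) hcons (fun j => by
    refine Fin.cases ?_ (fun j => ?_) j
    · simpa using hw
    · simpa using hvV' j)
  rw [Fin.sum_univ_succ] at this
  simp only [Fin.cons_zero, Fin.cons_succ] at this
  have h2 : inner ℝ w (WithLp.toLp 2 x) = ∑ p, w p * x p := by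
    rw [PiLp.inner_apply]
    exact Finset.sum_congr rfl fun p _ => by simp [mul_comm]
  rw [h2]
  linarith

/-- Induction with Fubini. Given the first vector `x`, the greedy choice leaves `k` vectors, a
subspace larger by at most one dimension, and the budget `s - ‖proj x‖`. The factor `exp (-θ‖proj
x‖)` then integrates to at most `q`. The condition `2 (dim V + k) ≤ |ι|` keeps every subspace met on
the way within the range of `hproj`. -/
theorem pi_stdGauss_pairingLE {θ q : ℝ} (hθ : 0 ≤ θ) (hq : 0 ≤ q)
    (hproj : ∀ V : Submodule ℝ (EuclideanSpace ℝ ι), 2 * Module.finrank ℝ V ≤ Fintype.card ι →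
      ∫⁻ x, ENNReal.ofReal (Real.exp (-θ * ‖Vᗮ.starProjection (WithLp.toLp 2 x)‖)) ∂(stdGauss ι)
        ≤ ENNReal.ofReal q)
    (k : ℕ) (V : Submodule ℝ (EuclideanSpace ℝ ι)) (s : ℝ)
    (hV : 2 * (Module.finrank ℝ V + k) ≤ Fintype.card ι) :
    (Measure.pi fun _ : Fin k => stdGauss ι) (pairingLE V k s)
      ≤ ENNReal.ofReal (Real.exp (θ * s) * q ^ k) := by
  induction k generalizing V s with
  | zero =>
    by_cases hs : 0 ≤ s
    · refine prob_le_one.trans ?_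
      rw [pow_zero, mul_one, ENNReal.one_le_ofReal]
      exact Real.one_le_exp (by positivity)
    · have : pairingLE V 0 s = ∅ := by
        ext h
        simp only [Set.mem_empty_iff_false, iff_false]
        intro hh
        have := hh (fun j => j.elim0) ⟨fun j => j.elim0, fun j => j.elim0⟩ (fun j => j.elim0)
        simp at this
        exact hs this
      rw [this]; simp
  | succ k ih =>
    have hmp := measurePreserving_piFinSuccAbove (fun _ : Fin (k + 1) => stdGauss ι) 0
    set T : Set ((ι → ℝ) × (Fin k → ι → ℝ)) := {x | Fin.cons x.1 x.2 ∈ pairingLE V (k + 1) s}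
      with hT
    have hTm : MeasurableSet T := by
      refine (IsClosed.preimage ?_ (isClosed_pairingLE V (k + 1) s)).measurableSet
      exact continuous_pi fun j => by
        refine Fin.cases ?_ (fun j => ?_) j
        · simpa using continuous_fst
        · simp only [Fin.cons_succ]; fun_prop
    have hpre : pairingLE V (k + 1) s
        = (MeasurableEquiv.piFinSuccAbove (fun _ : Fin (k + 1) => ι → ℝ) 0) ⁻¹' T := by
      ext h
      simp only [hT, Set.mem_preimage, Set.mem_ofPred_eq]
      have : (Fin.cons ((MeasurableEquiv.piFinSuccAbove (fun _ : Fin (k + 1) => ι → ℝ) 0) h).1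
        ((MeasurableEquiv.piFinSuccAbove (fun _ : Fin (k + 1) => ι → ℝ) 0) h).2 :
          Fin (k + 1) → ι → ℝ) = h := by
        ext j
        refine Fin.cases ?_ (fun j => ?_) j <;> rfl
      rw [this]
    rw [hpre, hmp.measure_preimage hTm.nullMeasurableSet, Measure.prod_apply hTm]
    have hsec : ∀ x : ι → ℝ, (Measure.pi fun _ : Fin k => stdGauss ι) (Prod.mk x ⁻¹' T)
        ≤ ENNReal.ofReal (Real.exp (θ * s) * q ^ k)
          * ENNReal.ofReal (Real.exp (-θ * ‖Vᗮ.starProjection (WithLp.toLp 2 x)‖)) := by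
      intro x
      -- Here `w` is chosen separately for each `x`; since only an inclusion of sections is used, no
      -- measurability in `x` is required.
      obtain ⟨w, hw, hw1, hwx⟩ := exists_unit_mem_orthogonal V (by omega) (WithLp.toLp 2 x)
      have hsub : Prod.mk x ⁻¹' T ⊆ pairingLE (V ⊔ Submodule.span ℝ {w}) k
          (s - ‖Vᗮ.starProjection (WithLp.toLp 2 x)‖) := by
        intro h hh
        rw [← hwx]
        exact mem_pairingLE_of_cons V hw hw1 x h hh
      refine (measure_mono hsub).trans ((ih _ _ ?_).trans (le_of_eq ?_))
      · have h1 := Submodule.finrank_add_le_finrank_add_finrank V (Submodule.span ℝ {w})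
        have h2 := finrank_span_le_card (R := ℝ) ({w} : Set (EuclideanSpace ℝ ι))
        simp at h2
        omega
      · rw [← ENNReal.ofReal_mul (by positivity)]
        congr 1
        rw [mul_right_comm, ← Real.exp_add]
        congr 2; ring
    refine (lintegral_mono hsec).trans ?_
    rw [lintegral_const_mul' _ _ ENNReal.ofReal_ne_top]
    refine (mul_le_mul_right (hproj V (by omega)) _).trans (le_of_eq ?_)
    rw [← ENNReal.ofReal_mul (by positivity)]
    congr 1; ring

/-- The projection to `U` is a standard Gaussian vector in `dim U` coordinates. With `R` its norm,
`exp (-θR) ≤ exp (-θρ)` if `R ≥ ρ`, and otherwise `exp (-θR) ≤ 1 ≤ exp (ρ² - R²)`; the mean of `exp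
(-R²)` is at most `exp (-dim U/2)`. -/
theorem lintegral_exp_neg_norm_starProjection_le (U : Submodule ℝ (EuclideanSpace ℝ ι)) {θ ρ : ℝ}
    (hθ : 0 ≤ θ) :
    ∫⁻ x, ENNReal.ofReal (Real.exp (-θ * ‖U.starProjection (WithLp.toLp 2 x)‖)) ∂(stdGauss ι)
      ≤ ENNReal.ofReal (Real.exp (-θ * ρ) + Real.exp (ρ ^ 2 - Module.finrank ℝ U / 2)) := by
  classical
  let b := stdOrthonormalBasis ℝ U
  let B : Fin (Module.finrank ℝ U) → ι → ℝ := fun i p => (b i : EuclideanSpace ℝ ι) p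
  have hB : ∀ i j, ∑ p, B i p * B j p = if i = j then 1 else 0 := by
    intro i j
    have h1 := orthonormal_iff_ite.1 b.orthonormal i j
    rw [Submodule.coe_inner, PiLp.inner_apply] at h1
    rw [← h1]
    exact Finset.sum_congr rfl fun p _ => by simp [B, mul_comm]
  have hnorm : ∀ x : ι → ℝ, ‖U.starProjection (WithLp.toLp 2 x)‖
      = Real.sqrt (∑ i, (∑ p, B i p * x p) ^ 2) := by
    intro x
    rw [Submodule.starProjection_apply]
    change ‖U.orthogonalProjectionOnto (WithLp.toLp 2 x)‖ = _
    rw [eq_comm, Real.sqrt_eq_iff_mul_self_eq (by positivity) (by positivity), ← sq, eq_comm,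
      ← b.sum_sq_norm_inner_right]
    refine Finset.sum_congr rfl fun i _ => ?_
    rw [Real.norm_eq_abs, sq_abs]
    congr 1
    rw [Submodule.coe_inner, ← Submodule.starProjection_apply,
      Submodule.inner_starProjection_left_eq_right .. |>.symm,
      Submodule.starProjection_eq_self_iff.2 (b i).2, PiLp.inner_apply]
    exact Finset.sum_congr rfl fun p _ => by simp [B, mul_comm]
  have hmeas : Measurable fun y : Fin (Module.finrank ℝ U) → ℝ =>
      ENNReal.ofReal (Real.exp (-θ * Real.sqrt (∑ i, y i ^ 2))) :=
    ENNReal.measurable_ofReal.comp (Continuous.measurable (by fun_prop))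
  calc ∫⁻ x, ENNReal.ofReal (Real.exp (-θ * ‖U.starProjection (WithLp.toLp 2 x)‖)) ∂(stdGauss ι)
      = ∫⁻ y, ENNReal.ofReal (Real.exp (-θ * Real.sqrt (∑ i, y i ^ 2)))
          ∂((stdGauss ι).map (fun x i => ∑ p, B i p * x p)) := by
        rw [lintegral_map hmeas (by fun_prop)]
        simp_rw [hnorm]
    _ = ∫⁻ y, ENNReal.ofReal (Real.exp (-θ * Real.sqrt (∑ i, y i ^ 2)))
          ∂(stdGauss (Fin (Module.finrank ℝ U))) := by
        rw [stdGauss_map_of_orthonormal_rows B hB]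
    _ ≤ ∫⁻ y, (ENNReal.ofReal (Real.exp (-θ * ρ)) + ENNReal.ofReal (Real.exp (ρ ^ 2)) *
          ENNReal.ofReal (Real.exp (-∑ i, y i ^ 2))) ∂(stdGauss (Fin (Module.finrank ℝ U))) := by
        refine lintegral_mono fun y => ?_
        rw [← ENNReal.ofReal_mul (by positivity), ← ENNReal.ofReal_add (by positivity) (by positivity),
          ← Real.exp_add]
        apply ENNReal.ofReal_le_ofReal
        have hs0 : 0 ≤ ∑ i, y i ^ 2 := Finset.sum_nonneg fun _ _ => sq_nonneg _
        rcases le_total ρ (Real.sqrt (∑ i, y i ^ 2)) with h | h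
        · have : Real.exp (-θ * Real.sqrt (∑ i, y i ^ 2)) ≤ Real.exp (-θ * ρ) := by
            apply Real.exp_le_exp.2
            nlinarith
          have h2 := Real.exp_pos (ρ ^ 2 + -∑ i, y i ^ 2)
          linarith
        · have h1 : ∑ i, y i ^ 2 ≤ ρ ^ 2 := by
            rw [← Real.sq_sqrt hs0]; gcongr
          have h2 : Real.exp (-θ * Real.sqrt (∑ i, y i ^ 2)) ≤ 1 := by
            apply Real.exp_le_one_iff.2
            have := Real.sqrt_nonneg (∑ i, y i ^ 2)
            nlinarith
          have h3 : 1 ≤ Real.exp (ρ ^ 2 + -∑ i, y i ^ 2) := Real.one_le_exp (by linarith)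
          have h4 := Real.exp_pos (-θ * ρ)
          linarith
    _ ≤ _ := by
        rw [lintegral_add_left (by fun_prop), lintegral_const, measure_univ, mul_one,
          lintegral_const_mul' _ _ ENNReal.ofReal_ne_top]
        refine (add_le_add le_rfl (mul_le_mul_right lintegral_exp_neg_sum_sq_le _)).trans
          (le_of_eq ?_)
        rw [← ENNReal.ofReal_mul (by positivity), ← ENNReal.ofReal_add (by positivity) (by positivity),
          ← Real.exp_add, Fintype.card_fin]
        congr 3

/-- Take `θ = √n` and `ρ = √n/4`. Since `dim Vᗮ ≥ n/2`, both terms of the one-step bound are at most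
`exp (-3n/16)`, whence `q = 2 exp (-3n/16)`. The threshold costs `exp (kn/16)`, so the exponent is
at most `k(1 - n/8) ≤ -kn/16` for `n ≥ 16`. -/
theorem pi_stdGauss_not_exists_orthonormal_pairing (n k : ℕ) (hk : 2 * k ≤ n) (hn : 16 ≤ n) :
    (Measure.pi fun _ : Fin k => stdGauss (Fin n))
      {h | ¬ ∃ w : Fin k → EuclideanSpace ℝ (Fin n), Orthonormal ℝ w ∧
        k * Real.sqrt n / 16 ≤ ∑ j, ∑ p, w j p * h j p}
      ≤ ENNReal.ofReal (Real.exp (-(k * n / 16))) := by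
  have hn0 : (0 : ℝ) ≤ n := by positivity
  have hn16 : (16 : ℝ) ≤ n := by exact_mod_cast hn
  have hs := Real.sq_sqrt hn0
  refine (measure_mono (t := pairingLE ⊥ k (k * Real.sqrt n / 16)) ?_).trans
    ((pi_stdGauss_pairingLE (θ := Real.sqrt n) (q := 2 * Real.exp (-(3 * n / 16)))
      (by positivity) (by positivity) ?_ k ⊥ _ (by simpa using hk)).trans ?_)
  · intro h hh w hw _
    simp only [Set.mem_ofPred_eq, not_exists, not_and, not_le] at hh
    exact (hh w hw).le
  · intro V hV
    refine (lintegral_exp_neg_norm_starProjection_le Vᗮ (ρ := Real.sqrt n / 4)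
      (by positivity)).trans (ENNReal.ofReal_le_ofReal ?_)
    have h1 := V.finrank_add_finrank_orthogonal
    rw [finrank_euclideanSpace] at h1
    simp only [Fintype.card_fin] at h1 hV
    have h2 : (n : ℝ) / 2 ≤ Module.finrank ℝ Vᗮ := by
      have : n ≤ 2 * Module.finrank ℝ Vᗮ := by omega
      have : (n : ℝ) ≤ 2 * Module.finrank ℝ Vᗮ := by exact_mod_cast this
      linarith
    have e1 : Real.exp (-Real.sqrt n * (Real.sqrt n / 4)) ≤ Real.exp (-(3 * n / 16)) := by
      apply Real.exp_le_exp.2; nlinarith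
    have e2 : Real.exp ((Real.sqrt n / 4) ^ 2 - Module.finrank ℝ Vᗮ / 2)
        ≤ Real.exp (-(3 * n / 16)) := by
      apply Real.exp_le_exp.2; nlinarith
    linarith
  · apply ENNReal.ofReal_le_ofReal
    have h2 : (2 : ℝ) ≤ Real.exp 1 := by linarith [Real.exp_one_gt_d9]
    calc Real.exp (Real.sqrt n * (k * Real.sqrt n / 16)) * (2 * Real.exp (-(3 * n / 16))) ^ k
        ≤ Real.exp (Real.sqrt n * (k * Real.sqrt n / 16))
          * (Real.exp 1 * Real.exp (-(3 * n / 16))) ^ k := by gcongr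
      _ = Real.exp (Real.sqrt n * (k * Real.sqrt n / 16) + k * (1 + -(3 * n / 16))) := by
        rw [← Real.exp_add, ← Real.exp_nat_mul, ← Real.exp_add]
      _ ≤ _ := by
        apply Real.exp_le_exp.2
        have : Real.sqrt n * (k * Real.sqrt n / 16) = k * n / 16 := by
          rw [show Real.sqrt n * (k * Real.sqrt n / 16) = k * (Real.sqrt n) ^ 2 / 16 by ring, hs]
        rw [this]
        have hk0 : (0 : ℝ) ≤ k := by positivity
        nlinarith

end GramSchmidt

/-! ### Support function of the positive semidefinite unit ball at a Gaussian matrix -/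

/-- The positive semidefinite matrices of Frobenius norm at most one, as vectors indexed by
(column, row). -/
def psdBall (d : ℕ) : Set (EuclideanSpace ℝ (Fin d × Fin d)) :=
  {P | (Matrix.of fun i j => P (j, i)).PosSemidef ∧ ‖P‖ ≤ 1}

theorem zero_mem_psdBall (d : ℕ) : 0 ∈ psdBall d := by
  refine ⟨?_, by simp⟩
  convert! Matrix.PosSemidef.zero (n := Fin d) (R := ℝ)

theorem convex_psdBall (d : ℕ) : Convex ℝ (psdBall d) := by
  intro P hP Q hQ a b ha hb hab
  refine ⟨?_, ?_⟩
  · convert! (hP.1.smul ha).add (hQ.1.smul hb)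
  · have := convex_closedBall (0 : EuclideanSpace ℝ (Fin d × Fin d)) 1
      (by simpa using hP.2) (by simpa using hQ.2) ha hb hab
    simpa using this

theorem isCompact_psdBall (d : ℕ) : IsCompact (psdBall d) := by
  have h : psdBall d = {P | (Matrix.of fun i j => P (j, i)).PosSemidef} ∩
      Metric.closedBall (0 : EuclideanSpace ℝ (Fin d × Fin d)) 1 := by
    ext P; simp [psdBall]
  rw [h]
  refine (isCompact_closedBall _ _).inter_left ?_
  simp only [Matrix.posSemidef_iff_dotProduct_mulVec, Matrix.IsHermitian, Set.ofPred_and,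
    Set.ofPred_forall]
  refine IsClosed.inter ?_ (isClosed_iInter fun x => ?_)
  · exact isClosed_eq (continuous_matrix fun i j => by simp [Matrix.conjTranspose]; fun_prop)
      (continuous_matrix fun i j => by simp; fun_prop)
  · refine isClosed_le continuous_const ?_
    simp only [dotProduct, Matrix.mulVec, Matrix.of_apply]
    fun_prop

section

variable {n k l : ℕ}

/-- The block matrix with identity diagonal blocks and off-diagonal blocks given by `w`. -/
def couplingMatrix (l : ℕ) (w : Fin k → EuclideanSpace ℝ (Fin n)) :
    Matrix ((Fin n ⊕ Fin k) ⊕ Fin l) ((Fin n ⊕ Fin k) ⊕ Fin l) ℝ :=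
  Matrix.fromBlocks
    (Matrix.fromBlocks 1 (Matrix.of fun i j => w j i) (Matrix.of fun i j => w j i).conjTranspose 1)
    0 0 1

/-- The Schur complement of the first diagonal block is `1 - WᵀW`, which vanishes because `w` is
orthonormal. -/
theorem posSemidef_couplingMatrix {w : Fin k → EuclideanSpace ℝ (Fin n)} (hw : Orthonormal ℝ w) :
    (couplingMatrix l w).PosSemidef := by
  unfold couplingMatrix
  let _ (m : ℕ) : Invertible (1 : Matrix (Fin m) (Fin m) ℝ) := invertibleOne
  have h2 := Matrix.PosDef.fromBlocks₂₂
    (Matrix.fromBlocks 1 (Matrix.of fun i j => w j i) (Matrix.of fun i j => w j i).conjTranspose 1)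
    (0 : Matrix (Fin n ⊕ Fin k) (Fin l) ℝ) (D := 1) Matrix.PosDef.one
  rw [Matrix.conjTranspose_zero] at h2
  rw [h2, Matrix.zero_mul, Matrix.zero_mul, sub_zero, Matrix.PosDef.fromBlocks₁₁ _ _ Matrix.PosDef.one]
  convert! Matrix.PosSemidef.zero (n := Fin k) (R := ℝ) using 1
  rw [inv_one, Matrix.mul_one, sub_eq_zero]
  ext i j
  have := orthonormal_iff_ite.1 hw i j
  rw [PiLp.inner_apply] at this
  rw [Matrix.one_apply, ← this, Matrix.mul_apply]
  exact Finset.sum_congr rfl fun p _ => by simp [mul_comm]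

theorem sum_couplingMatrix_mul (w : Fin k → EuclideanSpace ℝ (Fin n))
    (g : (Fin n ⊕ Fin k) ⊕ Fin l → (Fin n ⊕ Fin k) ⊕ Fin l → ℝ) :
    ∑ u, ∑ v, couplingMatrix l w u v * g u v = ∑ u, g u u
      + ∑ j, ∑ i, w j i * (g (.inl (.inl i)) (.inl (.inr j)) + g (.inl (.inr j)) (.inl (.inl i))) := by
  simp only [couplingMatrix, Fintype.sum_sum_type, Matrix.fromBlocks_apply₁₁,
    Matrix.fromBlocks_apply₁₂, Matrix.fromBlocks_apply₂₁, Matrix.fromBlocks_apply₂₂,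
    Matrix.one_apply, Matrix.of_apply, Matrix.conjTranspose_apply, star_trivial, ite_mul, one_mul,
    zero_mul, Finset.sum_ite_eq, Finset.mem_univ, if_true, Matrix.zero_apply,
    Finset.sum_const_zero, add_zero, zero_add, Finset.sum_add_distrib, mul_add]
  rw [Finset.sum_comm (s := (Finset.univ : Finset (Fin n)))]
  ring

theorem sum_couplingMatrix_sq {w : Fin k → EuclideanSpace ℝ (Fin n)} (hw : Orthonormal ℝ w) :
    ∑ u, ∑ v, couplingMatrix l w u v ^ 2 = n + 3 * k + l := by
  have h1 : ∀ j, ∑ i, w j i ^ 2 = 1 := fun j => by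
    rw [← EuclideanSpace.real_norm_sq_eq, hw.1 j, one_pow]
  have := sum_couplingMatrix_mul (l := l) w (couplingMatrix l w)
  simp_rw [← sq] at this
  rw [this]
  simp [couplingMatrix, Fintype.sum_sum_type, ← two_mul, mul_left_comm, ← Finset.mul_sum, ← sq, h1]
  ring

end

/-- The positions `(r i, c j)` and `(c j, r i)` are pairwise distinct as `i` and `j` vary, so the
functionals are orthonormal after division by `√2`. -/
theorem stdGauss_map_symmetrized_block {ι : Type*} [Fintype ι] [DecidableEq ι] {n k : ℕ}
    (r : Fin n → ι) (c : Fin k → ι) (hr : Function.Injective r) (hc : Function.Injective c)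
    (hrc : ∀ i j, r i ≠ c j) :
    (stdGauss (ι × ι)).map (fun g j i => (Real.sqrt 2)⁻¹ * (g (r i, c j) + g (c j, r i)))
      = Measure.pi fun _ : Fin k => stdGauss (Fin n) := by
  set s := (Real.sqrt 2)⁻¹ with hs
  have hs2 : s * s = 1 / 2 := by
    rw [hs, ← mul_inv, Real.mul_self_sqrt (by norm_num)]; norm_num
  rw [← stdGauss_map_curry, ← stdGauss_map_of_orthonormal_rows (ι := ι × ι) (κ := Fin k × Fin n)
    (fun q p => (if p = (r q.2, c q.1) then s else 0) + if p = (c q.1, r q.2) then s else 0),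
    Measure.map_map (by fun_prop) (by fun_prop)]
  · congr 1
    ext g j i
    simp [add_mul, Finset.sum_add_distrib, mul_add]
  · rintro ⟨j, i⟩ ⟨j', i'⟩
    simp only [add_mul, mul_add, Finset.sum_add_distrib, ite_mul, zero_mul, mul_ite, mul_zero,
      Finset.sum_ite_eq', Finset.mem_univ, if_true, Prod.mk.injEq, hr.eq_iff, hc.eq_iff, hrc,
      (hrc _ _).symm, and_false, if_false, add_zero, zero_add, hs2]
    by_cases h1 : i' = i <;> by_cases h2 : j' = j <;>
      simp [h1, h2, eq_comm (a := i), eq_comm (a := j)]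
    norm_num

theorem stdGauss_trace_sq_ge {d : ℕ} (hd : 0 < d) (t : ℝ) :
    stdGauss (Fin d × Fin d) {g | t * d ≤ (∑ a, g (a, a)) ^ 2}
      ≤ ENNReal.ofReal (Real.exp (1 / 2 - t / 4)) := by
  have hd' : (0 : ℝ) < d := by exact_mod_cast hd
  set s := (Real.sqrt d)⁻¹ with hs
  have hs2 : s * s = (d : ℝ)⁻¹ := by
    rw [hs, ← mul_inv, Real.mul_self_sqrt hd'.le]
  have hmap := stdGauss_map_of_orthonormal_rows (ι := Fin d × Fin d) (κ := Unit)
    (fun _ p => if p.1 = p.2 then s else 0) (by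
      intro i j
      simp [Fintype.sum_prod_type, hs2, hd'.ne'])
  have h := stdGauss_le_sum_sq (ι := Unit) t
  rw [← hmap] at h
  refine (measure_mono ?_).trans ((Measure.le_map_apply (Measurable.aemeasurable
    (measurable_pi_lambda _ fun _ => Finset.measurable_sum _ fun p _ =>
      (measurable_pi_apply p).const_mul _)) _).trans (h.trans_eq (by simp)))
  intro g hg
  simp only [Set.mem_ofPred_eq] at hg
  simp only [Set.mem_preimage, Set.mem_ofPred_eq, Finset.univ_unique, Finset.sum_singleton,
    Fintype.sum_prod_type, ite_mul, zero_mul, Finset.sum_ite_eq, Finset.mem_univ, if_true]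
  rw [← Finset.mul_sum, mul_pow, sq s, hs2, inv_mul_eq_div, le_div_iff₀ hd']
  exact hg

/-- The pairing of a coupling matrix with `g` is the trace of `g`, typically of order `√d`, plus the
pairing of `w` with a Gaussian block, which a good `w` makes of order `d^{3/2}`. Dividing by the
Frobenius norm, of order `√d`, leaves order `d`. -/
theorem stdGauss_not_exists_mem_psdBall {d : ℕ} (hd : (262144 : ℝ) ≤ d * d) :
    stdGauss (Fin d × Fin d) {g | ¬ ∃ P ∈ psdBall d, 1 / 256 * (d : ℝ) ≤ ∑ p, P p * g p}
      ≤ ENNReal.ofReal (Real.exp (-(1 / 131072) * (d * d))) := by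
  have hd512 : (512 : ℝ) ≤ d := by nlinarith [(Nat.cast_nonneg d : (0 : ℝ) ≤ d)]
  have hd512' : 512 ≤ d := by exact_mod_cast hd512
  -- The blocks have sizes `2k` and `k`, which leaves room for Gram–Schmidt; the `l` remaining
  -- indices carry an identity block.
  obtain ⟨k, hk⟩ : ∃ k, k = d / 3 := ⟨_, rfl⟩
  obtain ⟨l, hl⟩ : ∃ l, l = d - 3 * k := ⟨_, rfl⟩
  obtain ⟨n, hn⟩ : ∃ n, n = 2 * k := ⟨_, rfl⟩
  have hsum : n + k + l = d := by omega
  have hkd : d ≤ 4 * k := by omega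
  have hkd' : (d : ℝ) ≤ 4 * k := by exact_mod_cast hkd
  have hn' : (n : ℝ) = 2 * k := by exact_mod_cast hn
  have hsum' : (n : ℝ) + k + l = d := by exact_mod_cast hsum
  let e : Fin d ≃ (Fin n ⊕ Fin k) ⊕ Fin l := Fintype.equivOfCardEq (by simp [hsum])
  let r : Fin n → Fin d := fun i => e.symm (.inl (.inl i))
  let c : Fin k → Fin d := fun j => e.symm (.inl (.inr j))
  have hr : Function.Injective r := fun i j h => by simpa [r] using h
  have hc : Function.Injective c := fun i j h => by simpa [c] using h
  have hrc : ∀ i j, r i ≠ c j := fun i j h => by simp [r, c] at h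
  have hmap := stdGauss_map_symmetrized_block r c hr hc hrc
  have hblock := pi_stdGauss_not_exists_orthonormal_pairing n k (by omega) (by omega)
  rw [← hmap] at hblock
  have htr := stdGauss_trace_sq_ge (d := d) (by omega) ((d : ℝ) ^ 2 / 16384)
  have hdpos : (0 : ℝ) < d := by linarith
  set q := Real.sqrt d with hq
  have hqpos : 0 < q := Real.sqrt_pos.2 hdpos
  have hq2 : q ^ 2 = d := Real.sq_sqrt hdpos.le
  have hsub : {g : Fin d × Fin d → ℝ | ¬ ∃ P ∈ psdBall d, 1 / 256 * (d : ℝ) ≤ ∑ p, P p * g p}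
      ⊆ {g | (d : ℝ) ^ 2 / 16384 * d ≤ (∑ a, g (a, a)) ^ 2} ∪
        (fun g j i => (Real.sqrt 2)⁻¹ * (g (r i, c j) + g (c j, r i))) ⁻¹'
          {h | ¬ ∃ w : Fin k → EuclideanSpace ℝ (Fin n), Orthonormal ℝ w ∧
            k * Real.sqrt n / 16 ≤ ∑ j, ∑ p, w j p * h j p} := by
    intro g hg
    by_contra hcon
    simp only [Set.mem_union, Set.mem_preimage, Set.mem_ofPred_eq, not_or, not_not, not_le] at hcon
    obtain ⟨h1, w, hw, hpair⟩ := hcon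
    apply hg
    -- The squared Frobenius norm is `n + 3k + l ≤ 4d`. The block contributes at least `d√d/64` and
    -- the trace at least `-d√d/128`, so at least `α d√d/128 = d/256` remains.
    set α : ℝ := 1 / (2 * q) with hα
    have hαpos : 0 < α := by positivity
    have hpsd := posSemidef_couplingMatrix (l := l) hw
    refine ⟨WithLp.toLp 2 fun p => α * couplingMatrix l w (e p.1) (e p.2), ⟨?_, ?_⟩, ?_⟩
    · convert! ((hpsd.submatrix e).smul hαpos.le).transpose using 1
    · refine abs_le_of_sq_le_sq' ?_ zero_le_one |>.2
      rw [EuclideanSpace.real_norm_sq_eq]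
      simp only [mul_pow, ← Finset.mul_sum, Fintype.sum_prod_type]
      have : ∑ a : Fin d, ∑ b : Fin d, couplingMatrix l w (e a) (e b) ^ 2 = n + 3 * k + l := by
        rw [← sum_couplingMatrix_sq (l := l) hw, ← e.sum_comp]
        exact Finset.sum_congr rfl fun a _ =>
          e.sum_comp fun v => couplingMatrix l w (e a) v ^ 2
      rw [this, hα, div_pow, mul_pow, hq2, div_mul_eq_mul_div, div_le_iff₀ (by positivity)]
      linarith
    · have hval : ∑ p : Fin d × Fin d, α * couplingMatrix l w (e p.1) (e p.2) * g p
          = α * (∑ a, g (a, a) + ∑ j, ∑ i, w j i * (g (r i, c j) + g (c j, r i))) := by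
        simp only [mul_assoc, ← Finset.mul_sum, Fintype.sum_prod_type]
        congr 1
        have h3 := sum_couplingMatrix_mul (l := l) w (fun u v => g (e.symm u, e.symm v))
        rw [← e.sum_comp, ← e.sum_comp (fun u => g (e.symm u, e.symm u))] at h3
        simp only [Equiv.symm_apply_apply] at h3
        rw [← h3]
        refine Finset.sum_congr rfl fun a _ => ?_
        rw [← e.sum_comp]
        simp
      have hval' : ∑ p : Fin d × Fin d, (WithLp.toLp 2 fun p : Fin d × Fin d =>
          α * couplingMatrix l w (e p.1) (e p.2) : EuclideanSpace ℝ (Fin d × Fin d)) p * g p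
          = ∑ p : Fin d × Fin d, α * couplingMatrix l w (e p.1) (e p.2) * g p := rfl
      rw [hval', hval]
      have hT : -(d * q / 128) ≤ ∑ a, g (a, a) := by
        refine (abs_le_of_sq_le_sq' ?_ (by positivity)).1
        rw [div_pow, mul_pow, hq2]
        linarith
      have h2pos : 0 < Real.sqrt 2 := by positivity
      have h22 : Real.sqrt 2 * Real.sqrt 2 = 2 := Real.mul_self_sqrt (by norm_num)
      have hW : Real.sqrt 2 * (k * Real.sqrt n / 16)
          ≤ ∑ j, ∑ i, w j i * (g (r i, c j) + g (c j, r i)) := by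
        have : ∑ j, ∑ i, w j i * ((Real.sqrt 2)⁻¹ * (g (r i, c j) + g (c j, r i)))
            = (Real.sqrt 2)⁻¹ * ∑ j, ∑ i, w j i * (g (r i, c j) + g (c j, r i)) := by
          simp only [Finset.mul_sum]
          exact Finset.sum_congr rfl fun _ _ => Finset.sum_congr rfl fun _ _ => by ring
        rw [this, ← div_eq_inv_mul, le_div_iff₀ h2pos] at hpair
        linarith
      have hn2 : q ≤ Real.sqrt 2 * Real.sqrt n := by
        rw [← Real.sqrt_mul (by norm_num), hn']
        exact Real.sqrt_le_sqrt (by linarith)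
      have hk0 : (0 : ℝ) ≤ k := by positivity
      have hW2 : d * q / 64 ≤ Real.sqrt 2 * (k * Real.sqrt n / 16) := by
        have : d / 4 * q ≤ k * (Real.sqrt 2 * Real.sqrt n) := by gcongr; linarith
        linarith
      calc 1 / 256 * (d : ℝ) = α * (d * q / 128) := by rw [hα]; field_simp; norm_num
        _ ≤ _ := by gcongr; linarith
  refine (measure_mono hsub).trans ((measure_union_le _ _).trans
    ((add_le_add htr ((Measure.le_map_apply (by fun_prop) _).trans hblock)).trans ?_))
  rw [← ENNReal.ofReal_add (by positivity) (by positivity)]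
  apply ENNReal.ofReal_le_ofReal
  have e1 : Real.exp (1 / 2 - (d : ℝ) ^ 2 / 16384 / 4) ≤ Real.exp (1 / 2 - (d * d) / 65536) := by
    apply Real.exp_le_exp.2; apply le_of_eq; ring
  have e2 : Real.exp (-((k : ℝ) * n / 16)) ≤ Real.exp (1 / 2 - (d * d) / 65536) := by
    apply Real.exp_le_exp.2
    rw [hn']
    nlinarith
  -- The constant `1 + 1/2` is absorbed by half of the exponent, since `d²/131072 ≥ 2`.
  have e3 : 2 * Real.exp (1 / 2 - (d * d : ℝ) / 65536) ≤ Real.exp (-(1 / 131072) * (d * d)) := by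
    have h2 : (2 : ℝ) ≤ Real.exp 1 := by linarith [Real.exp_one_gt_d9]
    calc 2 * Real.exp (1 / 2 - (d * d : ℝ) / 65536)
        ≤ Real.exp 1 * Real.exp (1 / 2 - (d * d : ℝ) / 65536) := by gcongr
      _ = Real.exp (1 + (1 / 2 - (d * d : ℝ) / 65536)) := (Real.exp_add _ _).symm
      _ ≤ _ := by apply Real.exp_le_exp.2; linarith
  linarith

/-- The unit ball is a set with large support function at a typical Gaussian vector. -/
theorem stdGauss_not_exists_mem_closedBall {ι : Type*} [Fintype ι] :
    stdGauss ι {g | ¬ ∃ P ∈ Metric.closedBall (0 : EuclideanSpace ℝ ι) 1,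
        1 / 2 * Real.sqrt (Fintype.card ι) ≤ ∑ p, P p * g p}
      ≤ ENNReal.ofReal (Real.exp (-(1 / 4) * Fintype.card ι)) := by
  refine (measure_mono ?_).trans ((stdGauss_sum_sq_le (Fintype.card ι / 4 : ℝ)).trans
    (ENNReal.ofReal_le_ofReal (Real.exp_le_exp.2 (by linarith))))
  intro g hg
  by_contra hcon
  simp only [Set.mem_ofPred_eq, not_le] at hcon
  apply hg
  set s := ∑ p, g p ^ 2 with hs
  have hspos : 0 < s := lt_of_le_of_lt (by positivity) hcon
  have hq := Real.sq_sqrt hspos.le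
  have hqpos := Real.sqrt_pos.2 hspos
  refine ⟨WithLp.toLp 2 fun p => (Real.sqrt s)⁻¹ * g p, ?_, ?_⟩
  · rw [mem_closedBall_zero_iff]
    refine abs_le_of_sq_le_sq' ?_ zero_le_one |>.2
    rw [EuclideanSpace.real_norm_sq_eq]
    simp only [mul_pow, ← Finset.mul_sum]
    rw [← hs, inv_pow, hq, inv_mul_cancel₀ hspos.ne', one_pow]
  · have : ∑ p, (WithLp.toLp 2 fun p => (Real.sqrt s)⁻¹ * g p : EuclideanSpace ℝ ι) p * g p
        = Real.sqrt s := by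
      simp only [mul_assoc, ← Finset.mul_sum, ← sq]
      rw [← hs]
      field_simp
      exact hq.symm
    rw [this]
    apply Real.le_sqrt_of_sq_le
    rw [mul_pow, Real.sq_sqrt (by positivity)]
    linarith

/-! ### Singular values, duality of the nuclear norm, Lipschitz bounds -/

section

variable {d₁ d₂ : ℕ} {J : Type} [Fintype J]

/-- The matrix `∑ i, σ i • u i (v i)ᵀ`. -/
def rankOneSum (σ : J → ℝ) (u : J → EuclideanSpace ℝ (Fin d₁)) (v : J → EuclideanSpace ℝ (Fin d₂)) :
    Matrix (Fin d₁) (Fin d₂) ℝ :=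
  Matrix.of fun a b => ∑ i, σ i * u i a * v i b

/-- The `v i` are eigenvectors of `TᵀT` and `u i = T (v i) / σ i`. Only the first `rank X` indices
are kept, so all `σ i` are positive. -/
theorem exists_singular_value_decomposition (X : Matrix (Fin d₁) (Fin d₂) ℝ) :
    ∃ (J : Type) (_ : Fintype J) (σ : J → ℝ) (u : J → EuclideanSpace ℝ (Fin d₁))
      (v : J → EuclideanSpace ℝ (Fin d₂)), Orthonormal ℝ u ∧ Orthonormal ℝ v ∧ (∀ i, 0 < σ i) ∧
      X = rankOneSum σ u v ∧ nuclearNorm X = ∑ i, σ i ∧ Fintype.card J = X.rank := by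
  set T := Matrix.toEuclideanLin X with hT
  have hn : Module.finrank ℝ (EuclideanSpace ℝ (Fin d₂)) = d₂ := by simp
  set b := T.isSymmetric_adjoint_comp_self.eigenvectorBasis hn with hb
  have hrank : X.rank = Module.finrank ℝ T.range := by
    rw [hT]; exact Matrix.rank_eq_finrank_range_toLin X
      (EuclideanSpace.basisFun _ ℝ).toBasis (EuclideanSpace.basisFun _ ℝ).toBasis
  have hinner : ∀ i j, inner ℝ (T (b i)) (T (b j)) = if i = j then T.singularValues i ^ 2 else 0 := by
    intro i j
    rw [← LinearMap.adjoint_inner_left]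
    have h1 := T.isSymmetric_adjoint_comp_self.apply_eigenvectorBasis hn i
    rw [LinearMap.comp_apply, ← hb] at h1
    rw [h1, T.sq_singularValues_fin hn i, inner_smul_left, orthonormal_iff_ite.1 b.orthonormal i j]
    simp
  have hpos : ∀ i : {i : Fin d₂ // i.val < X.rank}, 0 < T.singularValues i.1 := fun i => by
    rw [T.singularValues_pos_iff_lt_finrank_range, ← hrank]; exact i.2
  have hzero : ∀ i : {i : Fin d₂ // ¬ i.val < X.rank}, T.singularValues i.1 = 0 := fun i => by
    rw [T.singularValues_eq_zero_iff_le_finrank_range, ← hrank]; exact not_lt.1 i.2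
  have hTzero : ∀ i : {i : Fin d₂ // ¬ i.val < X.rank}, T (b i) = 0 := fun i => by
    have := hinner i i
    rw [if_pos rfl, hzero i, zero_pow two_ne_zero] at this
    exact inner_self_eq_zero.1 this
  refine ⟨{i : Fin d₂ // i.val < X.rank}, inferInstance, fun i => T.singularValues i.1,
    fun i => (T.singularValues i.1)⁻¹ • T (b i.1), fun i => b i.1, ?_, ?_, hpos, ?_, ?_, ?_⟩
  · rw [orthonormal_iff_ite]
    intro i j
    rw [inner_smul_left, inner_smul_right, hinner]
    by_cases h : i = j
    · subst h
      have := (hpos i).ne'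
      simp
      field_simp
    · have : i.1 ≠ j.1 := fun h' => h (Subtype.ext h')
      simp [h, this]
  · exact b.orthonormal.comp _ Subtype.val_injective
  · ext a c
    have h1 : X a c = (T (EuclideanSpace.single c 1)) a := by
      rw [hT]
      simp [Matrix.toEuclideanLin, Matrix.toLpLin_apply]
    have h2 : EuclideanSpace.single c (1 : ℝ) = ∑ i, (b i c) • b i := by
      conv_lhs => rw [← b.sum_repr' (EuclideanSpace.single c (1 : ℝ))]
      refine Finset.sum_congr rfl fun i _ => ?_
      simp [EuclideanSpace.inner_single_right]
    rw [h1, h2, map_sum]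
    simp only [map_smul, rankOneSum, Matrix.of_apply]
    rw [← Fintype.sum_subtype_add_sum_subtype (fun i : Fin d₂ => i.val < X.rank)]
    rw [Finset.sum_eq_zero (s := (Finset.univ : Finset {i : Fin d₂ // ¬ i.val < X.rank}))
      (fun i _ => by rw [hTzero i, smul_zero]), add_zero]
    simp only [WithLp.ofLp_sum, Finset.sum_apply, WithLp.ofLp_smul, Pi.smul_apply, smul_eq_mul]
    refine Finset.sum_congr rfl fun i _ => ?_
    rw [mul_inv_cancel_left₀ (hpos i).ne', mul_comm]
  · rw [nuclearNorm, Finset.sum_range, ← hT,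
      ← Fintype.sum_subtype_add_sum_subtype (fun i : Fin d₂ => i.val < X.rank)]
    rw [Finset.sum_eq_zero (s := (Finset.univ : Finset {i : Fin d₂ // ¬ i.val < X.rank}))
      (fun i _ => hzero i), add_zero]
  · have hle : X.rank ≤ d₂ := X.rank_le_width
    rw [Fintype.card_subtype]
    have : (Finset.univ.filter fun i : Fin d₂ => i.val < X.rank).card
        = (Finset.range X.rank).card := by
      rw [← Finset.card_map Fin.valEmbedding]
      congr 1
      ext i
      simp only [Finset.mem_map, Finset.mem_filter, Finset.mem_univ, true_and,
        Fin.valEmbedding_apply, Finset.mem_range]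
      exact ⟨fun ⟨a, ha, hai⟩ => hai ▸ ha, fun h => ⟨⟨i, h.trans_le hle⟩, h, rfl⟩⟩
    rw [this, Finset.card_range]

theorem sum_mul_rankOneSum (M : Matrix (Fin d₁) (Fin d₂) ℝ) (σ : J → ℝ)
    (u : J → EuclideanSpace ℝ (Fin d₁)) (v : J → EuclideanSpace ℝ (Fin d₂)) :
    ∑ a, ∑ b, rankOneSum σ u v a b * M a b = ∑ i, σ i * ∑ a, ∑ b, u i a * M a b * v i b := by
  simp only [rankOneSum, Matrix.of_apply, Finset.sum_mul, Finset.mul_sum]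
  rw [Finset.sum_comm' (t' := Finset.univ) (s' := fun _ => Finset.univ) (by simp)]
  rw [Finset.sum_comm]
  simp_rw [Finset.sum_comm (s := (Finset.univ : Finset (Fin d₂))) (t := (Finset.univ : Finset J))]
  rw [Finset.sum_comm]
  refine Finset.sum_congr rfl fun i _ => ?_
  exact Finset.sum_congr rfl fun a _ => Finset.sum_congr rfl fun b _ => by ring

theorem transpose_rankOneSum (σ : J → ℝ) (u : J → EuclideanSpace ℝ (Fin d₁))
    (v : J → EuclideanSpace ℝ (Fin d₂)) :
    (rankOneSum σ u v).transpose = rankOneSum σ v u := by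
  ext a b
  simp only [rankOneSum, Matrix.transpose_apply, Matrix.of_apply]
  exact Finset.sum_congr rfl fun i _ => by ring

/-- Column norms thus depend on `σ` only through the squares `σ i ^ 2`: lowering the singular values
does not increase `‖·‖_{1,2}`. -/
theorem sum_col_sq_rankOneSum (σ : J → ℝ) {u : J → EuclideanSpace ℝ (Fin d₁)}
    (hu : Orthonormal ℝ u) (v : J → EuclideanSpace ℝ (Fin d₂)) (b : Fin d₂) :
    ∑ a, rankOneSum σ u v a b ^ 2 = ∑ i, σ i ^ 2 * v i b ^ 2 := by
  have h1 : ‖∑ i, (σ i * v i b) • u i‖ ^ 2 = ∑ i, σ i ^ 2 * v i b ^ 2 := by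
    rw [← real_inner_self_eq_norm_sq, hu.inner_sum]
    exact Finset.sum_congr rfl fun i _ => by simp; ring
  rw [← h1, EuclideanSpace.real_norm_sq_eq]
  refine Finset.sum_congr rfl fun a _ => ?_
  simp only [rankOneSum, Matrix.of_apply, WithLp.ofLp_sum, Finset.sum_apply, WithLp.ofLp_smul,
    Pi.smul_apply, smul_eq_mul]
  congr 1
  exact Finset.sum_congr rfl fun i _ => by ring

theorem sum_sq_rankOneSum (σ : J → ℝ) {u : J → EuclideanSpace ℝ (Fin d₁)}
    (hu : Orthonormal ℝ u) {v : J → EuclideanSpace ℝ (Fin d₂)} (hv : Orthonormal ℝ v) :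
    ∑ a, ∑ b, rankOneSum σ u v a b ^ 2 = ∑ i, σ i ^ 2 := by
  rw [Finset.sum_comm]
  simp_rw [sum_col_sq_rankOneSum σ hu v]
  rw [Finset.sum_comm]
  refine Finset.sum_congr rfl fun i _ => ?_
  rw [← Finset.mul_sum, ← EuclideanSpace.real_norm_sq_eq, hv.1 i]
  simp

/-- A matrix of operator norm at most one, in terms of its bilinear form. -/
def IsContraction (M : Matrix (Fin d₁) (Fin d₂) ℝ) : Prop :=
  ∀ (x : EuclideanSpace ℝ (Fin d₁)) (y : EuclideanSpace ℝ (Fin d₂)),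
    ∑ a, ∑ b, x a * M a b * y b ≤ ‖x‖ * ‖y‖

/-- Cauchy–Schwarz over the index set, then Bessel's inequality for both families. -/
theorem isContraction_rankOneSum {u : J → EuclideanSpace ℝ (Fin d₁)}
    (hu : Orthonormal ℝ u) {v : J → EuclideanSpace ℝ (Fin d₂)} (hv : Orthonormal ℝ v) :
    IsContraction (rankOneSum (fun _ => 1) u v) := by
  intro x y
  have h1 : ∑ a, ∑ b, x a * rankOneSum (fun _ => (1 : ℝ)) u v a b * y b
      = ∑ i, inner ℝ (u i) x * inner ℝ (v i) y := by
    have := sum_mul_rankOneSum (Matrix.of fun a b => x a * y b) (fun _ : J => (1 : ℝ)) u v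
    simp only [Matrix.of_apply, one_mul] at this
    calc _ = ∑ a, ∑ b, rankOneSum (fun _ => (1 : ℝ)) u v a b * (x a * y b) :=
          Finset.sum_congr rfl fun a _ => Finset.sum_congr rfl fun b _ => by ring
      _ = _ := this
      _ = _ := by
        refine Finset.sum_congr rfl fun i _ => ?_
        rw [PiLp.inner_apply, PiLp.inner_apply, Finset.sum_mul_sum]
        refine Finset.sum_congr rfl fun a _ => Finset.sum_congr rfl fun b _ => ?_
        simp only [RCLike.inner_apply, conj_trivial]
        ring
  rw [h1]
  have hx : ∑ i, inner ℝ (u i) x ^ 2 ≤ ‖x‖ ^ 2 := by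
    have := hu.sum_inner_products_le x (s := Finset.univ)
    simpa using this
  have hy : ∑ i, inner ℝ (v i) y ^ 2 ≤ ‖y‖ ^ 2 := by
    have := hv.sum_inner_products_le y (s := Finset.univ)
    simpa using this
  refine abs_le_of_sq_le_sq' ?_ (by positivity) |>.2
  refine (Finset.sum_mul_sq_le_sq_mul_sq _ _ _).trans ?_
  rw [mul_pow]
  exact mul_le_mul hx hy (Finset.sum_nonneg fun _ _ => sq_nonneg _) (sq_nonneg _)

theorem sum_rankOneSum_mul_le {M : Matrix (Fin d₁) (Fin d₂) ℝ} (hM : IsContraction M)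
    {σ : J → ℝ} (hσ : ∀ i, 0 ≤ σ i) {u : J → EuclideanSpace ℝ (Fin d₁)}
    (hu : Orthonormal ℝ u) {v : J → EuclideanSpace ℝ (Fin d₂)} (hv : Orthonormal ℝ v) :
    ∑ a, ∑ b, rankOneSum σ u v a b * M a b ≤ ∑ i, σ i := by
  rw [sum_mul_rankOneSum]
  refine Finset.sum_le_sum fun i _ => ?_
  have := hM (u i) (v i)
  rw [hu.1 i, hv.1 i, one_mul] at this
  exact mul_le_of_le_one_right (hσ i) this

theorem sum_mul_le_nuclearNorm {M : Matrix (Fin d₁) (Fin d₂) ℝ} (hM : IsContraction M)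
    (X : Matrix (Fin d₁) (Fin d₂) ℝ) : ∑ a, ∑ b, X a b * M a b ≤ nuclearNorm X := by
  obtain ⟨J, _, σ, u, v, hu, hv, hσ, hX, hnuc, -⟩ := exists_singular_value_decomposition X
  rw [hnuc, hX]
  exact sum_rankOneSum_mul_le hM (fun i => (hσ i).le) hu hv

/-- The dual certificate is `UVᵀ`; its squared Frobenius norm is the rank. -/
theorem exists_isContraction_nuclearNorm_eq (X : Matrix (Fin d₁) (Fin d₂) ℝ) :
    ∃ M, IsContraction M ∧ nuclearNorm X = ∑ a, ∑ b, X a b * M a b ∧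
      ∑ a, ∑ b, M a b ^ 2 ≤ min (d₁ : ℝ) d₂ := by
  obtain ⟨J, _, σ, u, v, hu, hv, hσ, hX, hnuc, hcard⟩ := exists_singular_value_decomposition X
  refine ⟨rankOneSum (fun _ => 1) u v, isContraction_rankOneSum hu hv, ?_, ?_⟩
  -- Polarization: the squared Frobenius norms for the coefficients `σ + 1`, `σ` and `1` determine
  -- the inner product of `X` and `UVᵀ`.
  · have h1 := sum_sq_rankOneSum (fun i => σ i + 1) hu hv
    have h2 := sum_sq_rankOneSum σ hu hv
    have h3 := sum_sq_rankOneSum (fun _ => (1 : ℝ)) hu hv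
    have h4 : rankOneSum (fun i => σ i + 1) u v
        = rankOneSum σ u v + rankOneSum (fun _ => (1 : ℝ)) u v := by
      ext a b
      simp [rankOneSum, add_mul, Finset.sum_add_distrib]
    rw [h4] at h1
    simp only [Matrix.add_apply, add_sq, Finset.sum_add_distrib, h2, h3, mul_assoc,
      ← Finset.mul_sum, one_pow, mul_one] at h1
    rw [hnuc]
    conv_rhs => rw [hX]
    linarith
  · rw [sum_sq_rankOneSum _ hu hv]
    simp only [one_pow, Finset.sum_const, Finset.card_univ, nsmul_eq_mul, mul_one, hcard]
    exact le_min (by exact_mod_cast X.rank_le_height) (by exact_mod_cast X.rank_le_width)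

theorem nuclearNorm_nonneg (X : Matrix (Fin d₁) (Fin d₂) ℝ) : 0 ≤ nuclearNorm X :=
  Finset.sum_nonneg fun i _ => LinearMap.singularValues_nonneg _ i

theorem nuclearNorm_rankOneSum_le {σ : J → ℝ} (hσ : ∀ i, 0 ≤ σ i)
    {u : J → EuclideanSpace ℝ (Fin d₁)} (hu : Orthonormal ℝ u)
    {v : J → EuclideanSpace ℝ (Fin d₂)} (hv : Orthonormal ℝ v) :
    nuclearNorm (rankOneSum σ u v) ≤ ∑ i, σ i := by
  obtain ⟨M, hM, h, -⟩ := exists_isContraction_nuclearNorm_eq (rankOneSum σ u v)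
  rw [h]
  exact sum_rankOneSum_mul_le hM hσ hu hv

theorem frobNorm_nonneg (X : Matrix (Fin d₁) (Fin d₂) ℝ) : 0 ≤ frobNorm X := Real.sqrt_nonneg _

theorem frobNorm_sq (X : Matrix (Fin d₁) (Fin d₂) ℝ) :
    frobNorm X ^ 2 = ∑ i, ∑ j, X i j ^ 2 :=
  Real.sq_sqrt (Finset.sum_nonneg fun _ _ => Finset.sum_nonneg fun _ _ => sq_nonneg _)

theorem sum_mul_le_mul_frobNorm (X M : Matrix (Fin d₁) (Fin d₂) ℝ) {D : ℝ}
    (hM : ∑ a, ∑ b, M a b ^ 2 ≤ D) : ∑ a, ∑ b, X a b * M a b ≤ Real.sqrt D * frobNorm X := by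
  have hD : 0 ≤ D := le_trans (Finset.sum_nonneg fun _ _ => Finset.sum_nonneg fun _ _ => sq_nonneg _) hM
  refine abs_le_of_sq_le_sq' ?_ (mul_nonneg (Real.sqrt_nonneg _) (frobNorm_nonneg _)) |>.2
  rw [mul_pow, Real.sq_sqrt hD, frobNorm_sq]
  simp only [← Fintype.sum_prod_type'] at *
  refine (Finset.sum_mul_sq_le_sq_mul_sq _ _ _).trans ?_
  rw [mul_comm]
  exact mul_le_mul_of_nonneg_right hM (Finset.sum_nonneg fun _ _ => sq_nonneg _)

/-- The certificate of `X + P` pairs with `X` to at most the nuclear norm and with `P` by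
Cauchy–Schwarz. -/
theorem nuclearNorm_add_le (X P : Matrix (Fin d₁) (Fin d₂) ℝ) :
    nuclearNorm (X + P) ≤ nuclearNorm X + Real.sqrt (min (d₁ : ℝ) d₂) * frobNorm P := by
  obtain ⟨M, hM, h, hM2⟩ := exists_isContraction_nuclearNorm_eq (X + P)
  rw [h]
  simp only [Matrix.add_apply, add_mul, Finset.sum_add_distrib]
  exact add_le_add (sum_mul_le_nuclearNorm hM X) (sum_mul_le_mul_frobNorm P M hM2)

/-- Multiplying rows and columns by numbers in `[-1, 1]` does not increase the nuclear norm. -/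
theorem nuclearNorm_rescale_le (X : Matrix (Fin d₁) (Fin d₂) ℝ) {α : Fin d₁ → ℝ} {β : Fin d₂ → ℝ}
    (hα : ∀ a, |α a| ≤ 1) (hβ : ∀ b, |β b| ≤ 1) :
    nuclearNorm (Matrix.of fun a b => α a * X a b * β b) ≤ nuclearNorm X := by
  obtain ⟨M, hM, h, -⟩ :=
    exists_isContraction_nuclearNorm_eq (Matrix.of fun a b => α a * X a b * β b)
  have hnorm : ∀ {d : ℕ} (γ : Fin d → ℝ) (_ : ∀ a, |γ a| ≤ 1) (x : EuclideanSpace ℝ (Fin d)),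
      ‖(WithLp.toLp 2 fun a => γ a * x a : EuclideanSpace ℝ (Fin d))‖ ≤ ‖x‖ := by
    intro d γ hγ x
    rw [← sq_le_sq₀ (norm_nonneg _) (norm_nonneg _), EuclideanSpace.real_norm_sq_eq,
      EuclideanSpace.real_norm_sq_eq]
    refine Finset.sum_le_sum fun a _ => ?_
    rw [mul_pow]
    exact mul_le_of_le_one_left (sq_nonneg _) ((sq_le_one_iff_abs_le_one _).2 (hγ a))
  -- The rescaling is moved from `X` to the certificate, which stays a contraction.
  have hM' : IsContraction (Matrix.of fun a b => α a * M a b * β b) := by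
    intro x y
    have := hM (WithLp.toLp 2 fun a => α a * x a) (WithLp.toLp 2 fun b => β b * y b)
    refine le_trans (le_of_eq ?_) (this.trans (mul_le_mul (hnorm α hα x) (hnorm β hβ y)
      (norm_nonneg _) (norm_nonneg _)))
    exact Finset.sum_congr rfl fun a _ => Finset.sum_congr rfl fun b _ => by
      simp only [Matrix.of_apply]; ring
  rw [h]
  refine le_trans (le_of_eq ?_) (sum_mul_le_nuclearNorm hM' X)
  exact Finset.sum_congr rfl fun a _ => Finset.sum_congr rfl fun b _ => by
    simp only [Matrix.of_apply]; ring

theorem nuclearNorm_smul_le (X : Matrix (Fin d₁) (Fin d₂) ℝ) {c : ℝ} (hc : 0 ≤ c) :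
    nuclearNorm (c • X) ≤ c * nuclearNorm X := by
  obtain ⟨M, hM, h, -⟩ := exists_isContraction_nuclearNorm_eq (c • X)
  rw [h]
  simp only [Matrix.smul_apply, smul_eq_mul, mul_assoc, ← Finset.mul_sum]
  exact mul_le_mul_of_nonneg_left (sum_mul_le_nuclearNorm hM X) hc

theorem l12Norm_mono {X Y : Matrix (Fin d₁) (Fin d₂) ℝ}
    (h : ∀ b, ∑ a, X a b ^ 2 ≤ ∑ a, Y a b ^ 2) : l12Norm X ≤ l12Norm Y :=
  Finset.sum_le_sum fun b _ => Real.sqrt_le_sqrt (h b)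

theorem l12Norm_add_le (X P : Matrix (Fin d₁) (Fin d₂) ℝ) :
    l12Norm (X + P) ≤ l12Norm X + Real.sqrt d₂ * frobNorm P := by
  have h1 : l12Norm (X + P) ≤ l12Norm X + l12Norm P := by
    rw [l12Norm, l12Norm, l12Norm, ← Finset.sum_add_distrib]
    refine Finset.sum_le_sum fun b _ => ?_
    have := norm_add_le (WithLp.toLp 2 fun a => X a b : EuclideanSpace ℝ (Fin d₁))
      (WithLp.toLp 2 fun a => P a b)
    simpa [EuclideanSpace.norm_eq] using this
  have h2 : l12Norm P ≤ Real.sqrt d₂ * frobNorm P := by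
    refine abs_le_of_sq_le_sq' ?_ (mul_nonneg (Real.sqrt_nonneg _) (frobNorm_nonneg _)) |>.2
    rw [mul_pow, Real.sq_sqrt (by positivity), frobNorm_sq, Finset.sum_comm, l12Norm]
    have := sq_sum_le_card_mul_sum_sq (s := (Finset.univ : Finset (Fin d₂)))
      (f := fun b => Real.sqrt (∑ a, P a b ^ 2))
    refine this.trans (le_of_eq ?_)
    rw [Finset.card_univ, Fintype.card_fin]
    congr 1
    exact Finset.sum_congr rfl fun b _ => Real.sq_sqrt (Finset.sum_nonneg fun _ _ => sq_nonneg _)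
  linarith

theorem frobNorm_transpose (X : Matrix (Fin d₁) (Fin d₂) ℝ) : frobNorm X.transpose = frobNorm X := by
  rw [frobNorm, frobNorm, Finset.sum_comm]; rfl

theorem l1Norm_add_le (X P : Matrix (Fin d₁) (Fin d₂) ℝ) :
    l1Norm (X + P) ≤ l1Norm X + Real.sqrt (d₁ * d₂) * frobNorm P := by
  have h1 : l1Norm (X + P) ≤ l1Norm X + l1Norm P := by
    rw [l1Norm, l1Norm, l1Norm, ← Finset.sum_add_distrib]
    refine Finset.sum_le_sum fun a _ => ?_
    rw [← Finset.sum_add_distrib]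
    exact Finset.sum_le_sum fun b _ => abs_add_le _ _
  have h2 : l1Norm P ≤ Real.sqrt (d₁ * d₂) * frobNorm P := by
    have := sum_mul_le_mul_frobNorm (Matrix.of fun a b => |P a b|) (Matrix.of fun _ _ => 1)
      (D := d₁ * d₂) (by simp)
    simpa [l1Norm, frobNorm] using this
  linarith

theorem l1Norm_sq_le (X : Matrix (Fin d₁) (Fin d₂) ℝ) :
    l1Norm X ^ 2 ≤ d₁ * d₂ * frobNorm X ^ 2 := by
  have h := l1Norm_add_le 0 X
  have h0 : l1Norm (0 : Matrix (Fin d₁) (Fin d₂) ℝ) = 0 := by simp [l1Norm]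
  rw [zero_add, h0, zero_add] at h
  have hn : 0 ≤ l1Norm X := Finset.sum_nonneg fun _ _ => Finset.sum_nonneg fun _ _ => abs_nonneg _
  calc l1Norm X ^ 2 ≤ (Real.sqrt (d₁ * d₂) * frobNorm X) ^ 2 := by gcongr
    _ = _ := by rw [mul_pow, Real.sq_sqrt (by positivity)]

theorem l1Norm_smul (X : Matrix (Fin d₁) (Fin d₂) ℝ) {c : ℝ} (hc : 0 ≤ c) :
    l1Norm (c • X) = c * l1Norm X := by
  simp [l1Norm, abs_mul, abs_of_nonneg hc, Finset.mul_sum]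

end

/-! ### The descent criterion for failure, and the measurement event for matrices -/

open Filter Topology

section

variable {m d₁ d₂ : ℕ}

theorem measurements_apply (A : Fin m → Fin d₂ × Fin d₁ → ℝ) (X : Matrix (Fin d₁) (Fin d₂) ℝ)
    (i : Fin m) : measurements A X i = ∑ p, A i p * X p.2 p.1 := rfl

theorem measurements_add (A : Fin m → Fin d₂ × Fin d₁ → ℝ) (X Y : Matrix (Fin d₁) (Fin d₂) ℝ) :
    measurements A (X + Y) = measurements A X + measurements A Y := by
  ext i; simp [measurements_apply, mul_add, Finset.sum_add_distrib]

theorem measurements_sub (A : Fin m → Fin d₂ × Fin d₁ → ℝ) (X Y : Matrix (Fin d₁) (Fin d₂) ℝ) :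
    measurements A (X - Y) = measurements A X - measurements A Y := by
  ext i; simp [measurements_apply, mul_sub, Finset.sum_sub_distrib]

theorem measurements_smul (A : Fin m → Fin d₂ × Fin d₁ → ℝ) (c : ℝ)
    (X : Matrix (Fin d₁) (Fin d₂) ℝ) : measurements A (c • X) = c • measurements A X := by
  ext i
  simp only [measurements_apply, Matrix.smul_apply, smul_eq_mul, Pi.smul_apply, Finset.mul_sum]
  exact Finset.sum_congr rfl fun p _ => by ring

/-- A matrix fails to be recovered as soon as the objective decreases at rate `δ` along a path in
direction `-E` and the deviation of the measurements along the path can be corrected within the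
constraint set at a smaller cost. -/
theorem failsToRecover_of_path {f : Matrix (Fin d₁) (Fin d₂) ℝ → ℝ}
    {C C' : Set (Matrix (Fin d₁) (Fin d₂) ℝ)} {A : Fin m → Fin d₂ × Fin d₁ → ℝ}
    {X₀ E E' : Matrix (Fin d₁) (Fin d₂) ℝ} {L δ s : ℝ} {Y : ℝ → Matrix (Fin d₁) (Fin d₂) ℝ}
    (hs : 0 < s) (hL : 0 ≤ L) (hC : ∀ X ∈ C, ∀ P ∈ C', ∀ c : ℝ, 0 ≤ c → X + c • P ∈ C)
    (hsolve : ∀ z : EuclideanSpace ℝ (Fin m), ‖z‖ ≤ s →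
      ∃ P ∈ C', frobNorm P ≤ 1 ∧ ∀ i, measurements A P i = z i)
    (hlip : ∀ X P, f (X + P) ≤ f X + L * frobNorm P)
    (hY : ∀ᶠ t in 𝓝[>] (0 : ℝ), Y t ∈ C ∧ f (Y t) ≤ f X₀ - t * δ ∧
      X₀ - Y t = t • E - t ^ 2 • E')
    (hsmall : L * Real.sqrt (∑ i, measurements A E i ^ 2) < δ * s) :
    FailsToRecover f C A X₀ := by
  set aE : EuclideanSpace ℝ (Fin m) := WithLp.toLp 2 (measurements A E) with haE
  set aE' : EuclideanSpace ℝ (Fin m) := WithLp.toLp 2 (measurements A E') with haE'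
  have hnE : Real.sqrt (∑ i, measurements A E i ^ 2) = ‖aE‖ := by
    rw [EuclideanSpace.norm_eq]; simp [haE]
  rw [hnE] at hsmall
  -- The strict inequality leaves room for a `κ` above `‖A(E)‖` that absorbs the `t²` term for small
  -- `t`. Division by `L + 1` covers `L = 0`.
  obtain ⟨κ, hκ1, hκ2⟩ : ∃ κ, ‖aE‖ < κ ∧ L * κ < δ * s := by
    refine ⟨‖aE‖ + (δ * s - L * ‖aE‖) / (L + 1) / 2, ?_, ?_⟩
    · have : 0 < (δ * s - L * ‖aE‖) / (L + 1) / 2 := by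
        have := sub_pos.2 hsmall
        positivity
      linarith
    · have h1 : L * ((δ * s - L * ‖aE‖) / (L + 1)) ≤ δ * s - L * ‖aE‖ := by
        rw [mul_div_assoc', div_le_iff₀ (by positivity)]
        nlinarith [sub_pos.2 hsmall]
      nlinarith [sub_pos.2 hsmall]
  have hκ0 : 0 < κ := lt_of_le_of_lt (norm_nonneg _) hκ1
  have hsmallt : ∀ᶠ t in 𝓝[>] (0 : ℝ), ‖aE‖ + t * ‖aE'‖ < κ := by
    have hcont : ContinuousAt (fun t : ℝ => ‖aE‖ + t * ‖aE'‖) 0 := by fun_prop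
    have := hcont.eventually_lt (continuousAt_const (y := κ)) (by simpa using hκ1)
    exact this.filter_mono nhdsWithin_le_nhds
  obtain ⟨t, ⟨hYt, hft, hdiff⟩, htκ, ht⟩ :=
    (hY.and (hsmallt.and self_mem_nhdsWithin)).exists
  have ht0 : (0 : ℝ) < t := ht
  set z : EuclideanSpace ℝ (Fin m) := t • aE - t ^ 2 • aE' with hz
  have hzn : ‖z‖ ≤ t * κ := by
    calc ‖z‖ ≤ ‖t • aE‖ + ‖t ^ 2 • aE'‖ := norm_sub_le _ _
      _ = t * (‖aE‖ + t * ‖aE'‖) := by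
        rw [norm_smul, norm_smul, Real.norm_of_nonneg ht0.le, Real.norm_of_nonneg (sq_nonneg t)]
        ring
      _ ≤ t * κ := by gcongr
  have hzA : ∀ i, z i = measurements A X₀ i - measurements A (Y t) i := by
    intro i
    have h1 := congrFun (congrArg (measurements A) hdiff) i
    rw [measurements_sub, measurements_sub, measurements_smul, measurements_smul] at h1
    simp only [Pi.sub_apply, Pi.smul_apply] at h1
    rw [h1]
    simp [hz, haE, haE']
  -- The deviation `z`, of norm at most `tκ`, is scaled to norm at most `s`; the correction `(tκ/s)
  -- P` costs at most `Ltκ/s < tδ`.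
  obtain ⟨P, hP, hP1, hPz⟩ := hsolve ((s / (t * κ)) • z) (by
    rw [norm_smul, Real.norm_of_nonneg (by positivity), div_mul_eq_mul_div,
      div_le_iff₀ (by positivity)]
    gcongr)
  rintro ⟨-, hmin⟩
  have hfeas : Y t + (t * κ / s) • P ∈ feasible C A X₀ := by
    refine ⟨hC _ hYt P hP _ (by positivity), ?_⟩
    ext i
    rw [measurements_add, measurements_smul]
    simp only [Pi.add_apply, Pi.smul_apply, hPz, smul_eq_mul, PiLp.smul_apply]
    have hcancel : t * κ / s * (s / (t * κ)) = 1 := by field_simp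
    rw [← mul_assoc, hcancel, one_mul, hzA]
    ring
  have h1 := isMinOn_iff.1 hmin _ hfeas
  have h2 := hlip (Y t) ((t * κ / s) • P)
  have h3 : frobNorm ((t * κ / s) • P) ≤ t * κ / s := by
    have : frobNorm ((t * κ / s) • P) = t * κ / s * frobNorm P := by
      rw [frobNorm, frobNorm]
      simp only [Matrix.smul_apply, smul_eq_mul, mul_pow, ← Finset.mul_sum]
      rw [Real.sqrt_mul (sq_nonneg _), Real.sqrt_sq (by positivity)]
    rw [this]
    exact mul_le_of_le_one_right (by positivity) hP1
  have h4 : L * frobNorm ((t * κ / s) • P) < t * δ := by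
    calc L * frobNorm ((t * κ / s) • P) ≤ L * (t * κ / s) := by gcongr
      _ = t * (L * κ / s) := by ring
      _ < t * δ := by
        gcongr
        rwa [div_lt_iff₀ hs]
  linarith

theorem exists_const_measurements {a b η N₀ : ℝ} (ha : 0 < a) (hb : 0 < b) (hη : 0 < η)
    (hN₀ : 0 < N₀) :
    ∃ c₁ > (0 : ℝ), ∃ c₂ > (0 : ℝ), ∀ (m d₁ d₂ : ℕ)
      (S : Set (EuclideanSpace ℝ (Fin d₂ × Fin d₁))) (m₀ : ℝ)
      (E : Fin 3 → Matrix (Fin d₁) (Fin d₂) ℝ) (k : Fin 3 → ℝ),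
      Convex ℝ S → IsCompact S → (0 : EuclideanSpace ℝ (Fin d₂ × Fin d₁)) ∈ S →
      (∀ P ∈ S, ‖P‖ ≤ 1) →
      (N₀ ≤ Fintype.card (Fin d₂ × Fin d₁) →
        stdGauss (Fin d₂ × Fin d₁)
          {g | ¬ ∃ P ∈ S, a * Real.sqrt (Fintype.card (Fin d₂ × Fin d₁)) ≤ ∑ p, P p * g p}
          ≤ ENNReal.ofReal (Real.exp (-b * Fintype.card (Fin d₂ × Fin d₁)))) →
      (∀ j, ∑ p, ∑ q, E j p q ^ 2 ≤ k j) → m₀ ≤ (d₁ * d₂ : ℝ) → (m : ℝ) ≤ c₂ * m₀ →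
      gaussianEnsemble m d₁ d₂
        {A | ¬ ((∀ z : EuclideanSpace ℝ (Fin m), ‖z‖ ≤ a / 2 * Real.sqrt (d₁ * d₂) →
            ∃ P ∈ {P : Matrix (Fin d₁) (Fin d₂) ℝ | WithLp.toLp 2 P.vec ∈ S},
              frobNorm P ≤ 1 ∧ ∀ i, measurements A P i = z i) ∧
          ∀ j, ∑ i, measurements A (E j) i ^ 2 ≤ k j * (η * m₀))}
        ≤ ENNReal.ofReal (Real.exp (-c₁ * m₀)) := by
  obtain ⟨c₁, hc₁, c₂, hc₂, h⟩ := exists_const_solvable_and_small ha hb hη hN₀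
  refine ⟨c₁, hc₁, c₂, hc₂, ?_⟩
  intro m d₁ d₂ S m₀ E k hconv hcomp h0 hS1 hS hE hm₀ hm
  have hfrob : ∀ P : Matrix (Fin d₁) (Fin d₂) ℝ,
      frobNorm P = ‖(WithLp.toLp 2 P.vec : EuclideanSpace ℝ (Fin d₂ × Fin d₁))‖ := by
    intro P
    rw [EuclideanSpace.norm_eq, frobNorm]
    simp only [Real.norm_eq_abs, sq_abs, Fintype.sum_prod_type]
    rw [Finset.sum_comm]; rfl
  -- Without measurements the bad event is empty; the general estimate requires `1 ≤ m`.
  rcases Nat.eq_zero_or_pos m with rfl | hm1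
  · refine le_of_eq_of_le (measure_mono_null (t := ∅) ?_ measure_empty) zero_le
    intro A hA
    refine (hA ?_).elim
    have hm₀' : 0 ≤ m₀ := by
      rw [Nat.cast_zero] at hm
      exact nonneg_of_mul_nonneg_right hm hc₂
    refine ⟨fun z _ => ⟨0, ?_, ?_, fun i => i.elim0⟩, fun j => ?_⟩
    · simpa using h0
    · rw [hfrob]; simp
    · have : 0 ≤ k j := le_trans
        (Finset.sum_nonneg fun _ _ => Finset.sum_nonneg fun _ _ => sq_nonneg _) (hE j)
      simp only [Finset.univ_eq_empty, Finset.sum_empty]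
      positivity
  · have hcard : ((Fintype.card (Fin d₂ × Fin d₁) : ℕ) : ℝ) = d₁ * d₂ := by
      simp [mul_comm]
    refine (measure_mono ?_).trans (h (Fin d₂ × Fin d₁) m S m₀ (fun j => (E j).vec) k hconv hcomp h0
      hS1 hS (fun j => ?_) (hcard ▸ hm₀) hm1 hm)
    · intro A hA hgood
      apply hA
      refine ⟨fun z hz => ?_, fun j => hgood.2 j⟩
      rw [hcard] at hgood
      obtain ⟨P, hP, hPz⟩ := hgood.1 z hz
      have hPvec : WithLp.toLp 2 (Matrix.of fun i j => P (j, i)).vec = P := rfl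
      refine ⟨Matrix.of fun i j => P (j, i), ?_, ?_, hPz⟩
      · simpa only [Set.mem_ofPred_eq, hPvec] using hP
      · rw [hfrob, hPvec]; exact hS1 P hP
    · rw [Fintype.sum_prod_type, Finset.sum_comm]
      exact hE j

end

/-! ### Descent paths: shrinking columns and singular values -/

section Paths

variable {d₁ d₂ : ℕ}

/-- The Euclidean norm of a column. -/
noncomputable def colNorm (X : Matrix (Fin d₁) (Fin d₂) ℝ) (b : Fin d₂) : ℝ := Real.sqrt (∑ a, X a b ^ 2)

theorem colNorm_nonneg (X : Matrix (Fin d₁) (Fin d₂) ℝ) (b : Fin d₂) : 0 ≤ colNorm X b :=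
  Real.sqrt_nonneg _

theorem colNorm_sq (X : Matrix (Fin d₁) (Fin d₂) ℝ) (b : Fin d₂) :
    colNorm X b ^ 2 = ∑ a, X a b ^ 2 :=
  Real.sq_sqrt (Finset.sum_nonneg fun _ _ => sq_nonneg _)

theorem colNorm_ne_zero_iff (X : Matrix (Fin d₁) (Fin d₂) ℝ) (b : Fin d₂) :
    colNorm X b ≠ 0 ↔ ∃ a, X a b ≠ 0 := by
  rw [← not_iff_not, not_not, ← pow_eq_zero_iff two_ne_zero, colNorm_sq,
    Finset.sum_eq_zero_iff_of_nonneg fun _ _ => sq_nonneg _]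
  simp

theorem l02Count_eq_sum (X : Matrix (Fin d₁) (Fin d₂) ℝ) :
    (l02Count X : ℝ) = ∑ b, if colNorm X b ≠ 0 then 1 else 0 := by
  classical
  rw [l02Count, Finset.sum_boole, Set.ncard_eq_toFinset_card']
  congr 2
  ext b
  simp [colNorm_ne_zero_iff]

/-- Each nonzero column is normalized to length one; a zero column contributes `0` because `0 / 0 =
0`. -/
theorem sum_div_colNorm_sq (X : Matrix (Fin d₁) (Fin d₂) ℝ) :
    ∑ a, ∑ b, (X a b / colNorm X b) ^ 2 = l02Count X := by
  rw [Finset.sum_comm, l02Count_eq_sum]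
  refine Finset.sum_congr rfl fun b _ => ?_
  simp only [div_pow]
  rw [← Finset.sum_div, ← colNorm_sq]
  split_ifs with h
  · exact div_self (pow_ne_zero 2 h)
  · rw [not_not.1 h]; simp

/-- The factor shortens every nonzero column by exactly `t`, so the rate of descent is the number of
nonzero columns. -/
theorem sum_colNorm_mul_one_sub (X : Matrix (Fin d₁) (Fin d₂) ℝ) (t : ℝ) :
    ∑ b, colNorm X b * (1 - t / colNorm X b) = l12Norm X - t * l02Count X := by
  rw [l02Count_eq_sum, Finset.mul_sum, l12Norm, ← Finset.sum_sub_distrib]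
  refine Finset.sum_congr rfl fun b _ => ?_
  change _ = colNorm X b - _
  split_ifs with h
  · field_simp
  · rw [not_not.1 h]; simp

theorem eventually_one_sub_div_mem {J : Type*} [Finite J] (c : J → ℝ) (hc : ∀ j, 0 ≤ c j) :
    ∀ᶠ t in 𝓝[>] (0 : ℝ), ∀ j, 0 ≤ 1 - t / c j ∧ 1 - t / c j ≤ 1 := by
  rw [eventually_all]
  intro j
  rcases (hc j).eq_or_lt with h | h
  · simp [← h]
  · filter_upwards [Ioo_mem_nhdsGT h] with t ht
    have h1 : t / c j ≤ 1 := (div_le_one h).2 ht.2.le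
    have h2 : 0 ≤ t / c j := div_nonneg ht.1.le h.le
    constructor <;> linarith

/-- Shrinking each column by a factor in `[0, 1]`. -/
theorem l12Norm_rescale_columns_le (X : Matrix (Fin d₁) (Fin d₂) ℝ) {α : Fin d₁ → ℝ}
    {β : Fin d₂ → ℝ} (hα : ∀ a, |α a| ≤ 1) (hβ : ∀ b, 0 ≤ β b) :
    l12Norm (Matrix.of fun a b => α a * X a b * β b) ≤ ∑ b, colNorm X b * β b := by
  refine Finset.sum_le_sum fun b _ => ?_
  rw [Real.sqrt_le_left (mul_nonneg (colNorm_nonneg _ _) (hβ b)), mul_pow, colNorm_sq,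
    Finset.sum_mul]
  refine Finset.sum_le_sum fun a _ => ?_
  simp only [Matrix.of_apply, mul_pow]
  gcongr
  exact mul_le_of_le_one_left (sq_nonneg _) ((sq_le_one_iff_abs_le_one _).2 (hα a))

/-- The smallest submatrix is spanned by the nonzero rows and columns: minimality is tested against
exactly these sets. -/
theorem IsSL.l02Count_eq {X : Matrix (Fin d₁) (Fin d₂) ℝ} {k₁ k₂ r : ℕ} (h : IsSL X k₁ k₂ r) :
    l02Count X = k₂ ∧ l02Count X.transpose = k₁ := by
  classical
  obtain ⟨⟨I, J, hIJ, hmin, rfl, rfl⟩, -⟩ := h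
  have hsupp := hmin (Finset.univ.filter fun i => ∃ j, X i j ≠ 0)
    (Finset.univ.filter fun j => ∃ i, X i j ≠ 0)
    (fun i j hij => by simp; exact ⟨⟨j, hij⟩, ⟨i, hij⟩⟩)
  constructor
  · rw [l02Count, Set.ncard_eq_toFinset_card']
    congr 1
    ext j
    constructor
    · intro hj
      obtain ⟨i, hij⟩ : ∃ i, X i j ≠ 0 := by simpa using hj
      exact (hIJ i j hij).2
    · intro hj
      simpa using hsupp.2 hj
  · rw [l02Count, Set.ncard_eq_toFinset_card']
    congr 1
    ext i
    constructor
    · intro hi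
      obtain ⟨j, hij⟩ : ∃ j, X i j ≠ 0 := by
        rw [Set.mem_toFinset] at hi; exact hi
      exact (hIJ i j hij).1
    · intro hi
      rw [Set.mem_toFinset]
      simpa using hsupp.1 hi

theorem rank_le_l02Count (X : Matrix (Fin d₁) (Fin d₂) ℝ) : X.rank ≤ l02Count X := by
  classical
  let δ : Fin d₂ → ℝ := fun b => if ∃ a, X a b ≠ 0 then 1 else 0
  have h : X = X * Matrix.diagonal δ := by
    ext a b
    rw [Matrix.mul_diagonal]
    by_cases hb : ∃ a, X a b ≠ 0
    · simp only [δ, if_pos hb, mul_one]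
    · have : X a b = 0 := by
        by_contra h0; exact hb ⟨a, h0⟩
      simp [this]
  calc X.rank = (X * Matrix.diagonal δ).rank := by rw [← h]
    _ ≤ (Matrix.diagonal δ).rank := Matrix.rank_mul_le_right _ _
    _ = l02Count X := by
      rw [Matrix.rank_diagonal, l02Count, Set.ncard_eq_toFinset_card', Fintype.card_subtype]
      congr 1
      ext b
      simp [δ]

/-- Reducing the coefficients of a singular value decomposition. -/
theorem rankOneSum_sub_path {J : Type} [Fintype J] {σ : J → ℝ} (hσ : ∀ i, 0 < σ i)
    {u : J → EuclideanSpace ℝ (Fin d₁)} {v : J → EuclideanSpace ℝ (Fin d₂)}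
    (hu : Orthonormal ℝ u) (hv : Orthonormal ℝ v) :
    ∀ᶠ t in 𝓝[>] (0 : ℝ), (∀ i, 0 ≤ σ i - t) ∧
      nuclearNorm (rankOneSum (fun i => σ i - t) u v) ≤ ∑ i, σ i - t * Fintype.card J ∧
      l12Norm (rankOneSum (fun i => σ i - t) u v) ≤ l12Norm (rankOneSum σ u v) := by
  have h : ∀ᶠ t in 𝓝[>] (0 : ℝ), ∀ i, t < σ i := by
    rw [eventually_all]
    intro i
    filter_upwards [Ioo_mem_nhdsGT (hσ i)] with t ht using ht.2
  filter_upwards [h, self_mem_nhdsWithin] with t ht ht0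
  have ht0' : (0 : ℝ) < t := ht0
  refine ⟨fun i => sub_nonneg.2 (ht i).le, ?_, ?_⟩
  · refine (nuclearNorm_rankOneSum_le (fun i => sub_nonneg.2 (ht i).le) hu hv).trans (le_of_eq ?_)
    rw [Finset.sum_sub_distrib]
    simp [mul_comm]
  · refine l12Norm_mono fun b => ?_
    rw [sum_col_sq_rankOneSum _ hu, sum_col_sq_rankOneSum _ hu]
    refine Finset.sum_le_sum fun i _ => ?_
    have h1 : 0 ≤ σ i - t := sub_nonneg.2 (ht i).le
    gcongr
    linarith

end Paths

/-! ### Positive semidefinite matrices: spectral decomposition and congruence -/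

section Spectral

variable {d : ℕ} {J : Type} [Fintype J]

theorem posSemidef_rankOneSum {σ : J → ℝ} (hσ : ∀ i, 0 ≤ σ i) (v : J → EuclideanSpace ℝ (Fin d)) :
    (rankOneSum σ v v).PosSemidef := by
  have h : rankOneSum σ v v = ∑ i, σ i • Matrix.vecMulVec (v i).ofLp (star (v i).ofLp) := by
    ext a b
    simp [rankOneSum, Matrix.sum_apply, Matrix.vecMulVec_apply, mul_assoc]
  rw [h]
  exact Matrix.posSemidef_sum _ fun i _ =>
    (Matrix.posSemidef_vecMulVec_self_star _).smul (hσ i)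

theorem sum_rankOneSum_mul_vec [DecidableEq J] (σ : J → ℝ) (u : J → EuclideanSpace ℝ (Fin d))
    {v : J → EuclideanSpace ℝ (Fin d)} (hv : Orthonormal ℝ v) (i : J) (a : Fin d) :
    ∑ b, rankOneSum σ u v a b * v i b = σ i * u i a := by
  have h : ∀ j, ∑ b, v j b * v i b = if j = i then 1 else 0 := fun j => by
    rw [← orthonormal_iff_ite.1 hv j i, PiLp.inner_apply]
    exact Finset.sum_congr rfl fun b _ => by simp [mul_comm]
  simp only [rankOneSum, Matrix.of_apply, Finset.sum_mul]
  rw [Finset.sum_comm]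
  simp only [mul_assoc, ← Finset.mul_sum, h]
  simp

/-- Spectral decomposition of a positive semidefinite matrix. -/
theorem exists_spectral_decomposition {X : Matrix (Fin d) (Fin d) ℝ} (hX : X.PosSemidef) :
    ∃ (J : Type) (_ : Fintype J) (σ : J → ℝ) (v : J → EuclideanSpace ℝ (Fin d)),
      Orthonormal ℝ v ∧ (∀ i, 0 < σ i) ∧ X = rankOneSum σ v v ∧ nuclearNorm X = ∑ i, σ i ∧
      Fintype.card J = X.rank := by
  classical
  obtain ⟨J, _, σ, u, v, hu, hv, hσ, hXeq, hnuc, hcard⟩ := exists_singular_value_decomposition X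
  have hsymm : X.transpose = X := by
    rw [← Matrix.conjTranspose_eq_transpose_of_trivial]
    exact hX.isHermitian
  -- From `X v = σ u` and `X u = σ v`, the quadratic form of `X` at `v - u` equals `-σ‖v - u‖²`, so
  -- positivity forces `u = v`.
  have huv : u = v := by
    funext i
    have h1 : ∀ a, ∑ b, X a b * v i b = σ i * u i a := fun a => by
      conv_lhs => rw [hXeq]
      exact sum_rankOneSum_mul_vec σ u hv i a
    have h2 : ∀ a, ∑ b, X a b * u i b = σ i * v i a := fun a => by
      conv_lhs => rw [← hsymm, hXeq, transpose_rankOneSum]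
      exact sum_rankOneSum_mul_vec σ v hu i a
    have h3 := hX.dotProduct_mulVec_nonneg (v i - u i).ofLp
    have h4 : star (v i - u i).ofLp ⬝ᵥ X.mulVec (v i - u i).ofLp = -(σ i * ‖v i - u i‖ ^ 2) := by
      rw [EuclideanSpace.real_norm_sq_eq, Finset.mul_sum, ← Finset.sum_neg_distrib, dotProduct]
      refine Finset.sum_congr rfl fun a _ => ?_
      have : X.mulVec (v i - u i).ofLp a = σ i * u i a - σ i * v i a := by
        rw [← h1 a, ← h2 a, ← Finset.sum_sub_distrib, Matrix.mulVec, dotProduct]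
        exact Finset.sum_congr rfl fun b _ => by simp; ring
      rw [this]
      simp
      ring
    rw [h4] at h3
    have h5 : ‖v i - u i‖ ^ 2 ≤ 0 := by
      by_contra! hpos
      have := mul_pos (hσ i) hpos
      linarith
    have h6 : ‖v i - u i‖ = 0 := by
      have := sq_nonneg ‖v i - u i‖
      exact pow_eq_zero_iff two_ne_zero |>.1 (le_antisymm h5 this)
    exact (sub_eq_zero.1 (norm_eq_zero.1 h6)).symm
  subst huv
  exact ⟨J, _, σ, u, hu, hσ, hXeq, hnuc, hcard⟩

theorem Matrix.PosSemidef.rescale {X : Matrix (Fin d) (Fin d) ℝ} (hX : X.PosSemidef)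
    (β : Fin d → ℝ) : (Matrix.of fun a b => β a * X a b * β b).PosSemidef := by
  have := hX.mul_mul_conjTranspose_same (Matrix.diagonal β)
  convert! this using 1
  ext a b
  simp [Matrix.mul_diagonal, Matrix.diagonal_mul]

end Spectral

/-! ### Failure of the convex programs -/

theorem l02Count_pos {d₁ d₂ : ℕ} {X : Matrix (Fin d₁) (Fin d₂) ℝ} (hX : X ≠ 0) :
    0 < l02Count X := by
  have : ∃ a b, X a b ≠ 0 := by
    by_contra! h
    exact hX (Matrix.ext h)
  obtain ⟨a, b, hab⟩ := this
  rw [l02Count, Set.ncard_pos]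
  exact ⟨b, a, hab⟩

theorem rank_pos {d₁ d₂ : ℕ} {X : Matrix (Fin d₁) (Fin d₂) ℝ} (hX : X ≠ 0) : 0 < X.rank := by
  obtain ⟨J, _, σ, u, v, -, -, -, hXeq, -, hcard⟩ := exists_singular_value_decomposition X
  rw [← hcard, Fintype.card_pos_iff]
  by_contra hJ
  rw [not_nonempty_iff] at hJ
  refine hX ?_
  rw [hXeq]
  ext a b
  simp [rankOneSum]

theorem l02Count_le {d₁ d₂ : ℕ} (X : Matrix (Fin d₁) (Fin d₂) ℝ) : l02Count X ≤ d₂ := by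
  rw [l02Count]
  simpa using Set.ncard_le_card {j : Fin d₂ | ∃ i, X i j ≠ 0}

-- The weighted Lipschitz constants are `√d₂`, `l₁√d₁` and `l₂√(min d₁ d₂)`. The path follows a
-- largest of them: it shortens columns, shortens rows or lowers singular values, and each of these
-- moves increases none of the three norms.
set_option maxHeartbeats 1000000 in
theorem failsToRecover_general :
    ∃ c₁ > (0 : ℝ), ∃ c₂ > (0 : ℝ), ∀ (m d₁ d₂ k₁ k₂ r : ℕ) (X₀ : Matrix (Fin d₁) (Fin d₂) ℝ),
      X₀ ≠ 0 → IsSL X₀ k₁ k₂ r →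
      ∀ m₀ : ℝ, m₀ = min ((d₁ : ℝ) * k₂) (min ((d₂ : ℝ) * k₁) (((d₁ : ℝ) + d₂) * r)) →
      (m : ℝ) ≤ c₂ * m₀ →
      HoldsExceptWithProb (gaussianEnsemble m d₁ d₂) (Real.exp (-c₁ * m₀))
        (fun A => ∀ l₁ l₂ : ℝ, 0 ≤ l₁ → 0 ≤ l₂ →
          FailsToRecover (fun X => l12Norm X + l₁ * l12Norm X.transpose + l₂ * nuclearNorm X)
            Set.univ A X₀) := by
  obtain ⟨c₁, hc₁, c₂, hc₂, h⟩ := exists_const_measurements (a := 1 / 2) (b := 1 / 4)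
    (η := 1 / 300) (N₀ := 1) (by norm_num) (by norm_num) (by norm_num) one_pos
  refine ⟨c₁, hc₁, c₂, hc₂, ?_⟩
  intro m d₁ d₂ k₁ k₂ r X₀ hX₀ hSL m₀ hm₀ hm
  obtain ⟨hk₂, hk₁⟩ := hSL.l02Count_eq
  have hr := hSL.2
  obtain ⟨J, _, σ, u, v, hu, hv, hσ, hXeq, hnuc, hcard⟩ := exists_singular_value_decomposition X₀
  have hX₀t : X₀.transpose ≠ 0 := fun h0 => hX₀ (by simpa using congrArg Matrix.transpose h0)
  have hk₂pos : (0 : ℝ) < k₂ := by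
    rw [← hk₂]; exact_mod_cast l02Count_pos hX₀
  have hk₁pos : (0 : ℝ) < k₁ := by
    rw [← hk₁]; exact_mod_cast l02Count_pos hX₀t
  have hrpos : (0 : ℝ) < r := by
    rw [← hr]; exact_mod_cast rank_pos hX₀
  have hk₂d : (k₂ : ℝ) ≤ d₂ := by
    rw [← hk₂]
    exact_mod_cast l02Count_le X₀
  have hd₂pos : (0 : ℝ) < d₂ := hk₂pos.trans_le hk₂d
  have hk₁d : (k₁ : ℝ) ≤ d₁ := by
    rw [← hk₁]
    exact_mod_cast l02Count_le X₀.transpose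
  have hd₁pos : (0 : ℝ) < d₁ := hk₁pos.trans_le hk₁d
  have hm₁ : m₀ ≤ d₁ * k₂ := hm₀ ▸ min_le_left _ _
  have hm₂ : m₀ ≤ d₂ * k₁ := hm₀ ▸ (min_le_right _ _).trans (min_le_left _ _)
  have hm₃ : m₀ ≤ (d₁ + d₂) * r := hm₀ ▸ (min_le_right _ _).trans (min_le_right _ _)
  set N : ℝ := (d₁ : ℝ) * d₂ with hN
  have hNpos : 0 < N := mul_pos hd₁pos hd₂pos
  obtain ⟨E₀, hE₀⟩ : ∃ E : Matrix (Fin d₁) (Fin d₂) ℝ,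
      E = Matrix.of fun a b => X₀ a b / colNorm X₀ b := ⟨_, rfl⟩
  obtain ⟨E₁, hE₁⟩ : ∃ E : Matrix (Fin d₁) (Fin d₂) ℝ,
      E = Matrix.of fun a b => X₀ a b / colNorm X₀.transpose a := ⟨_, rfl⟩
  obtain ⟨E₂, hE₂⟩ : ∃ E : Matrix (Fin d₁) (Fin d₂) ℝ, E = rankOneSum (fun _ => 1) u v := ⟨_, rfl⟩
  have hprob := h m d₁ d₂ (Metric.closedBall 0 1) m₀ ![E₀, E₁, E₂] ![k₂, k₁, r]
    (convex_closedBall _ _) (isCompact_closedBall _ _) (by simp) (fun P hP => by simpa using hP)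
    (fun _ => stdGauss_not_exists_mem_closedBall) (by
      intro j
      fin_cases j
      · change ∑ p, ∑ q, E₀ p q ^ 2 ≤ (k₂ : ℝ)
        rw [hE₀, ← hk₂]
        exact (sum_div_colNorm_sq X₀).le
      · change ∑ p, ∑ q, E₁ p q ^ 2 ≤ (k₁ : ℝ)
        rw [hE₁, ← hk₁, Finset.sum_comm]
        exact (sum_div_colNorm_sq X₀.transpose).le
      · change ∑ p, ∑ q, E₂ p q ^ 2 ≤ (r : ℝ)
        rw [hE₂, sum_sq_rankOneSum _ hu hv]
        simp [hcard, hr]) (hm₁.trans (by gcongr)) hm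
  refine (measure_mono ?_).trans hprob
  intro A hA hgood
  apply hA
  obtain ⟨hsolve, hsmall⟩ := hgood
  have hsmall₀ : ∑ i, measurements A E₀ i ^ 2 ≤ k₂ * (1 / 300 * m₀) := hsmall 0
  have hsmall₁ : ∑ i, measurements A E₁ i ^ 2 ≤ k₁ * (1 / 300 * m₀) := hsmall 1
  have hsmall₂ : ∑ i, measurements A E₂ i ^ 2 ≤ r * (1 / 300 * m₀) := hsmall 2
  clear hsmall hprob h hA
  intro l₁ l₂ hl₁ hl₂
  set D₃ : ℝ := min (d₁ : ℝ) d₂ with hD₃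
  have hD₃0 : 0 ≤ D₃ := by positivity
  set L : ℝ := Real.sqrt d₂ + l₁ * Real.sqrt d₁ + l₂ * Real.sqrt D₃ with hL
  have hL0 : 0 ≤ L := by positivity
  have hlip : ∀ X P : Matrix (Fin d₁) (Fin d₂) ℝ,
      l12Norm (X + P) + l₁ * l12Norm (X + P).transpose + l₂ * nuclearNorm (X + P)
      ≤ l12Norm X + l₁ * l12Norm X.transpose + l₂ * nuclearNorm X + L * frobNorm P := by
    intro X P
    have h1 := l12Norm_add_le X P
    have h2 := mul_le_mul_of_nonneg_left (l12Norm_add_le X.transpose P.transpose) hl₁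
    have h3 := mul_le_mul_of_nonneg_left (nuclearNorm_add_le X P) hl₂
    rw [frobNorm_transpose] at h2
    rw [Matrix.transpose_add, hL]
    nlinarith
  have hs : 0 < 1 / 2 / 2 * Real.sqrt N := by
    have := Real.sqrt_pos.2 hNpos
    positivity
  -- For a dominating penalty with weight `l` and Lipschitz constant `√D`, `L ≤ 3l√D`, while the
  -- path has rate `lK` and `‖E‖_F² ≤ K`. The value `η = 1/300` works since `2/300 < 1/144`.
  have key : ∀ l K D Q : ℝ, 0 < l → 0 < K → 0 ≤ D → L ≤ 3 * (l * Real.sqrt D) →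
      D * m₀ ≤ 2 * K * N → 0 ≤ Q → Q ≤ K * (1 / 300 * m₀) →
      L * Real.sqrt Q < l * K * (1 / 2 / 2 * Real.sqrt N) := by
    intro l K D Q hl hK hD hLD hDm hQ0 hQ
    have h1 : Real.sqrt D * Real.sqrt Q < K * Real.sqrt N / 12 := by
      refine lt_of_pow_lt_pow_left₀ 2 (by positivity) ?_
      rw [mul_pow, Real.sq_sqrt hD, Real.sq_sqrt hQ0, div_pow, mul_pow, Real.sq_sqrt hNpos.le]
      have h2 : D * Q ≤ K / 300 * (D * m₀) := by
        calc D * Q ≤ D * (K * (1 / 300 * m₀)) := by gcongr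
          _ = _ := by ring
      have h3 : K / 300 * (D * m₀) ≤ K / 300 * (2 * K * N) := by gcongr
      have h4 : 0 < K ^ 2 * N := by positivity
      nlinarith
    calc L * Real.sqrt Q ≤ 3 * (l * Real.sqrt D) * Real.sqrt Q := by gcongr
      _ = 3 * l * (Real.sqrt D * Real.sqrt Q) := by ring
      _ < 3 * l * (K * Real.sqrt N / 12) := by gcongr
      _ = _ := by ring
  have hQ0 : ∀ E : Matrix (Fin d₁) (Fin d₂) ℝ, 0 ≤ ∑ i, measurements A E i ^ 2 := fun _ =>
    Finset.sum_nonneg fun _ _ => sq_nonneg _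
  have hsq0 := Real.sqrt_nonneg (d₂ : ℝ)
  have hsq1 : 0 ≤ l₁ * Real.sqrt d₁ := by positivity
  have hsq2 : 0 ≤ l₂ * Real.sqrt D₃ := by positivity
  have hsqpos : 0 < Real.sqrt (d₂ : ℝ) := Real.sqrt_pos.2 hd₂pos
  have hC : ∀ X ∈ (Set.univ : Set (Matrix (Fin d₁) (Fin d₂) ℝ)),
      ∀ P ∈ {P : Matrix (Fin d₁) (Fin d₂) ℝ | WithLp.toLp 2 P.vec ∈
        Metric.closedBall (0 : EuclideanSpace ℝ (Fin d₂ × Fin d₁)) 1},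
      ∀ c : ℝ, 0 ≤ c → X + c • P ∈ (Set.univ : Set (Matrix (Fin d₁) (Fin d₂) ℝ)) :=
    fun _ _ _ _ _ _ => Set.mem_univ _
  have hmono : ∀ {p q : ℕ} (X Y : Matrix (Fin p) (Fin q) ℝ), (∀ a b, X a b ^ 2 ≤ Y a b ^ 2) →
      l12Norm X ≤ l12Norm Y := fun X Y hXY =>
    l12Norm_mono fun b => Finset.sum_le_sum fun a _ => hXY a b
  by_cases hcase : l₁ * Real.sqrt d₁ ≤ Real.sqrt d₂ ∧ l₂ * Real.sqrt D₃ ≤ Real.sqrt d₂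
  · refine failsToRecover_of_path (E := E₀) (E' := 0) (L := L) (δ := 1 * k₂)
      (Y := fun t => Matrix.of fun a b => 1 * X₀ a b * (1 - t / colNorm X₀ b))
      hs hL0 hC hsolve hlip ?_ (key 1 k₂ d₂ _ one_pos hk₂pos hd₂pos.le (by linarith) ?_
        (hQ0 _) hsmall₀)
    · filter_upwards [eventually_one_sub_div_mem (colNorm X₀) (colNorm_nonneg X₀)] with t ht
      refine ⟨Set.mem_univ _, ?_, ?_⟩
      · have h1 := l12Norm_rescale_columns_le X₀ (α := fun _ => 1)
          (β := fun b => 1 - t / colNorm X₀ b) (by simp) (fun b => (ht b).1)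
        rw [sum_colNorm_mul_one_sub, hk₂] at h1
        have h2 : l12Norm (Matrix.of fun a b => 1 * X₀ a b * (1 - t / colNorm X₀ b)).transpose
            ≤ l12Norm X₀.transpose := hmono _ _ fun b a => by
          simp only [Matrix.transpose_apply, Matrix.of_apply, one_mul, mul_pow]
          exact mul_le_of_le_one_right (sq_nonneg _) (pow_le_one₀ (ht b).1 (ht b).2)
        have h3 := nuclearNorm_rescale_le X₀ (α := fun _ => 1)
          (β := fun b => 1 - t / colNorm X₀ b) (by simp)
          (fun b => abs_le.2 ⟨by linarith [(ht b).1], (ht b).2⟩)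
        have h4 := mul_le_mul_of_nonneg_left h2 hl₁
        have h5 := mul_le_mul_of_nonneg_left h3 hl₂
        linarith
      · ext a b
        simp [hE₀]
        ring
    · have h1 : (d₂ : ℝ) * m₀ ≤ d₂ * (d₁ * k₂) := by gcongr
      have h2 : (d₂ : ℝ) * (d₁ * k₂) = k₂ * N := by rw [hN]; ring
      have h3 : 0 < k₂ * N := by positivity
      linarith
  by_cases hcase2 : l₂ * Real.sqrt D₃ ≤ l₁ * Real.sqrt d₁ ∧ Real.sqrt d₂ ≤ l₁ * Real.sqrt d₁
  · have hl₁pos : 0 < l₁ := by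
      rcases hl₁.eq_or_lt with h0 | h0
      · exfalso
        rw [← h0] at hcase2
        linarith [hcase2.2]
      · exact h0
    refine failsToRecover_of_path (E := E₁) (E' := 0) (L := L) (δ := l₁ * k₁)
      (Y := fun t => Matrix.of fun a b => (1 - t / colNorm X₀.transpose a) * X₀ a b * 1)
      hs hL0 hC hsolve hlip ?_ (key l₁ k₁ d₁ _ hl₁pos hk₁pos hd₁pos.le (by linarith) ?_
        (hQ0 _) hsmall₁)
    · filter_upwards [eventually_one_sub_div_mem (colNorm X₀.transpose)
        (colNorm_nonneg X₀.transpose)] with t ht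
      refine ⟨Set.mem_univ _, ?_, ?_⟩
      · have h1 := l12Norm_rescale_columns_le X₀.transpose (α := fun _ => 1)
          (β := fun b => 1 - t / colNorm X₀.transpose b) (by simp) (fun b => (ht b).1)
        rw [sum_colNorm_mul_one_sub, hk₁] at h1
        have h0 : (Matrix.of fun a b => (1 - t / colNorm X₀.transpose a) * X₀ a b * 1).transpose
            = Matrix.of fun a b => 1 * X₀.transpose a b * (1 - t / colNorm X₀.transpose b) := by
          ext a b
          simp [mul_comm]
        have h2 : l12Norm (Matrix.of fun a b => (1 - t / colNorm X₀.transpose a) * X₀ a b * 1)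
            ≤ l12Norm X₀ := hmono _ _ fun a b => by
          simp only [Matrix.of_apply, mul_one, mul_pow]
          exact mul_le_of_le_one_left (sq_nonneg _) (pow_le_one₀ (ht a).1 (ht a).2)
        have h3 := nuclearNorm_rescale_le X₀ (β := fun _ => 1)
          (α := fun b => 1 - t / colNorm X₀.transpose b)
          (fun b => abs_le.2 ⟨by linarith [(ht b).1], (ht b).2⟩) (by simp)
        rw [← h0] at h1
        have h4 := mul_le_mul_of_nonneg_left h1 hl₁
        have h5 := mul_le_mul_of_nonneg_left h3 hl₂
        linarith
      · ext a b
        simp [hE₁]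
        ring
    · have h1 : (d₁ : ℝ) * m₀ ≤ d₁ * (d₂ * k₁) := by gcongr
      have h2 : (d₁ : ℝ) * (d₂ * k₁) = k₁ * N := by rw [hN]; ring
      have h3 : 0 < k₁ * N := by positivity
      linarith
  · have hmax : Real.sqrt d₂ ≤ l₂ * Real.sqrt D₃ ∧ l₁ * Real.sqrt d₁ ≤ l₂ * Real.sqrt D₃ := by
      rw [not_and_or, not_le, not_le] at hcase hcase2
      rcases hcase with h1 | h1 <;> rcases hcase2 with h2 | h2 <;> constructor <;> linarith
    have hl₂pos : 0 < l₂ := by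
      rcases hl₂.eq_or_lt with h0 | h0
      · exfalso
        rw [← h0] at hmax
        linarith [hmax.1]
      · exact h0
    refine failsToRecover_of_path (E := E₂) (E' := 0) (L := L) (δ := l₂ * r)
      (Y := fun t => rankOneSum (fun i => σ i - t) u v)
      hs hL0 hC hsolve hlip ?_ (key l₂ r D₃ _ hl₂pos hrpos hD₃0 (by linarith) ?_
        (hQ0 _) hsmall₂)
    · filter_upwards [rankOneSum_sub_path hσ hu hv, rankOneSum_sub_path hσ hv hu] with t ht ht'
      refine ⟨Set.mem_univ _, ?_, ?_⟩
      · have h1 := ht.2.2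
        have h2 := ht'.2.2
        have h3 := ht.2.1
        rw [← hXeq] at h1
        rw [← transpose_rankOneSum _ u v, ← transpose_rankOneSum σ u v, ← hXeq] at h2
        rw [← hnuc, hcard, hr] at h3
        have h4 := mul_le_mul_of_nonneg_left h2 hl₁
        have h5 := mul_le_mul_of_nonneg_left h3 hl₂
        linarith
      · conv_lhs => rw [hXeq]
        ext a b
        simp [hE₂, rankOneSum, sub_mul, Finset.mul_sum, mul_assoc]
    -- The smaller side times the sum of the sides is at most twice the product; hence the factor
    -- `2` in `key`.
    · have h1 : D₃ * (d₁ + d₂) ≤ 2 * N := by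
        rw [hD₃, hN]
        rcases le_total (d₁ : ℝ) d₂ with h | h
        · rw [min_eq_left h]; nlinarith
        · rw [min_eq_right h]; nlinarith
      calc D₃ * m₀ ≤ D₃ * ((d₁ + d₂) * r) := by gcongr
        _ = D₃ * (d₁ + d₂) * r := by ring
        _ ≤ 2 * N * r := by gcongr
        _ = _ := by ring

theorem exists_const_measurements_psd {η : ℝ} (hη : 0 < η) :
    ∃ c₁ > (0 : ℝ), ∃ c₂ > (0 : ℝ), ∀ (m d : ℕ) (m₀ : ℝ)
      (E : Fin 3 → Matrix (Fin d) (Fin d) ℝ) (k : Fin 3 → ℝ),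
      (∀ j, ∑ p, ∑ q, E j p q ^ 2 ≤ k j) → m₀ ≤ (d * d : ℝ) → (m : ℝ) ≤ c₂ * m₀ →
      gaussianEnsemble m d d
        {A | ¬ ((∀ z : EuclideanSpace ℝ (Fin m), ‖z‖ ≤ d / 512 →
            ∃ P ∈ psdCone d, frobNorm P ≤ 1 ∧ ∀ i, measurements A P i = z i) ∧
          ∀ j, ∑ i, measurements A (E j) i ^ 2 ≤ k j * (η * m₀))}
        ≤ ENNReal.ofReal (Real.exp (-c₁ * m₀)) := by
  obtain ⟨c₁, hc₁, c₂, hc₂, h⟩ := exists_const_measurements (a := 1 / 256) (b := 1 / 131072)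
    (N₀ := 262144) (by norm_num) (by norm_num) hη (by norm_num)
  refine ⟨c₁, hc₁, c₂, hc₂, ?_⟩
  intro m d m₀ E k hE hm₀ hm
  have hprob := h m d d (psdBall d) m₀ E k (convex_psdBall d) (isCompact_psdBall d)
    (zero_mem_psdBall d) (fun P hP => hP.2) (by
      intro hd
      simp only [Fintype.card_prod, Fintype.card_fin, Nat.cast_mul] at hd ⊢
      rw [Real.sqrt_mul_self (Nat.cast_nonneg d)]
      exact stdGauss_not_exists_mem_psdBall hd) hE hm₀ hm
  refine (measure_mono ?_).trans hprob
  intro A hA hgood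
  refine hA ⟨fun z hz => ?_, hgood.2⟩
  obtain ⟨P, hP, hP'⟩ := hgood.1 z (hz.trans (le_of_eq (by
    rw [Real.sqrt_mul_self (Nat.cast_nonneg d)]; ring)))
  exact ⟨P, hP.1, hP'⟩

theorem psdCone_add_smul_mem {d : ℕ} : ∀ X ∈ psdCone d, ∀ P ∈ psdCone d, ∀ c : ℝ, 0 ≤ c →
    X + c • P ∈ psdCone d :=
  fun _ hX _ hP _ hc => Matrix.PosSemidef.add hX (Matrix.PosSemidef.smul hP hc)

/-- The matrix is the first-order term of the two-sided rescaling by `1 - t / colNorm X`. Use `(x +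
y)² ≤ 2x² + 2y²`, with symmetry to treat rows as columns. -/
theorem sum_mul_inv_colNorm_add_sq_le {d : ℕ} {X : Matrix (Fin d) (Fin d) ℝ} (hX : X.transpose = X) :
    ∑ a, ∑ b, (X a b * (1 / colNorm X a + 1 / colNorm X b)) ^ 2 ≤ 4 * (l02Count X : ℝ) := by
  have h1 := sum_div_colNorm_sq X
  have h2 : ∑ a, ∑ b, (X a b / colNorm X a) ^ 2 = (l02Count X : ℝ) := by
    rw [Finset.sum_comm, ← h1]
    refine Finset.sum_congr rfl fun a _ => Finset.sum_congr rfl fun b _ => ?_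
    conv_lhs => rw [← hX, Matrix.transpose_apply, hX]
  calc ∑ a, ∑ b, (X a b * (1 / colNorm X a + 1 / colNorm X b)) ^ 2
      ≤ ∑ a, ∑ b, (2 * (X a b / colNorm X a) ^ 2 + 2 * (X a b / colNorm X b) ^ 2) := by
        refine Finset.sum_le_sum fun a _ => Finset.sum_le_sum fun b _ => ?_
        have h := sq_nonneg (X a b / colNorm X a - X a b / colNorm X b)
        have h' : X a b * (1 / colNorm X a + 1 / colNorm X b)
          = X a b / colNorm X a + X a b / colNorm X b := by ring
        rw [h']
        linarith [add_sq (X a b / colNorm X a) (X a b / colNorm X b), sub_sq (X a b / colNorm X a) (X a b / colNorm X b)]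
    _ = 4 * (l02Count X : ℝ) := by
        simp only [Finset.sum_add_distrib, ← Finset.mul_sum, h1, h2]
        ring

/-- Shrinking columns alone leaves the cone, so for `l ≤ 1` the path is the congruence `D X₀ D`,
whose quadratic term supplies `E'`. For `l > 1` the eigenvalues are lowered. As `r ≤ k`, the
threshold `rd` suffices for both. -/
theorem failsToRecover_psd_l12 :
    ∃ c₁ > (0 : ℝ), ∃ c₂ > (0 : ℝ), ∀ (m d k r : ℕ) (X₀ : Matrix (Fin d) (Fin d) ℝ),
      X₀ ≠ 0 → X₀.PosSemidef → IsSL X₀ k k r → (m : ℝ) ≤ c₂ * ((r : ℝ) * d) →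
      HoldsExceptWithProb (gaussianEnsemble m d d) (Real.exp (-c₁ * ((r : ℝ) * d)))
        (fun A => ∀ l : ℝ, 0 ≤ l →
          FailsToRecover (fun X => l12Norm X + l * nuclearNorm X) (psdCone d) A X₀) := by
  obtain ⟨c₁, hc₁, c₂, hc₂, h⟩ := exists_const_measurements_psd (η := 1 / 4096 ^ 2) (by norm_num)
  refine ⟨c₁, hc₁, c₂, hc₂, ?_⟩
  intro m d k r X₀ hX₀ hpsd hSL hm
  have hsymm : X₀.transpose = X₀ := by
    rw [← Matrix.conjTranspose_eq_transpose_of_trivial]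
    exact hpsd.isHermitian
  have hk := hSL.l02Count_eq.1
  have hr := hSL.2
  obtain ⟨J, _, σ, v, hv, hσ, hXeq, hnuc, hcard⟩ := exists_spectral_decomposition hpsd
  have hkpos : (0 : ℝ) < k := by
    rw [← hk]; exact_mod_cast l02Count_pos hX₀
  have hrpos : (0 : ℝ) < r := by
    rw [← hr]; exact_mod_cast rank_pos hX₀
  have hkd : (k : ℝ) ≤ d := by
    rw [← hk]; exact_mod_cast l02Count_le X₀
  have hrk : (r : ℝ) ≤ k := by
    rw [← hk, ← hr]; exact_mod_cast rank_le_l02Count X₀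
  have hdpos : (0 : ℝ) < d := hkpos.trans_le hkd
  obtain ⟨E₀, hE₀⟩ : ∃ E : Matrix (Fin d) (Fin d) ℝ,
      E = Matrix.of fun a b => X₀ a b * (1 / colNorm X₀ a + 1 / colNorm X₀ b) := ⟨_, rfl⟩
  obtain ⟨E₁, hE₁⟩ : ∃ E : Matrix (Fin d) (Fin d) ℝ, E = rankOneSum (fun _ => 1) v v := ⟨_, rfl⟩
  have hprob := h m d (r * d) ![E₀, E₁, 0] ![4 * k, r, 0] (by
    intro j
    fin_cases j
    · change ∑ p, ∑ q, E₀ p q ^ 2 ≤ 4 * (k : ℝ)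
      rw [hE₀, ← hk]
      exact sum_mul_inv_colNorm_add_sq_le hsymm
    · change ∑ p, ∑ q, E₁ p q ^ 2 ≤ (r : ℝ)
      rw [hE₁, sum_sq_rankOneSum _ hv hv]
      simp [hcard, hr]
    · change ∑ p : Fin d, ∑ q : Fin d, (0 : ℝ) ^ 2 ≤ (0 : ℝ)
      simp) (mul_le_mul_of_nonneg_right (hrk.trans hkd) hdpos.le) hm
  refine (measure_mono ?_).trans hprob
  intro A hA hgood
  apply hA
  obtain ⟨hsolve, hsmall⟩ := hgood
  have hsmall₀ : ∑ i, measurements A E₀ i ^ 2 ≤ 4 * k * (1 / 4096 ^ 2 * (r * d)) := hsmall 0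
  have hsmall₁ : ∑ i, measurements A E₁ i ^ 2 ≤ r * (1 / 4096 ^ 2 * (r * d)) := hsmall 1
  clear hsmall hprob h hA
  intro l hl
  set s : ℝ := Real.sqrt d with hs
  have hspos : 0 < s := Real.sqrt_pos.2 hdpos
  have hss : s * s = d := Real.mul_self_sqrt hdpos.le
  have hL : 0 ≤ s + l * s := by positivity
  have hlip : ∀ X P : Matrix (Fin d) (Fin d) ℝ,
      l12Norm (X + P) + l * nuclearNorm (X + P)
      ≤ l12Norm X + l * nuclearNorm X + (s + l * s) * frobNorm P := by
    intro X P
    have h1 := l12Norm_add_le X P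
    have h3 := mul_le_mul_of_nonneg_left (nuclearNorm_add_le X P) hl
    rw [min_self] at h3
    linarith
  have hsq : ∀ (Q K : ℝ), 0 ≤ K → Q ≤ (K * s / 4096) ^ 2 → Real.sqrt Q ≤ K * s / 4096 :=
    fun Q K hK hQ => Real.sqrt_le_iff.2 ⟨by positivity, hQ⟩
  rcases le_or_gt l 1 with hl1 | hl1
  · refine failsToRecover_of_path (E := E₀)
      (E' := Matrix.of fun a b => X₀ a b / (colNorm X₀ a * colNorm X₀ b)) (δ := k)
      (Y := fun t => Matrix.of fun a b =>
        (1 - t / colNorm X₀ a) * X₀ a b * (1 - t / colNorm X₀ b))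
      (by positivity) hL psdCone_add_smul_mem hsolve hlip ?_ ?_
    · filter_upwards [eventually_one_sub_div_mem (colNorm X₀) (colNorm_nonneg X₀)] with t ht
      have hβ : ∀ b, |1 - t / colNorm X₀ b| ≤ 1 := fun b =>
        abs_le.2 ⟨by linarith [(ht b).1], (ht b).2⟩
      refine ⟨Matrix.PosSemidef.rescale hpsd _, ?_, ?_⟩
      · have h1 := l12Norm_rescale_columns_le X₀ hβ (fun b => (ht b).1)
        rw [sum_colNorm_mul_one_sub, hk] at h1
        have h5 := mul_le_mul_of_nonneg_left (nuclearNorm_rescale_le X₀ hβ hβ) hl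
        linarith
      · ext a b
        simp [hE₀]
        ring
    -- The inequality `r ≤ k` replaces `kr` by `k²`, which makes the bound a square.
    · have h1 := hsq (∑ i, measurements A E₀ i ^ 2) (2 * k) (by positivity) (by
        refine hsmall₀.trans ?_
        have h2 : (2 * k * s / 4096) ^ 2 = 4 * k * (1 / 4096 ^ 2 * (k * d)) := by
          rw [← hss]; ring
        rw [h2]
        gcongr)
      calc (s + l * s) * Real.sqrt (∑ i, measurements A E₀ i ^ 2)
          ≤ (s + 1 * s) * (2 * k * s / 4096) := by gcongr
        _ = k * (s * s) / 1024 := by ring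
        _ < k * (d / 512) := by
          rw [hss]
          have := mul_pos hkpos hdpos
          linarith
  · refine failsToRecover_of_path (E := E₁) (E' := 0) (δ := l * r)
      (Y := fun t => rankOneSum (fun i => σ i - t) v v)
      (by positivity) hL psdCone_add_smul_mem hsolve hlip ?_ ?_
    · filter_upwards [rankOneSum_sub_path hσ hv hv] with t ht
      refine ⟨posSemidef_rankOneSum ht.1 v, ?_, ?_⟩
      · have h1 := ht.2.2
        have h3 := ht.2.1
        rw [← hXeq] at h1
        rw [← hnuc, hcard, hr] at h3
        have h5 := mul_le_mul_of_nonneg_left h3 hl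
        linarith
      · conv_lhs => rw [hXeq]
        ext a b
        simp [hE₁, rankOneSum, sub_mul, Finset.mul_sum, mul_assoc]
    · have h1 := hsq (∑ i, measurements A E₁ i ^ 2) r (by positivity) (by
        refine hsmall₁.trans (le_of_eq ?_)
        rw [← hss]; ring)
      calc (s + l * s) * Real.sqrt (∑ i, measurements A E₁ i ^ 2)
          ≤ (l * s + l * s) * (r * s / 4096) := by
            gcongr
            exact le_mul_of_one_le_left hspos.le hl1.le
        _ = l * r * (s * s) / 2048 := by ring
        _ < l * r * (d / 512) := by
          rw [hss]
          have : 0 < l * r * d := by positivity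
          linarith

/-- Scaling `X₀` towards `0` lowers both norms, at the total rate `a + ln` for the norms `a`, `n` of
the normalized matrix. The two bounds in `m₀` control the two Lipschitz terms separately: `‖A(E)‖ ≤
a/1024` is used against `d`, and `‖A(E)‖ ≤ n√d/1024` against `l√d`, so no case distinction on `l`
arises. -/
theorem failsToRecover_psd_l1 :
    ∃ c₁ > (0 : ℝ), ∃ c₂ > (0 : ℝ), ∀ (m d k r : ℕ) (X₀ : Matrix (Fin d) (Fin d) ℝ),
      X₀ ≠ 0 → X₀.PosSemidef → IsSL X₀ k k r →
      ∀ m₀ : ℝ, m₀ = min (l1Norm (normalized X₀) ^ 2) (nuclearNorm (normalized X₀) ^ 2 * d) →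
      (m : ℝ) ≤ c₂ * m₀ →
      HoldsExceptWithProb (gaussianEnsemble m d d) (Real.exp (-c₁ * m₀))
        (fun A => ∀ l : ℝ, 0 ≤ l →
          FailsToRecover (fun X => l1Norm X + l * nuclearNorm X) (psdCone d) A X₀) := by
  obtain ⟨c₁, hc₁, c₂, hc₂, h⟩ := exists_const_measurements_psd (η := 1 / 1024 ^ 2) (by norm_num)
  refine ⟨c₁, hc₁, c₂, hc₂, ?_⟩
  intro m d k r X₀ hX₀ hpsd hSL m₀ hm₀ hm
  have hd : (0 : ℝ) < d := by
    have := (l02Count_pos hX₀).trans_le (l02Count_le X₀)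
    exact_mod_cast this
  have hsumpos : 0 < ∑ i, ∑ j, X₀ i j ^ 2 := by
    refine lt_of_le_of_ne (Finset.sum_nonneg fun _ _ => Finset.sum_nonneg fun _ _ => sq_nonneg _) ?_
    intro h0
    refine hX₀ (Matrix.ext fun a b => ?_)
    have h1 := (Finset.sum_eq_zero_iff_of_nonneg fun a _ =>
      Finset.sum_nonneg fun b _ => sq_nonneg (X₀ a b)).1 h0.symm a (Finset.mem_univ _)
    have h2 := (Finset.sum_eq_zero_iff_of_nonneg fun b _ => sq_nonneg (X₀ a b)).1 h1 b
      (Finset.mem_univ _)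
    exact pow_eq_zero_iff two_ne_zero |>.1 h2
  obtain ⟨F, hF⟩ : ∃ F, F = frobNorm X₀ := ⟨_, rfl⟩
  have hFpos : 0 < F := hF ▸ Real.sqrt_pos.2 hsumpos
  have hF2 : F ^ 2 = ∑ i, ∑ j, X₀ i j ^ 2 := by rw [hF, frobNorm_sq]
  obtain ⟨E, hE⟩ : ∃ E, E = normalized X₀ := ⟨_, rfl⟩
  have hEX : E = F⁻¹ • X₀ := by rw [hE, hF]; rfl
  have hEsum : ∑ p, ∑ q, E p q ^ 2 = 1 := by
    simp only [hEX, Matrix.smul_apply, smul_eq_mul, mul_pow, ← Finset.mul_sum, ← hF2]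
    field_simp
  rw [← hE] at hm₀
  set a := l1Norm E with ha
  set n := nuclearNorm E with hn
  have ha' : a = F⁻¹ * l1Norm X₀ := by rw [ha, hEX, l1Norm_smul _ (inv_nonneg.2 hFpos.le)]
  have hn' : n ≤ F⁻¹ * nuclearNorm X₀ := by
    rw [hn, hEX]; exact nuclearNorm_smul_le _ (inv_nonneg.2 hFpos.le)
  have hn0 : 0 ≤ n := nuclearNorm_nonneg E
  have hapos : 0 < a := by
    rw [ha']
    refine mul_pos (inv_pos.2 hFpos) ?_
    refine lt_of_le_of_ne (Finset.sum_nonneg fun _ _ => Finset.sum_nonneg fun _ _ => abs_nonneg _) ?_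
    intro h0
    refine hX₀ (Matrix.ext fun a b => ?_)
    have h1 := (Finset.sum_eq_zero_iff_of_nonneg fun a _ =>
      Finset.sum_nonneg fun b _ => abs_nonneg (X₀ a b)).1 h0.symm a (Finset.mem_univ _)
    have h2 := (Finset.sum_eq_zero_iff_of_nonneg fun b _ => abs_nonneg (X₀ a b)).1 h1 b
      (Finset.mem_univ _)
    exact abs_eq_zero.1 h2
  have hm₀a : m₀ ≤ a ^ 2 := hm₀ ▸ min_le_left _ _
  have hm₀n : m₀ ≤ n ^ 2 * d := hm₀ ▸ min_le_right _ _
  have hm₀d : m₀ ≤ d * d := by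
    refine hm₀a.trans ((l1Norm_sq_le E).trans (le_of_eq ?_))
    rw [frobNorm_sq, hEsum, mul_one]
  have hprob := h m d m₀ (fun _ => E) (fun _ => 1) (fun _ => hEsum.le) hm₀d hm
  refine (measure_mono ?_).trans hprob
  intro A hA hgood
  apply hA
  obtain ⟨hsolve, hsmall⟩ := hgood
  have hsmall₀ : ∑ i, measurements A E i ^ 2 ≤ 1 * (1 / 1024 ^ 2 * m₀) := hsmall 0
  clear hsmall hprob h hA
  intro l hl
  set s : ℝ := Real.sqrt d with hs
  have hspos : 0 < s := Real.sqrt_pos.2 hd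
  have hss : s * s = d := Real.mul_self_sqrt hd.le
  have hlip : ∀ X P : Matrix (Fin d) (Fin d) ℝ,
      l1Norm (X + P) + l * nuclearNorm (X + P)
      ≤ l1Norm X + l * nuclearNorm X + (d + l * s) * frobNorm P := by
    intro X P
    have h1 := l1Norm_add_le X P
    have h3 := mul_le_mul_of_nonneg_left (nuclearNorm_add_le X P) hl
    rw [min_self] at h3
    rw [Real.sqrt_mul_self hd.le] at h1
    linarith
  refine failsToRecover_of_path (E := E) (E' := 0) (δ := a + l * n)
    (Y := fun t => (1 - t * F⁻¹) • X₀)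
    (by positivity) (by positivity) psdCone_add_smul_mem hsolve hlip ?_ ?_
  · filter_upwards [Ioo_mem_nhdsGT hFpos] with t ht
    have ht1 : 0 ≤ 1 - t * F⁻¹ := by
      rw [← div_eq_mul_inv, sub_nonneg, div_le_one hFpos]
      exact ht.2.le
    refine ⟨Matrix.PosSemidef.smul hpsd ht1, ?_, ?_⟩
    · rw [l1Norm_smul _ ht1, ha']
      have h1 := mul_le_mul_of_nonneg_left (nuclearNorm_smul_le X₀ ht1) hl
      have h2 := mul_le_mul_of_nonneg_left hn' (mul_nonneg ht.1.le hl)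
      linarith
    · ext a b
      simp [hEX]
      ring
  · have hq1 : Real.sqrt (∑ i, measurements A E i ^ 2) ≤ a / 1024 := by
      refine Real.sqrt_le_iff.2 ⟨by positivity, ?_⟩
      rw [div_pow]
      linarith
    have hq2 : s * Real.sqrt (∑ i, measurements A E i ^ 2) ≤ n * d / 1024 := by
      have : Real.sqrt (∑ i, measurements A E i ^ 2) ≤ n * s / 1024 := by
        refine Real.sqrt_le_iff.2 ⟨by positivity, ?_⟩
        rw [div_pow, mul_pow, pow_two s, hss]
        linarith
      calc _ ≤ s * (n * s / 1024) := by gcongr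
        _ = n * (s * s) / 1024 := by ring
        _ = _ := by rw [hss]
    have hq3 := mul_le_mul_of_nonneg_left hq1 hd.le
    have hq4 := mul_le_mul_of_nonneg_left hq2 hl
    have h5 : 0 < a * d := mul_pos hapos hd
    have h6 : 0 ≤ l * (n * d) := by positivity
    nlinarith

/-! ### Generic kernels avoid families with few parameters -/

section NullSets

theorem pi_mono_of_sigmaFinite {ι : Type*} [Fintype ι] {α : ι → Type*} [∀ i, MeasurableSpace (α i)]
    {μ ν : ∀ i, Measure (α i)} [∀ i, SigmaFinite (μ i)] [∀ i, SigmaFinite (ν i)]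
    (h : ∀ i, μ i ≤ ν i) : Measure.pi μ ≤ Measure.pi ν := by
  have h1 : (Measure.pi μ).toOuterMeasure ≤ OuterMeasure.pi fun i => (ν i).toOuterMeasure := by
    rw [OuterMeasure.le_pi]
    intro s _
    refine (Measure.pi_pi μ s).le.trans ?_
    exact Finset.prod_le_prod' fun i _ => h i (s i)
  refine Measure.le_iff.2 fun s hs => ?_
  rw [Measure.pi, Measure.pi, toMeasure_apply _ _ hs, toMeasure_apply _ _ hs]
  refine le_trans (le_of_eq ?_) (h1 s)
  change _ = Measure.pi μ s
  rw [Measure.pi, toMeasure_apply _ _ hs]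

/-- The density is at most `(2π)^{-1/2} ≤ 1`. Domination by Lebesgue measure passes to finite
products, so Lebesgue null sets are null for the ensemble. -/
theorem gaussianReal_le_volume : gaussianReal 0 1 ≤ (volume : Measure ℝ) := by
  rw [gaussianReal_of_var_ne_zero _ one_ne_zero]
  conv_rhs => rw [← withDensity_one (μ := (volume : Measure ℝ))]
  refine withDensity_mono (Eventually.of_forall fun x => ?_)
  rw [gaussianPDF, Pi.one_apply, ← ENNReal.ofReal_one]
  refine ENNReal.ofReal_le_ofReal ?_
  rw [gaussianPDFReal]
  refine mul_le_one₀ (inv_le_one_of_one_le₀ ?_) (Real.exp_nonneg _) ?_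
  · rw [Real.one_le_sqrt]
    have := Real.pi_gt_three
    simp
    linarith
  · rw [Real.exp_le_one_iff]
    have := sq_nonneg (x - 0)
    simp only [NNReal.coe_one]
    linarith [div_nonneg this (by norm_num : (0 : ℝ) ≤ 2 * 1), neg_div (2 * 1 : ℝ) ((x - 0) ^ 2)]

theorem gaussianEnsemble_le_volume (m d₁ d₂ : ℕ) : gaussianEnsemble m d₁ d₂ ≤ volume :=
  pi_mono_of_sigmaFinite fun _ => pi_mono_of_sigmaFinite fun _ => gaussianReal_le_volume

/-- The image of a smooth map from a space of smaller dimension is a null set. -/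
theorem volume_image_eq_zero_of_finrank_lt {E F : Type*} [NormedAddCommGroup E] [NormedSpace ℝ E]
    [FiniteDimensional ℝ E] [NormedAddCommGroup F] [NormedSpace ℝ F] [FiniteDimensional ℝ F]
    [MeasurableSpace F] [BorelSpace F] (μ : Measure F) [μ.IsAddHaarMeasure] {f : E → F} {s : Set E}
    (hf : ∀ x ∈ s, ContDiffAt ℝ 1 f x) (hdim : Module.finrank ℝ E < Module.finrank ℝ F) :
    μ (f '' s) = 0 := by
  -- A locally Lipschitz map does not raise Hausdorff dimension, and a set of Hausdorff dimension
  -- below that of the space is null.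
  have h1 : dimH (f '' s) ≤ dimH s := dimH_image_le_of_locally_lipschitzOn fun x hx => by
    obtain ⟨C, t, ht, hC⟩ := (hf x hx).exists_lipschitzOnWith
    exact ⟨C, t, mem_nhdsWithin_of_mem_nhds ht, hC⟩
  have h2 : dimH (f '' s) < ((Module.finrank ℝ F : NNReal) : ℝ≥0∞) := by
    refine h1.trans_lt ((dimH_mono (Set.subset_univ s)).trans_lt ?_)
    rw [Real.dimH_univ_eq_finrank]
    exact_mod_cast hdim
  have h3 := hausdorffMeasure_of_dimH_lt h2
  exact Measure.absolutelyContinuous_isAddHaarMeasure μ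
    (Measure.hausdorffMeasure (Module.finrank ℝ F : ℝ)) (by simpa using h3)

variable {ι κ : Type*} [Fintype ι] [Fintype κ]

/-- A generic linear map to a space of dimension larger than the number of parameters has no
nonzero point of a parametrized family in its kernel. -/
theorem volume_exists_parametrized_kernel_eq_zero {m : ℕ} {φ : (κ → ℝ) → ι → ℝ}
    (hφ : ContDiff ℝ 1 φ) (hm : Fintype.card κ < m) :
    volume {A : Fin m → ι → ℝ | ∃ p, φ p ≠ 0 ∧ ∀ i, ∑ l, A i l * φ p l = 0} = 0 := by
  classical
  -- At a coordinate `j` with `φ p j ≠ 0`, each of the `m` equations is solved for its entry in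
  -- column `j`. So `A` is a smooth function of `p` and of the `m(|ι| - 1)` other entries, fewer
  -- than `m|ι|` parameters in total.
  have hsub : {A : Fin m → ι → ℝ | ∃ p, φ p ≠ 0 ∧ ∀ i, ∑ l, A i l * φ p l = 0} ⊆
      ⋃ j : ι, (fun q : (κ → ℝ) × (Fin m → {l // l ≠ j} → ℝ) => fun i l =>
        if h : l = j then -(∑ l', q.2 i l' * φ q.1 l') / φ q.1 j else q.2 i ⟨l, h⟩) ''
        {q | φ q.1 j ≠ 0} := by
    rintro A ⟨p, hp, hA⟩
    obtain ⟨j, hj⟩ := Function.ne_iff.1 hp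
    refine Set.mem_iUnion.2 ⟨j, ⟨p, fun i l => A i l⟩, hj, ?_⟩
    funext i l
    dsimp only
    split_ifs with h
    · subst h
      rw [div_eq_iff hj]
      have h1 := hA i
      rw [← Finset.add_sum_erase _ _ (Finset.mem_univ l)] at h1
      have h2 : ∑ l' : {l' // l' ≠ l}, A i l' * φ p l'
          = ∑ l' ∈ Finset.univ.erase l, A i l' * φ p l' :=
        (Finset.sum_subtype (Finset.univ.erase l) (by simp) fun l' => A i l' * φ p l').symm
      rw [h2]
      linarith
    · rfl
  refine measure_mono_null hsub (measure_iUnion_null fun j => ?_)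
  refine volume_image_eq_zero_of_finrank_lt volume ?_ ?_
  · rintro ⟨p, B⟩ hp
    have hφ' : ∀ l, ContDiff ℝ 1 fun q : (κ → ℝ) × (Fin m → {l // l ≠ j} → ℝ) => φ q.1 l := fun l =>
      (contDiff_pi.1 hφ l).comp contDiff_fst
    have hB : ∀ i l, ContDiff ℝ 1 fun q : (κ → ℝ) × (Fin m → {l // l ≠ j} → ℝ) => q.2 i l :=
      fun i l => contDiff_pi.1 (contDiff_pi.1 contDiff_snd i) l
    refine contDiffAt_pi.2 fun i => contDiffAt_pi.2 fun l => ?_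
    by_cases h : l = j
    · simp only [h, dif_pos]
      refine ContDiffAt.div (ContDiffAt.neg (ContDiffAt.sum fun l' _ => ?_)) (hφ' j).contDiffAt hp
      exact ((hB i l').mul (hφ' l')).contDiffAt
    · simp only [h, dif_neg, not_false_eq_true]
      exact (hB i _).contDiffAt
  · have h1 : Fintype.card {l // l ≠ j} + 1 = Fintype.card ι := by
      have := Fintype.card_pos_iff.2 ⟨j⟩
      simp
      omega
    simp only [Module.finrank_prod, Module.finrank_pi_fintype,
      Finset.sum_const, Finset.card_univ, Fintype.card_fin, smul_eq_mul, Module.finrank_self,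
      mul_one, ← h1]
    rw [mul_add]
    omega

end NullSets

/-- Almost surely the kernel of the measurement operator contains no nonzero matrix with too few
degrees of freedom. -/
theorem gaussianEnsemble_exists_kernel_eq_zero (m d₁ d₂ : ℕ) :
    gaussianEnsemble m d₁ d₂ {A | ∃ Z : Matrix (Fin d₁) (Fin d₂) ℝ, Z ≠ 0 ∧
      measurements A Z = 0 ∧ Z.rank * (l02Count Z.transpose + l02Count Z) < m} = 0 := by
  classical
  refine le_antisymm ((gaussianEnsemble_le_volume m d₁ d₂ _).trans (le_of_eq ?_)) zero_le
  -- Products `UVᵀ` with `R` columns in each factor, the rows of `U` and `V` supported on `I` and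
  -- `J`: `R(|I| + |J|)` parameters, and only countably many triples `(I, J, R)`.
  let φ : ∀ (I : Finset (Fin d₁)) (J : Finset (Fin d₂)) (R : ℕ),
      (Fin R × I ⊕ Fin R × J → ℝ) → Fin d₂ × Fin d₁ → ℝ := fun I J R p q =>
    ∑ s, (if h : q.2 ∈ I then p (Sum.inl (s, ⟨q.2, h⟩)) else 0) *
      (if h : q.1 ∈ J then p (Sum.inr (s, ⟨q.1, h⟩)) else 0)
  have hφ : ∀ I J R, ContDiff ℝ 1 (φ I J R) := fun I J R => by
    refine contDiff_pi.2 fun q => ContDiff.sum fun s _ => ContDiff.mul ?_ ?_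
    · split_ifs
      · exact contDiff_apply ℝ ℝ _
      · exact contDiff_const
    · split_ifs
      · exact contDiff_apply ℝ ℝ _
      · exact contDiff_const
  have hsub : {A : Fin m → Fin d₂ × Fin d₁ → ℝ | ∃ Z : Matrix (Fin d₁) (Fin d₂) ℝ, Z ≠ 0 ∧
      measurements A Z = 0 ∧ Z.rank * (l02Count Z.transpose + l02Count Z) < m} ⊆
      ⋃ I : Finset (Fin d₁), ⋃ J : Finset (Fin d₂), ⋃ R : ℕ, ⋃ _ : R * (I.card + J.card) < m,
        {A | ∃ p, φ I J R p ≠ 0 ∧ ∀ i, ∑ l, A i l * φ I J R p l = 0} := by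
    rintro A ⟨Z, hZ, hAZ, hdim⟩
    obtain ⟨T, _, σ, u, v, -, -, -, hZeq, -, hcard⟩ := exists_singular_value_decomposition Z
    let e : Fin Z.rank ≃ T := (finCongr hcard.symm).trans (Fintype.equivFin T).symm
    let I : Finset (Fin d₁) := Finset.univ.filter fun a => ∃ b, Z a b ≠ 0
    let J : Finset (Fin d₂) := Finset.univ.filter fun b => ∃ a, Z a b ≠ 0
    have hI : I.card = l02Count Z.transpose := by
      rw [l02Count, Set.ncard_eq_toFinset_card']
      congr 1
      ext a
      rw [Set.mem_toFinset]
      simp [I]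
    have hJ : J.card = l02Count Z := by
      rw [l02Count, Set.ncard_eq_toFinset_card']
      congr 1
      ext b
      rw [Set.mem_toFinset]
      simp [J]
    obtain ⟨p, hp⟩ : ∃ p, φ I J Z.rank p = Z.vec := by
      refine ⟨Sum.elim (fun x => σ (e x.1) * u (e x.1) x.2) fun x => v (e x.1) x.2, ?_⟩
      funext ⟨b, a⟩
      change _ = Z a b
      simp only [φ, Sum.elim_inl, Sum.elim_inr]
      by_cases ha : a ∈ I
      · by_cases hb : b ∈ J
        · simp only [ha, hb, dif_pos]
          conv_rhs => rw [hZeq]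
          exact e.sum_comp fun t => σ t * u t a * v t b
        · have : Z a b = 0 := by
            by_contra h0
            exact hb (by simpa [J] using ⟨a, h0⟩)
          simp [hb, this]
      · have : Z a b = 0 := by
          by_contra h0
          exact ha (by simpa [I] using ⟨b, h0⟩)
        simp [ha, this]
    refine Set.mem_iUnion.2 ⟨I, Set.mem_iUnion.2 ⟨J, Set.mem_iUnion.2 ⟨Z.rank,
      Set.mem_iUnion.2 ⟨by rwa [hI, hJ], p, ?_, ?_⟩⟩⟩⟩
    · rw [hp]
      intro h0
      refine hZ (Matrix.ext fun a b => ?_)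
      exact congrFun h0 (b, a)
    · intro i
      rw [hp]
      exact congrFun hAZ i
  refine measure_mono_null hsub ?_
  refine measure_iUnion_null fun I => measure_iUnion_null fun J => measure_iUnion_null fun R =>
    measure_iUnion_null fun h => ?_
  refine volume_exists_parametrized_kernel_eq_zero (hφ I J R) ?_
  simpa [mul_add] using h

/-! ### Rank and support counts -/

section Counts

variable {d₁ d₂ : ℕ}

theorem l02Count_sub_le (X Y : Matrix (Fin d₁) (Fin d₂) ℝ) :
    l02Count (X - Y) ≤ l02Count X + l02Count Y := by
  refine (Set.ncard_le_ncard (t := {j | ∃ i, X i j ≠ 0} ∪ {j | ∃ i, Y i j ≠ 0}) ?_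
    (Set.toFinite _)).trans (Set.ncard_union_le _ _)
  rintro j ⟨i, hi⟩
  by_cases h : X i j = 0
  · exact Or.inr ⟨i, fun h' => hi (by simp [h, h'])⟩
  · exact Or.inl ⟨i, h⟩

theorem rank_sub_le (X Y : Matrix (Fin d₁) (Fin d₂) ℝ) : (X - Y).rank ≤ X.rank + Y.rank := by
  refine le_trans (Submodule.finrank_mono ?_) (Submodule.finrank_add_le_finrank_add_finrank _ _)
  rintro _ ⟨z, rfl⟩
  rw [Matrix.mulVecLin_apply, Matrix.sub_mulVec]
  exact Submodule.sub_mem_sup ⟨z, rfl⟩ ⟨z, rfl⟩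

theorem l0Count_le (X : Matrix (Fin d₁) (Fin d₂) ℝ) :
    l0Count X ≤ l02Count X.transpose * l02Count X := by
  rw [l02Count, l02Count, ← Set.ncard_prod]
  refine Set.ncard_le_ncard ?_ (Set.toFinite _)
  rintro ⟨a, b⟩ h
  exact ⟨⟨b, h⟩, ⟨a, h⟩⟩

/-- For `X = σ u vᵀ` the support is the full rectangle of nonzero rows and nonzero columns. -/
theorem le_l0Count_of_rank_eq_one {X : Matrix (Fin d₁) (Fin d₂) ℝ} (hX : X.rank = 1) :
    l02Count X.transpose * l02Count X ≤ l0Count X := by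
  obtain ⟨T, _, σ, u, v, -, -, -, hXeq, -, hcard⟩ := exists_singular_value_decomposition X
  rw [hX, Fintype.card_eq_one_iff] at hcard
  obtain ⟨t, ht⟩ := hcard
  have huniv : (Finset.univ : Finset T) = {t} := by
    ext s
    simp [ht s]
  have hab : ∀ a b, X a b = σ t * u t a * v t b := fun a b => by
    conv_lhs => rw [hXeq]
    simp [rankOneSum, huniv]
  rw [l02Count, l02Count, ← Set.ncard_prod]
  refine Set.ncard_le_ncard ?_ (Set.toFinite _)
  rintro ⟨a, b⟩ ⟨⟨b', hb'⟩, ⟨a', ha'⟩⟩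
  change X a b' ≠ 0 at hb'
  change X a' b ≠ 0 at ha'
  change X a b ≠ 0
  rw [hab] at hb' ha' ⊢
  exact mul_ne_zero (left_ne_zero_of_mul hb') (right_ne_zero_of_mul ha')

theorem eq_zero_of_l0Count_eq_zero {X : Matrix (Fin d₁) (Fin d₂) ℝ} (h : l0Count X = 0) :
    X = 0 := by
  rw [l0Count, Set.ncard_eq_zero (Set.toFinite _)] at h
  refine Matrix.ext fun a b => ?_
  by_contra h0
  have : (a, b) ∈ {p : Fin d₁ × Fin d₂ | X p.1 p.2 ≠ 0} := h0
  rw [h] at this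
  exact this

end Counts

/-! ### Recovery by the nonconvex programs -/

section Recovery

/-- Recovery follows almost surely once every competitor differs from `X₀` by a matrix with few
degrees of freedom. -/
theorem holdsExceptWithProb_uniquelyRecovers {m d₁ d₂ : ℕ} {f : Matrix (Fin d₁) (Fin d₂) ℝ → ℝ}
    {C : Set (Matrix (Fin d₁) (Fin d₂) ℝ)} {X₀ : Matrix (Fin d₁) (Fin d₂) ℝ} (hX₀ : X₀ ∈ C)
    (h : ∀ X ∈ C, f X ≤ f X₀ →
      (X - X₀).rank * (l02Count (X - X₀).transpose + l02Count (X - X₀)) < m) (δ : ℝ) :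
    HoldsExceptWithProb (gaussianEnsemble m d₁ d₂) δ (fun A => UniquelyRecovers f C A X₀) := by
  refine (measure_mono ?_).trans
    ((gaussianEnsemble_exists_kernel_eq_zero m d₁ d₂).le.trans zero_le)
  intro A hA
  by_contra hker
  refine hA ⟨⟨hX₀, rfl⟩, fun X hX hne => ?_⟩
  by_contra! hle
  refine hker ⟨X - X₀, sub_ne_zero.2 hne, ?_, h X hX.1 hle⟩
  rw [measurements_sub, hX.2, sub_self]

theorem natCast_le_mul_of_div_le {n k : ℕ} {c : ℕ} (hk : (0 : ℝ) < k)
    (h : 1 / (k : ℝ) * n ≤ c) : n ≤ c * k := by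
  rw [one_div_mul_eq_div, div_le_iff₀ hk] at h
  exact_mod_cast h

/-- Since `f X₀ = 3`, each term of a competitor is at most `3`, so its counts are at most three
times those of `X₀`, and those of the difference at most four times. This gives `4r(4k₁ + 4k₂) =
16(k₁ + k₂)r` parameters, below `17(k₁ + k₂)r ≤ m`. -/
theorem uniquelyRecovers_general :
    ∃ c₁ > (0 : ℝ), ∃ c₂ > (0 : ℝ), ∀ (m d₁ d₂ k₁ k₂ r : ℕ) (X₀ : Matrix (Fin d₁) (Fin d₂) ℝ),
      X₀ ≠ 0 → IsSL X₀ k₁ k₂ r →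
      c₂ * max (((k₁ : ℝ) + k₂) * r)
        (max ((k₁ : ℝ) * Real.log (d₁ / k₁)) ((k₂ : ℝ) * Real.log (d₂ / k₂))) ≤ m →
      HoldsExceptWithProb (gaussianEnsemble m d₁ d₂) (Real.exp (-c₁ * m))
        (fun A => UniquelyRecovers
          (fun X => 1 / (k₂ : ℝ) * l02Count X + 1 / (k₁ : ℝ) * l02Count X.transpose
            + 1 / (r : ℝ) * X.rank) Set.univ A X₀) := by
  refine ⟨1, one_pos, 17, by norm_num, ?_⟩
  intro m d₁ d₂ k₁ k₂ r X₀ hX₀ hSL hm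
  obtain ⟨hk₂, hk₁⟩ := hSL.l02Count_eq
  have hr := hSL.2
  have hX₀t : X₀.transpose ≠ 0 := fun h0 => hX₀ (by simpa using congrArg Matrix.transpose h0)
  have hk₂n : 0 < k₂ := hk₂ ▸ l02Count_pos hX₀
  have hk₁n : 0 < k₁ := hk₁ ▸ l02Count_pos hX₀t
  have hrn : 0 < r := hr ▸ rank_pos hX₀
  have hk₂pos : (0 : ℝ) < k₂ := by exact_mod_cast hk₂n
  have hk₁pos : (0 : ℝ) < k₁ := by exact_mod_cast hk₁n
  have hrpos : (0 : ℝ) < r := by exact_mod_cast hrn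
  have hm' : 17 * ((k₁ + k₂) * r) ≤ m := by
    have := (mul_le_mul_of_nonneg_left (le_max_left (((k₁ : ℝ) + k₂) * r) _)
      (by norm_num : (0 : ℝ) ≤ 17)).trans hm
    exact_mod_cast this
  refine holdsExceptWithProb_uniquelyRecovers (Set.mem_univ _) (fun X _ hX => ?_) _
  simp only [hk₂, hk₁, hr, one_div_mul_cancel hk₂pos.ne', one_div_mul_cancel hk₁pos.ne',
    one_div_mul_cancel hrpos.ne'] at hX
  have e₁ : 0 ≤ 1 / (k₂ : ℝ) * l02Count X := by positivity
  have e₂ : 0 ≤ 1 / (k₁ : ℝ) * l02Count X.transpose := by positivity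
  have e₃ : 0 ≤ 1 / (r : ℝ) * X.rank := by positivity
  have h₁ : l02Count X ≤ 3 * k₂ := natCast_le_mul_of_div_le hk₂pos (by push_cast; linarith)
  have h₂ : l02Count X.transpose ≤ 3 * k₁ :=
    natCast_le_mul_of_div_le hk₁pos (by push_cast; linarith)
  have h₃ : X.rank ≤ 3 * r := natCast_le_mul_of_div_le hrpos (by push_cast; linarith)
  have g₁ := l02Count_sub_le X X₀
  have g₂ := l02Count_sub_le X.transpose X₀.transpose
  have g₃ := rank_sub_le X X₀
  rw [← Matrix.transpose_sub] at g₂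
  calc (X - X₀).rank * (l02Count (X - X₀).transpose + l02Count (X - X₀))
      ≤ (4 * r) * (4 * k₁ + 4 * k₂) := Nat.mul_le_mul (by omega) (by omega)
    _ = 16 * ((k₁ + k₂) * r) := by ring
    _ < 17 * ((k₁ + k₂) * r) := by
        have : 0 < (k₁ + k₂) * r := by positivity
        omega
    _ ≤ m := hm'

theorem uniquelyRecovers_psd_l02 :
    ∃ c₁ > (0 : ℝ), ∃ c₂ > (0 : ℝ), ∀ (m d k r : ℕ) (X₀ : Matrix (Fin d) (Fin d) ℝ),
      X₀ ≠ 0 → X₀.PosSemidef → IsSL X₀ k k r →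
      c₂ * max ((r : ℝ) * k) ((k : ℝ) * Real.log (d / k)) ≤ m →
      HoldsExceptWithProb (gaussianEnsemble m d d) (Real.exp (-c₁ * m))
        (fun A => UniquelyRecovers
          (fun X => 2 / (k : ℝ) * l02Count X + 1 / (r : ℝ) * X.rank) (symMatrices d) A X₀) := by
  -- Again `f X₀ = 3`; the difference has at most `4r(4k + 4k) = 32rk` parameters.
  refine ⟨1, one_pos, 33, by norm_num, ?_⟩
  intro m d k r X₀ hX₀ hpsd hSL hm
  have hsymm : X₀.transpose = X₀ := by
    rw [← Matrix.conjTranspose_eq_transpose_of_trivial]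
    exact hpsd.isHermitian
  have hk := hSL.l02Count_eq.1
  have hr := hSL.2
  have hkn : 0 < k := hk ▸ l02Count_pos hX₀
  have hrn : 0 < r := hr ▸ rank_pos hX₀
  have hkpos : (0 : ℝ) < k := by exact_mod_cast hkn
  have hrpos : (0 : ℝ) < r := by exact_mod_cast hrn
  have hm' : 33 * (r * k) ≤ m := by
    have := (mul_le_mul_of_nonneg_left (le_max_left ((r : ℝ) * k) _)
      (by norm_num : (0 : ℝ) ≤ 33)).trans hm
    exact_mod_cast this
  refine holdsExceptWithProb_uniquelyRecovers (C := symMatrices d) hsymm (fun X hXs hX => ?_) _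
  simp only [hk, hr, div_mul_cancel₀ _ hkpos.ne', one_div_mul_cancel hrpos.ne'] at hX
  have e₁ : 0 ≤ 1 / (k : ℝ) * l02Count X := by positivity
  have e₂ : 2 / (k : ℝ) * l02Count X = 2 * (1 / (k : ℝ) * l02Count X) := by ring
  have e₃ : 0 ≤ 1 / (r : ℝ) * X.rank := by positivity
  have h₁ : l02Count X ≤ 3 * k := natCast_le_mul_of_div_le hkpos (by push_cast; linarith)
  have h₃ : X.rank ≤ 3 * r := natCast_le_mul_of_div_le hrpos (by push_cast; linarith)
  have g₁ := l02Count_sub_le X X₀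
  have g₃ := rank_sub_le X X₀
  have hXs' : X.transpose = X := hXs
  rw [Matrix.transpose_sub, hXs', hsymm]
  calc (X - X₀).rank * (l02Count (X - X₀) + l02Count (X - X₀))
      ≤ (4 * r) * (4 * k + 4 * k) := Nat.mul_le_mul (by omega) (by omega)
    _ = 32 * (r * k) := by ring
    _ < 33 * (r * k) := by
        have : 0 < r * k := by positivity
        omega
    _ ≤ m := hm'

/-- Here `f X₀ ≤ 2`. A nonzero competitor of rank two would have no nonzero entries left, so it has
rank one and at most `k²` entries; by symmetry its support is a square of side at most `k`. The
difference has rank at most `2` and at most `2k` nonzero rows and columns, that is `8k` parameters.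
-/
theorem uniquelyRecovers_psd_l0_of_le {m d k : ℕ} {X₀ : Matrix (Fin d) (Fin d) ℝ}
    (hpsd : X₀.PosSemidef) (hSL : IsSL X₀ k k 1) (hm : 9 * k ≤ m) (δ : ℝ) :
    HoldsExceptWithProb (gaussianEnsemble m d d) δ
      (fun A => UniquelyRecovers
        (fun X => 1 / (k : ℝ) ^ 2 * l0Count X + X.rank) (symMatrices d) A X₀) := by
  have hsymm : X₀.transpose = X₀ := by
    rw [← Matrix.conjTranspose_eq_transpose_of_trivial]
    exact hpsd.isHermitian
  have hk := hSL.l02Count_eq.1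
  have hr := hSL.2
  have hX₀ : X₀ ≠ 0 := by
    rintro rfl
    simp at hr
  have hkn : 0 < k := hk ▸ l02Count_pos hX₀
  have hkpos : (0 : ℝ) < (k ^ 2 : ℕ) := by positivity
  refine holdsExceptWithProb_uniquelyRecovers (C := symMatrices d) hsymm (fun X hXs hX => ?_) _
  have hXs' : X.transpose = X := hXs
  have hl0 := l0Count_le X₀
  rw [hsymm, hk, ← pow_two] at hl0
  have hX₀2 : 1 / (k : ℝ) ^ 2 * l0Count X₀ ≤ 1 := by
    rw [one_div_mul_eq_div, div_le_one (by positivity)]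
    exact_mod_cast hl0
  simp only [hr, Nat.cast_one] at hX
  have e₁ : 0 ≤ 1 / (k : ℝ) ^ 2 * l0Count X := by positivity
  have hrank2 : X.rank ≤ 2 := by
    have : (X.rank : ℝ) ≤ 2 := by linarith
    exact_mod_cast this
  have hbound : X.rank ≤ 1 ∧ l02Count X ≤ k := by
    by_cases h0 : X = 0
    · simp [h0, l02Count]
    have hpos := rank_pos h0
    have h1 : X.rank = 1 := by
      by_contra hne
      have h2 : X.rank = 2 := by omega
      rw [h2] at hX
      have h3 : 1 / (k : ℝ) ^ 2 * l0Count X ≤ (0 : ℕ) := by push_cast at hX ⊢; linarith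
      rw [← Nat.cast_pow] at h3
      have h4 := natCast_le_mul_of_div_le hkpos h3
      exact h0 (eq_zero_of_l0Count_eq_zero (by omega))
    refine ⟨h1.le, ?_⟩
    rw [h1] at hX
    have h3 : 1 / (k : ℝ) ^ 2 * l0Count X ≤ (1 : ℕ) := by push_cast at hX ⊢; linarith
    rw [← Nat.cast_pow] at h3
    have h4 := natCast_le_mul_of_div_le hkpos h3
    have h5 := le_l0Count_of_rank_eq_one h1
    rw [hXs', ← pow_two] at h5
    exact (Nat.pow_le_pow_iff_left two_ne_zero).1 (h5.trans (h4.trans (by omega)))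
  have g₁ := l02Count_sub_le X X₀
  have g₃ := rank_sub_le X X₀
  rw [Matrix.transpose_sub, hXs', hsymm]
  calc (X - X₀).rank * (l02Count (X - X₀) + l02Count (X - X₀))
      ≤ 2 * (2 * k + 2 * k) := Nat.mul_le_mul (by omega) (by omega)
    _ < 9 * k := by omega
    _ ≤ m := hm

theorem uniquelyRecovers_psd_l0 :
    ∃ c₁ > (0 : ℝ), ∃ c₂ > (0 : ℝ), ∀ (m d k : ℕ) (X₀ : Matrix (Fin d) (Fin d) ℝ),
      X₀.PosSemidef → IsSL X₀ k k 1 →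
      c₂ * max (k : ℝ) ((k : ℝ) * Real.log (d / k)) ≤ m →
      HoldsExceptWithProb (gaussianEnsemble m d d) (Real.exp (-c₁ * m))
        (fun A => UniquelyRecovers
          (fun X => 1 / (k : ℝ) ^ 2 * l0Count X + X.rank) (symMatrices d) A X₀) := by
  refine ⟨1, one_pos, 9, by norm_num, ?_⟩
  intro m d k X₀ hpsd hSL hm
  refine uniquelyRecovers_psd_l0_of_le hpsd hSL ?_ _
  have := (mul_le_mul_of_nonneg_left (le_max_left (k : ℝ) _)
    (by norm_num : (0 : ℝ) ≤ 9)).trans hm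
  exact_mod_cast this

theorem uniquelyRecovers_psd_l0_of_sparse (θ : ℝ) (hθ : 0 < θ) (hθ1 : θ < 1) :
    ∃ c₁ > (0 : ℝ), ∃ c₂ > (0 : ℝ),
      ∀ (m d k : ℕ) (X₀ : Matrix (Fin d) (Fin d) ℝ),
      X₀.PosSemidef → IsSL X₀ k k 1 → (k : ℝ) ≤ θ * d →
      c₂ * ((k : ℝ) * Real.log (d / k)) ≤ m →
      HoldsExceptWithProb (gaussianEnsemble m d d) (Real.exp (-c₁ * m))
        (fun A => UniquelyRecovers
          (fun X => 1 / (k : ℝ) ^ 2 * l0Count X + X.rank) (symMatrices d) A X₀) := by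
  -- For `0 < k ≤ θd`, `log (d/k) ≥ log θ⁻¹ > 0`, so `k log (d/k)` dominates a multiple of `k`.
  have hlog : 0 < Real.log θ⁻¹ := Real.log_pos ((one_lt_inv₀ hθ).2 hθ1)
  refine ⟨1, one_pos, 9 / Real.log θ⁻¹, by positivity, ?_⟩
  intro m d k X₀ hpsd hSL hkd hm
  refine uniquelyRecovers_psd_l0_of_le hpsd hSL ?_ _
  rcases Nat.eq_zero_or_pos k with rfl | hk
  · simp
  have hkpos : (0 : ℝ) < k := by exact_mod_cast hk
  have h1 : Real.log θ⁻¹ ≤ Real.log (d / k) := by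
    refine Real.log_le_log (inv_pos.2 hθ) ?_
    rw [le_div_iff₀ hkpos, inv_mul_le_iff₀ hθ]
    exact hkd
  have h2 : 9 * (k : ℝ) ≤ m := by
    calc 9 * (k : ℝ)
      _ = 9 / Real.log θ⁻¹ * (k * Real.log θ⁻¹) := by
        rw [div_mul_eq_mul_div, eq_div_iff hlog.ne', mul_assoc]
      _ ≤ 9 / Real.log θ⁻¹ * (k * Real.log (d / k)) := by gcongr
      _ ≤ m := hm
  exact_mod_cast h2

end Recovery

end SparseLowRank

theorem mainTheorem1 :
    -- (a1) general model, convex program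
    (∃ c₁ > (0 : ℝ), ∃ c₂ > (0 : ℝ), ∀ (m d₁ d₂ k₁ k₂ r : ℕ) (X₀ : Matrix (Fin d₁) (Fin d₂) ℝ),
      X₀ ≠ 0 → SparseLowRank.IsSL X₀ k₁ k₂ r →
      ∀ m₀ : ℝ, m₀ = min ((d₁ : ℝ) * k₂) (min ((d₂ : ℝ) * k₁) (((d₁ : ℝ) + d₂) * r)) →
      (m : ℝ) ≤ c₂ * m₀ →
      SparseLowRank.HoldsExceptWithProb (SparseLowRank.gaussianEnsemble m d₁ d₂) (Real.exp (-c₁ * m₀))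
        (fun A => ∀ l₁ l₂ : ℝ, 0 ≤ l₁ → 0 ≤ l₂ →
          SparseLowRank.FailsToRecover
            (fun X => SparseLowRank.l12Norm X + l₁ * SparseLowRank.l12Norm X.transpose
              + l₂ * SparseLowRank.nuclearNorm X)
            Set.univ A X₀)) ∧
    -- (a2) general model, nonconvex program
    (∃ c₁ > (0 : ℝ), ∃ c₂ > (0 : ℝ), ∀ (m d₁ d₂ k₁ k₂ r : ℕ) (X₀ : Matrix (Fin d₁) (Fin d₂) ℝ),
      X₀ ≠ 0 → SparseLowRank.IsSL X₀ k₁ k₂ r →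
      c₂ * max (((k₁ : ℝ) + k₂) * r)
        (max ((k₁ : ℝ) * Real.log (d₁ / k₁)) ((k₂ : ℝ) * Real.log (d₂ / k₂))) ≤ m →
      SparseLowRank.HoldsExceptWithProb (SparseLowRank.gaussianEnsemble m d₁ d₂) (Real.exp (-c₁ * m))
        (fun A => SparseLowRank.UniquelyRecovers
          (fun X => 1 / (k₂ : ℝ) * SparseLowRank.l02Count X
            + 1 / (k₁ : ℝ) * SparseLowRank.l02Count X.transpose + 1 / (r : ℝ) * X.rank)
          Set.univ A X₀)) ∧
    -- (b1) positive semidefinite model, convex program with the column norm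
    (∃ c₁ > (0 : ℝ), ∃ c₂ > (0 : ℝ), ∀ (m d k r : ℕ) (X₀ : Matrix (Fin d) (Fin d) ℝ),
      X₀ ≠ 0 → X₀.PosSemidef → SparseLowRank.IsSL X₀ k k r →
      (m : ℝ) ≤ c₂ * ((r : ℝ) * d) →
      SparseLowRank.HoldsExceptWithProb (SparseLowRank.gaussianEnsemble m d d)
        (Real.exp (-c₁ * ((r : ℝ) * d)))
        (fun A => ∀ l : ℝ, 0 ≤ l →
          SparseLowRank.FailsToRecover
            (fun X => SparseLowRank.l12Norm X + l * SparseLowRank.nuclearNorm X)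
            (SparseLowRank.psdCone d) A X₀)) ∧
    -- (b2) positive semidefinite model, nonconvex program with the column count
    (∃ c₁ > (0 : ℝ), ∃ c₂ > (0 : ℝ), ∀ (m d k r : ℕ) (X₀ : Matrix (Fin d) (Fin d) ℝ),
      X₀ ≠ 0 → X₀.PosSemidef → SparseLowRank.IsSL X₀ k k r →
      c₂ * max ((r : ℝ) * k) ((k : ℝ) * Real.log (d / k)) ≤ m →
      SparseLowRank.HoldsExceptWithProb (SparseLowRank.gaussianEnsemble m d d) (Real.exp (-c₁ * m))
        (fun A => SparseLowRank.UniquelyRecovers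
          (fun X => 2 / (k : ℝ) * SparseLowRank.l02Count X + 1 / (r : ℝ) * X.rank)
          (SparseLowRank.symMatrices d) A X₀)) ∧
    -- (c1) positive semidefinite model, convex program with the entrywise norm
    (∃ c₁ > (0 : ℝ), ∃ c₂ > (0 : ℝ), ∀ (m d k r : ℕ) (X₀ : Matrix (Fin d) (Fin d) ℝ),
      X₀ ≠ 0 → X₀.PosSemidef → SparseLowRank.IsSL X₀ k k r →
      ∀ m₀ : ℝ, m₀ = min (SparseLowRank.l1Norm (SparseLowRank.normalized X₀) ^ 2)
        (SparseLowRank.nuclearNorm (SparseLowRank.normalized X₀) ^ 2 * d) →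
      (m : ℝ) ≤ c₂ * m₀ →
      SparseLowRank.HoldsExceptWithProb (SparseLowRank.gaussianEnsemble m d d) (Real.exp (-c₁ * m₀))
        (fun A => ∀ l : ℝ, 0 ≤ l →
          SparseLowRank.FailsToRecover
            (fun X => SparseLowRank.l1Norm X + l * SparseLowRank.nuclearNorm X)
            (SparseLowRank.psdCone d) A X₀)) ∧
    -- (c2) positive semidefinite rank-one model, nonconvex program with the entry count
    (∃ c₁ > (0 : ℝ), ∃ c₂ > (0 : ℝ), ∀ (m d k : ℕ) (X₀ : Matrix (Fin d) (Fin d) ℝ),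
      X₀.PosSemidef → SparseLowRank.IsSL X₀ k k 1 →
      c₂ * max (k : ℝ) ((k : ℝ) * Real.log (d / k)) ≤ m →
      SparseLowRank.HoldsExceptWithProb (SparseLowRank.gaussianEnsemble m d d) (Real.exp (-c₁ * m))
        (fun A => SparseLowRank.UniquelyRecovers
          (fun X => 1 / (k : ℝ) ^ 2 * SparseLowRank.l0Count X + X.rank)
          (SparseLowRank.symMatrices d) A X₀)) ∧
    -- (c2), sparse regime: the sample size `k log (d / k)` suffices when `k / d` stays below 1
    (∀ θ : ℝ, 0 < θ → θ < 1 → ∃ c₁ > (0 : ℝ), ∃ c₂ > (0 : ℝ),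
      ∀ (m d k : ℕ) (X₀ : Matrix (Fin d) (Fin d) ℝ),
      X₀.PosSemidef → SparseLowRank.IsSL X₀ k k 1 → (k : ℝ) ≤ θ * d →
      c₂ * ((k : ℝ) * Real.log (d / k)) ≤ m →
      SparseLowRank.HoldsExceptWithProb (SparseLowRank.gaussianEnsemble m d d) (Real.exp (-c₁ * m))
        (fun A => SparseLowRank.UniquelyRecovers
          (fun X => 1 / (k : ℝ) ^ 2 * SparseLowRank.l0Count X + X.rank)
          (SparseLowRank.symMatrices d) A X₀)) := by
  exact ⟨SparseLowRank.failsToRecover_general, SparseLowRank.uniquelyRecovers_general,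
    SparseLowRank.failsToRecover_psd_l12, SparseLowRank.uniquelyRecovers_psd_l02,
    SparseLowRank.failsToRecover_psd_l1, SparseLowRank.uniquelyRecovers_psd_l0,
    SparseLowRank.uniquelyRecovers_psd_l0_of_sparse⟩
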